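/- **Theorem.** Throughout, a *polyhedron* is a compact connected set $P\subset\mathbb R^3$ whose boundary is a piecewise linear $2$-manifold. A *tetrahedral decomposition* of $P$ is a finite set of non-degenerate tetrahedra with union $P$, any two of which intersect in a (possibly empty) common face; arbitrary vertices (Steiner points) are allowed. Let $b\in P$ (a *beacon*) and $p\in P$. At $x\in P$, a unit vector $u$ is a *steepest direction* towards $b$ if $x+tu\in P$ for all sufficiently small $t\ge 0$, the distance to $b$ decreases at a positive rate in the direction $u$, and no other unit vector $v$ with $x+tv\in P$ for all small $t\ge0$ gives a larger rate of decrease. An *attraction path* of $p$ towards $b$ is a continuous curve in $P$, parametrized by arc length and starting at $p$, which at every time before its end has a right derivative that is a steepest direction towards $b$. The beacon $b$ *covers* $p$ if the attraction path of $p$ towards $b$ ends in $b$. For a finite set $B\subset P$, a point $p\in P$ can be *routed* to $q\in P$ via $B$ if there are $k\ge1$ and $b_1,\dots,b_{k-1}\in B$, $b_k=q$, such that $b_1$ covers $p$ and $b_{i+1}$ covers $b_i$ for $1\le i<k$. 1. (Sufficiency.) If a polyhedron $P$ has a tetrahedral decomposition into $m$ tetrahedra, then there is a set $B\subset P$ of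 at most $\lfloor\frac{m+1}{3}\rfloor$ beacons such that every $p\in P$ can be routed to every $q\in P$ via $B$. 2. (Necessity.) For every $m\ge1$ there is a polyhedron $P$ that has a tetrahedral decomposition into $m$ tetrahedra such that every finite set $B\subset P$ via which every $p\in P$ can be routed to every $q\in P$ has at least $\lfloor\frac{m+1}{3}\rfloor$ elements. The steepest direction may fail to be unique. Part 1 holds even if "$b$ covers $p$" is read in the strict sense that there is an attraction path of $p$ towards $b$ ending in $b$ of which every attraction path of $p$ towards $b$ is an initial part; part 2 holds even if it is read in the generous sense that some attraction path of $p$ towards $b$ ends in $b$. Hence both parts hold for any way of resolving ties. -/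

import Mathlib

/-- Euclidean 3-space. -/
abbrev E3 : Type := EuclideanSpace ℝ (Fin 3)

/-- A finite family of nondegenerate simplices, each given by its set of `k` vertices, any two of
which meet exactly in their (possibly empty) common face, i.e. the hull of the common vertices. -/
structure IsSimplexFamily (k : ℕ) (T : Finset (Finset E3)) : Prop where
  card_eq : ∀ s ∈ T, s.card = k
  affineIndependent : ∀ s ∈ T, AffineIndependent ℝ ((↑) : s → E3)
  inter_eq : ∀ s ∈ T, ∀ t ∈ T,
    convexHull ℝ (s : Set E3) ∩ convexHull ℝ (t : Set E3) =
      convexHull ℝ ((s : Set E3) ∩ (t : Set E3))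

/-- The point set covered by a family of simplices. -/
def carrier (T : Finset (Finset E3)) : Set E3 :=
  ⋃ s ∈ T, convexHull ℝ (s : Set E3)

/-- `a` and `b` are triangles of `T` with a common edge that contains `v`
(possibly `a = b`). -/
def AdjacentAt (T : Finset (Finset E3)) (v : E3) (a b : Finset E3) : Prop :=
  a ∈ T ∧ b ∈ T ∧ ∃ e : Finset E3, e.card = 2 ∧ v ∈ e ∧ e ⊆ a ∧ e ⊆ b

/-- `M` is a compact piecewise linear 2-manifold without boundary: it is triangulated by a finite
family of triangles such that every edge lies in exactly two triangles and the triangles around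
every vertex are connected through common edges at that vertex (so every vertex link is a single
cycle). `M` itself need not be connected. -/
def IsPLSurface (M : Set E3) : Prop :=
  ∃ T : Finset (Finset E3), IsSimplexFamily 3 T ∧ carrier T = M ∧
    (∀ t ∈ T, ∀ e : Finset E3, e ⊆ t → e.card = 2 →
      {s : Finset E3 | s ∈ T ∧ e ⊆ s}.ncard = 2) ∧
    (∀ v : E3, ∀ a ∈ T, ∀ b ∈ T, v ∈ a → v ∈ b → Relation.ReflTransGen (AdjacentAt T v) a b)

/-- A polyhedron: a compact connected set bounded by a piecewise linear 2-manifold. -/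
structure IsPolyhedron (P : Set E3) : Prop where
  isCompact : IsCompact P
  isConnected : IsConnected P
  isPLSurface_frontier : IsPLSurface (frontier P)

/-- `S` is a tetrahedral decomposition of `P`. Arbitrary vertices (Steiner points) are allowed. -/
def IsTetrahedralDecomposition (P : Set E3) (S : Finset (Finset E3)) : Prop :=
  IsSimplexFamily 4 S ∧ carrier S = P

/-- An object at `x` can start to move inside `P` in the direction `u`. -/
def IsFeasibleDirection (P : Set E3) (x u : E3) : Prop :=
  ∃ ε : ℝ, 0 < ε ∧ ∀ t ∈ Set.Icc 0 ε, x + t • u ∈ P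

/-- `u` is a unit direction, feasible at `x`, in which the distance to `b` decreases, and in which
it decreases most rapidly among all feasible directions. (For `x ≠ b` the distance to `b` changes in
the unit direction `u` at the rate `-⟪u, b - x⟫ / ‖b - x‖`.) -/
def IsSteepestDirection (P : Set E3) (b x u : E3) : Prop :=
  ‖u‖ = 1 ∧ IsFeasibleDirection P x u ∧ 0 < inner ℝ u (b - x) ∧
    ∀ v : E3, ‖v‖ = 1 → IsFeasibleDirection P x v → inner ℝ v (b - x) ≤ inner ℝ u (b - x)

/-- `γ`, on `[0, L]`, is an initial part, parametrized by arc length, of an attraction path in `P`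
of the point `p` towards the beacon `b`: at every time it moves on in a direction in which the
distance to `b` decreases most rapidly. -/
structure IsAttractionPath (P : Set E3) (b p : E3) (L : ℝ) (γ : ℝ → E3) : Prop where
  length_nonneg : 0 ≤ L
  start : γ 0 = p
  continuousOn : ContinuousOn γ (Set.Icc 0 L)
  mem : ∀ t ∈ Set.Icc 0 L, γ t ∈ P
  steepest : ∀ t ∈ Set.Ico 0 L, ∃ u : E3,
    IsSteepestDirection P b (γ t) u ∧ HasDerivWithinAt γ u (Set.Ici t) t

/-- The beacon `b` covers `p`, without any ambiguity: the attraction path of `p` towards `b` is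
uniquely determined (every attraction path is an initial part of it), and it ends in `b`. -/
def Covers (P : Set E3) (b p : E3) : Prop :=
  ∃ (L : ℝ) (γ : ℝ → E3), IsAttractionPath P b p L γ ∧ γ L = b ∧
    ∀ (L' : ℝ) (γ' : ℝ → E3), IsAttractionPath P b p L' γ' →
      L' ≤ L ∧ Set.EqOn γ' γ (Set.Icc 0 L')

/-- The beacon `b` covers `p` if ties between several steepest directions are resolved
favourably: some attraction path of `p` towards `b` ends in `b`. -/
def MayCover (P : Set E3) (b p : E3) : Prop :=
  ∃ (L : ℝ) (γ : ℝ → E3), IsAttractionPath P b p L γ ∧ γ L = b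

/-- `p` can be routed towards `q` via the beacons in `B`, where `cov b x` says that `b` covers `x`:
there is a sequence `b₁, …, bₖ = q` (`k ≥ 1`), with `b₁, …, bₖ₋₁` in `B`, such that `b₁` covers `p`
and `bᵢ₊₁` covers `bᵢ`. -/
def CanRoute (cov : E3 → E3 → Prop) (B : Finset E3) (p q : E3) : Prop :=
  ∃ l : List E3, (∀ b ∈ l, b ∈ B) ∧ List.IsChain (fun x b => cov b x) (p :: (l ++ [q]))

/-! Sufficiency. If `p` and `b` lie in one tetrahedron, the segment from `p` to `b` is the only
attraction path, even where `P` is not convex (`covers_of_mem_convexHull`). So it suffices to find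
few vertices that meet every tetrahedron and are connected to each other through common tetrahedra:
a route enters this vertex set, walks through it and leaves it, always between two points of one
tetrahedron.

The dual graph of the decomposition is connected (`exists_card_inter_eq_three`). Otherwise the
tetrahedra split into two parts that meet at most in edges and vertices; `P` would be pinched along
their intersection, and its boundary could not be a surface there (`not_isPLSurface_of_pinched`). A
spanning tree of the dual graph carries a 4-colouring of the vertices of each tetrahedron in which
passing from a node to its child changes the vertex of at most one colour (`exists_isColouredTree`).

The rest is combinatorics of such trees (`IsColouredTree.exists_isConnectedTransversal`). By
induction, one cuts off at least `3k` nodes near a deepest leaf that are all met by `k` points of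
one node, such that these points also meet a remaining node. As three steps change at most three of
the four colours, one point serves a subtree of three nodes together with the parent. One
configuration resists: two branches of length two below `y` whose changed colours are complementary.
There `y` and one branch are cut off, and the other branch is reattached to the parent of `y` with a
degenerate vertex set, which forces a later choice to hit a vertex that the branch really has. This
is why the nodes carry arbitrary families of four points rather than tetrahedra.

Necessity. Stack tetrahedra on consecutive vertices of a zigzag that has three vertices per level
and whose amplitude grows by the factor 4, on alternating sides (`levelVertex`). The plane of three
consecutive vertices separates the next vertex from all earlier ones (`exists_separating_plane`), so
each tetrahedron can be glued on and the result is a polyhedron (`IsTriangulatedBody.glue`). A point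
on its way down past the turn at level `i` would have to move away from every beacon well below that
turn (`norm_sub_lt_of_levels`), whereas attraction never increases the distance. Hence each inner
level needs a beacon of its own in a thin slab, and these slabs are disjoint. -/

open Set Filter Topology

/-! ### Barycentric coordinates and feasible directions in a tetrahedron. -/

/-- The functions `c a`, `a ∈ s`, are the barycentric coordinates with respect to the
tetrahedron with vertex set `s`. -/
structure IsBarycentric (s : Finset E3) (c : E3 → E3 →ᵃ[ℝ] ℝ) : Prop where
  sum_eq_one : ∀ x, ∑ a ∈ s, c a x = 1
  sum_smul : ∀ x, ∑ a ∈ s, c a x • a = x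
  apply_self : ∀ a ∈ s, c a a = 1
  apply_ne : ∀ a ∈ s, ∀ b ∈ s, a ≠ b → c a b = 0

lemma exists_isBarycentric {s : Finset E3} (hcard : s.card = 4)
    (hs : AffineIndependent ℝ ((↑) : s → E3)) : ∃ c, IsBarycentric s c := by
  classical
  have htop : affineSpan ℝ (range ((↑) : s → E3)) = ⊤ := by
    rw [hs.affineSpan_eq_top_iff_card_eq_finrank_add_one]
    simp [hcard]
  let b : AffineBasis s ℝ E3 := ⟨(↑), hs, htop⟩
  refine ⟨fun a => if h : a ∈ s then b.coord ⟨a, h⟩ else AffineMap.const ℝ E3 0, ?_, ?_, ?_, ?_⟩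
  · intro x
    rw [← Finset.sum_coe_sort]
    simpa using b.sum_coord_apply_eq_one x
  · intro x
    rw [← Finset.sum_coe_sort]
    have h1 := b.linear_combination_coord_eq_self x
    have hb : ∀ i : s, b i = (i : E3) := fun i => rfl
    simpa [hb] using h1
  · intro a ha
    simp only [ha, dite_true]
    exact b.coord_apply_eq ⟨a, ha⟩
  · intro a ha c hc hac
    simp only [ha, dite_true]
    exact b.coord_apply_ne (i := ⟨a, ha⟩) (j := ⟨c, hc⟩) (by simpa using hac)

namespace IsBarycentric

variable {s : Finset E3} {c : E3 → E3 →ᵃ[ℝ] ℝ}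

lemma continuous (_ : IsBarycentric s c) (a : E3) : Continuous (c a) :=
  (c a).continuous_of_finiteDimensional

lemma add_smul (_ : IsBarycentric s c) (a x d : E3) (t : ℝ) :
    c a (x + t • d) = c a x + t * (c a).linear d := by
  have h := (c a).map_vadd x (t • d)
  rw [vadd_eq_add, vadd_eq_add, map_smul, smul_eq_mul] at h
  rw [add_comm x, h, add_comm]

lemma mem_convexHull_iff (h : IsBarycentric s c) {f : Finset E3} (hf : f ⊆ s) {x : E3} :
    x ∈ convexHull ℝ (f : Set E3) ↔
      (∀ a ∈ s, 0 ≤ c a x) ∧ ∀ a ∈ s, a ∉ f → c a x = 0 := by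
  classical
  constructor
  · intro hx
    have hconv : Convex ℝ {x | (∀ a ∈ s, 0 ≤ c a x) ∧ ∀ a ∈ s, a ∉ f → c a x = 0} := by
      intro x hx y hy p q hp hq hpq
      have key : ∀ a, c a (p • x + q • y) = p * c a x + q * c a y := fun a => by
        rw [Convex.combo_affine_apply hpq]; simp
      refine ⟨fun a ha => ?_, fun a ha haf => ?_⟩
      · rw [key]
        exact add_nonneg (mul_nonneg hp (hx.1 a ha)) (mul_nonneg hq (hy.1 a ha))
      · rw [key, hx.2 a ha haf, hy.2 a ha haf]; simp
    refine convexHull_min (fun b hb => ?_) hconv hx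
    refine ⟨fun a ha => ?_, fun a ha haf => ?_⟩
    · by_cases hab : a = b
      · subst hab; rw [h.apply_self a ha]; norm_num
      · rw [h.apply_ne a ha b (hf hb) hab]
    · exact h.apply_ne a ha b (hf hb) (fun e => haf (e ▸ hb))
  · rintro ⟨h0, h1⟩
    have e1 : ∑ a ∈ f, c a x = 1 := by
      rw [← h.sum_eq_one x]
      exact Finset.sum_subset hf fun a ha haf => h1 a ha haf
    have e2 : ∑ a ∈ f, c a x • a = x := by
      conv_rhs => rw [← h.sum_smul x]
      exact Finset.sum_subset hf fun a ha haf => by rw [h1 a ha haf, zero_smul]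
    rw [← e2]
    exact (convex_convexHull ℝ (f : Set E3)).sum_mem (fun a ha => h0 a (hf ha)) e1
      (fun a ha => subset_convexHull ℝ _ ha)

lemma mem_convexHull_self_iff (h : IsBarycentric s c) {x : E3} :
    x ∈ convexHull ℝ (s : Set E3) ↔ ∀ a ∈ s, 0 ≤ c a x := by
  rw [h.mem_convexHull_iff subset_rfl]
  exact ⟨fun h => h.1, fun h => ⟨h, fun a ha hn => absurd ha hn⟩⟩

lemma eq_one_of_mem_affine (h : IsBarycentric s c) {g : E3 →ᵃ[ℝ] ℝ} (x : E3) :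
    g x = ∑ a ∈ s, c a x * g a := by
  have := s.map_affineCombination (k := ℝ) (fun a : E3 => a) (fun a => c a x) (h.sum_eq_one x) g
  rw [Finset.affineCombination_eq_linear_combination _ _ _ (h.sum_eq_one x),
    Finset.affineCombination_eq_linear_combination _ _ _ (h.sum_eq_one x), h.sum_smul] at this
  simpa using this

/-- Only the coordinates that vanish at `y` constrain a small move; the positive ones stay positive
by continuity. -/
lemma feasible_of_mem (h : IsBarycentric s c) {y d : E3} (hy : y ∈ convexHull ℝ (s : Set E3))
    (hd : ∀ a ∈ s, 0 < c a y ∨ 0 ≤ (c a).linear d) :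
    IsFeasibleDirection (convexHull ℝ (s : Set E3)) y d := by
  have hy0 := h.mem_convexHull_self_iff.1 hy
  have key : ∀ᶠ t in 𝓝[≥] (0 : ℝ), ∀ a ∈ s, 0 ≤ c a (y + t • d) := by
    rw [Filter.eventually_all_finset]
    intro a ha
    rcases hd a ha with h1 | h1
    · have hcont : ContinuousAt (fun t : ℝ => c a (y + t • d)) 0 :=
        ((h.continuous a).comp (by fun_prop : Continuous fun t : ℝ => y + t • d)).continuousAt
      have : ∀ᶠ t in 𝓝 (0 : ℝ), 0 < c a (y + t • d) :=
        hcont.eventually_const_lt (by simpa using h1)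
      exact (this.filter_mono nhdsWithin_le_nhds).mono fun t ht => ht.le
    · filter_upwards [self_mem_nhdsWithin] with t ht
      rw [h.add_smul]
      exact add_nonneg (hy0 a ha) (mul_nonneg ht h1)
  obtain ⟨ε, hε, hsub⟩ := mem_nhdsGE_iff_exists_Icc_subset.1 key
  exact ⟨ε, hε, fun t ht => h.mem_convexHull_self_iff.2 (hsub ht)⟩

/-- A coordinate that decreases in the direction `d` is either positive at `t₀`, hence still
positive shortly afterwards, or at most zero at `t₀`, hence negative immediately afterwards. In the
second case the curve is outside the tetrahedron and nothing is claimed. -/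
lemma eventually_feasible (h : IsBarycentric s c) {γ : ℝ → E3} {t₀ : ℝ} {d : E3}
    (hγ : HasDerivWithinAt γ d (Ici t₀) t₀) :
    ∀ᶠ t in 𝓝[>] t₀, γ t ∈ convexHull ℝ (s : Set E3) →
      IsFeasibleDirection (convexHull ℝ (s : Set E3)) (γ t) d := by
  have key : ∀ᶠ t in 𝓝[>] t₀, ∀ a ∈ s,
      0 ≤ c a (γ t) → 0 < c a (γ t) ∨ 0 ≤ (c a).linear d := by
    rw [Filter.eventually_all_finset]
    intro a _
    by_cases h1 : 0 ≤ (c a).linear d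
    · exact Eventually.of_forall fun t _ => Or.inr h1
    push Not at h1
    have hγ' : HasDerivWithinAt γ d (Ioi t₀) t₀ := hγ.mono Ioi_subset_Ici_self
    have hder : HasDerivWithinAt (fun t => c a (γ t)) ((c a).linear d) (Ioi t₀) t₀ := by
      have h2 : HasFDerivAt (c a) (LinearMap.toContinuousLinearMap (c a).linear) (γ t₀) := by
        have h3 : (c a : E3 → ℝ) = fun x => LinearMap.toContinuousLinearMap (c a).linear x + c a 0 := by
          funext x
          have := (c a).decomp
          simpa using congrFun this x
        rw [h3]
        exact (ContinuousLinearMap.hasFDerivAt _).add_const _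
      have := h2.comp_hasDerivWithinAt t₀ hγ'
      rw [LinearMap.coe_toContinuousLinearMap'] at this
      exact this
    rcases lt_or_ge 0 (c a (γ t₀)) with h2 | h2
    · have : ∀ᶠ t in 𝓝[>] t₀, 0 < c a (γ t) := hder.continuousWithinAt.eventually_const_lt h2
      exact this.mono fun t ht _ => Or.inl ht
    · have hs := (hasDerivWithinAt_iff_tendsto_slope' (by simp)).1 hder
      have := hs.eventually_lt_const h1
      filter_upwards [this, self_mem_nhdsWithin] with t ht htt h0
      exfalso
      rw [slope_def_field, div_lt_iff₀ (sub_pos.2 htt), zero_mul] at ht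
      linarith
  filter_upwards [key] with t ht hmem
  exact h.feasible_of_mem hmem fun a ha => ht a ha (h.mem_convexHull_self_iff.1 hmem a ha)

end IsBarycentric

lemma IsFeasibleDirection.mono {P Q : Set E3} {x u : E3} (h : IsFeasibleDirection P x u)
    (hPQ : P ⊆ Q) : IsFeasibleDirection Q x u :=
  let ⟨ε, h0, h1⟩ := h
  ⟨ε, h0, fun t ht => hPQ (h1 t ht)⟩

lemma convexHull_subset_carrier {S : Finset (Finset E3)} {s : Finset E3} (hs : s ∈ S) :
    convexHull ℝ (s : Set E3) ⊆ carrier S :=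
  subset_biUnion_of_mem (u := fun s : Finset E3 => convexHull ℝ (s : Set E3)) hs

/-- A direction in which a curve leaves a point of a tetrahedralised set remains feasible along
the curve for a short time. -/
lemma eventually_feasible_carrier {S : Finset (Finset E3)} (hS : IsSimplexFamily 4 S)
    {γ : ℝ → E3} {t₀ : ℝ} {d : E3} (hγ : HasDerivWithinAt γ d (Ici t₀) t₀) :
    ∀ᶠ t in 𝓝[>] t₀, γ t ∈ carrier S → IsFeasibleDirection (carrier S) (γ t) d := by
  have : ∀ᶠ t in 𝓝[>] t₀, ∀ s ∈ S, γ t ∈ convexHull ℝ (s : Set E3) →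
      IsFeasibleDirection (convexHull ℝ (s : Set E3)) (γ t) d := by
    rw [Filter.eventually_all_finset]
    intro s hs
    obtain ⟨c, hc⟩ := exists_isBarycentric (hS.card_eq s hs) (hS.affineIndependent s hs)
    exact hc.eventually_feasible hγ
  filter_upwards [this] with t ht hmem
  obtain ⟨s, hs, hx⟩ := mem_iUnion₂.1 hmem
  exact (ht s hs hx).mono (convexHull_subset_carrier hs)

/-! ### Attraction within one tetrahedron. -/

lemma eq_of_inner_ge {u d : E3} (hu : ‖u‖ = 1) (hd : ‖d‖ = 1) (h : 1 ≤ inner ℝ u d) : u = d := by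
  have h1 : inner ℝ u d = (1 : ℝ) := le_antisymm (by
    have := real_inner_le_norm u d
    rw [hu, hd] at this; linarith) h
  exact (inner_eq_one_iff_of_norm_eq_one hu hd).1 h1

/-- The steepest direction is the direction of the beacon if that is feasible. -/
lemma IsSteepestDirection.eq_of_feasible {P : Set E3} {x u d : E3} {r : ℝ} (hr : 0 < r)
    (hd : ‖d‖ = 1) (hf : IsFeasibleDirection P x d)
    (hu : IsSteepestDirection P (x + r • d) x u) : u = d := by
  have := hu.2.2.2 d hd hf
  rw [add_sub_cancel_left, inner_smul_right, inner_smul_right, real_inner_self_eq_norm_sq, hd] at this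
  refine eq_of_inner_ge hu.1 hd ?_
  have h2 := le_of_mul_le_mul_left this hr
  simpa using h2

lemma antitoneOn_of_rightDeriv_nonpos {f f' : ℝ → ℝ} {a b : ℝ} (hf : ContinuousOn f (Icc a b))
    (hd : ∀ t ∈ Ico a b, HasDerivWithinAt f (f' t) (Ici t) t) (h0 : ∀ t ∈ Ico a b, f' t ≤ 0) :
    AntitoneOn f (Icc a b) := by
  intro x hx y hy hxy
  have := image_le_of_deriv_right_le_deriv_boundary (f := f) (f' := f') (a := x) (b := b)
    (B := fun _ => f x) (B' := fun _ => 0)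
    (hf.mono (Icc_subset_Icc_left hx.1))
    (fun t ht => hd t ⟨hx.1.trans ht.1, ht.2⟩) le_rfl continuousOn_const
    (fun t _ => hasDerivWithinAt_const _ _ _)
    (fun t ht => h0 t ⟨hx.1.trans ht.1, ht.2⟩)
  exact this ⟨hxy, hy.2⟩

lemma hasDerivWithinAt_norm_sq {γ : ℝ → E3} {u : E3} {s : Set ℝ} {t : ℝ}
    (h : HasDerivWithinAt γ u s t) :
    HasDerivWithinAt (fun t => ‖γ t‖ ^ 2) (2 * inner ℝ (γ t) u) s t := by
  have := h.inner ℝ h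
  simp only [real_inner_self_eq_norm_sq] at this
  rwa [real_inner_comm (γ t) u, ← two_mul] at this

/-- Along an attraction path the distance to the beacon decreases. -/
lemma IsAttractionPath.antitoneOn_dist {P : Set E3} {b p : E3} {L : ℝ} {γ : ℝ → E3}
    (h : IsAttractionPath P b p L γ) : AntitoneOn (fun t => ‖b - γ t‖ ^ 2) (Icc 0 L) := by
  classical
  choose! u hu using h.steepest
  refine antitoneOn_of_rightDeriv_nonpos (f' := fun t => 2 * inner ℝ (b - γ t) (-u t)) ?_ ?_ ?_
  · exact ((continuousOn_const.sub h.continuousOn).norm).pow 2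
  · intro t ht
    have := ((hasDerivWithinAt_const t (Ici t) b).sub (hu t ht).2)
    rw [zero_sub] at this
    exact hasDerivWithinAt_norm_sq this
  · intro t ht
    have := (hu t ht).1.2.2.1
    rw [inner_neg_right, real_inner_comm]
    linarith

/-- The direction `d` of the beacon is feasible along the segment, so it is the unique steepest
direction there. Uniqueness of the path needs more, since a competitor might leave the segment with
right derivative `d`. But `d` remains feasible along the competitor for a short time, so the
competitor's direction is at least as steep as `d`, and this forces its distance to the segment
motion to be nonincreasing. -/
lemma covers_of_mem_convexHull {S : Finset (Finset E3)} (hS : IsSimplexFamily 4 S)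
    {s : Finset E3} (hs : s ∈ S) {p b : E3} (hp : p ∈ convexHull ℝ (s : Set E3))
    (hb : b ∈ convexHull ℝ (s : Set E3)) : Covers (carrier S) b p := by
  by_cases hpb : p = b
  · subst hpb
    refine ⟨0, fun _ => p, ⟨le_rfl, rfl, continuousOn_const, fun _ _ => convexHull_subset_carrier hs hp,
      fun t ht => by simp at ht⟩, rfl, fun L' γ' h' => ?_⟩
    have hL : L' ≤ 0 := by
      by_contra hlt
      push Not at hlt
      obtain ⟨u, hu, -⟩ := h'.steepest 0 ⟨le_rfl, hlt⟩
      have := hu.2.2.1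
      rw [h'.start] at this
      simp at this
    refine ⟨hL, fun t ht => ?_⟩
    have : t = 0 := le_antisymm (ht.2.trans hL) ht.1
    rw [this, h'.start]
  set L := ‖b - p‖ with hLdef
  have hL : 0 < L := norm_pos_iff.2 (sub_ne_zero.2 (Ne.symm hpb))
  set d := L⁻¹ • (b - p) with hddef
  have hd : ‖d‖ = 1 := by rw [hddef, norm_smul, norm_inv, Real.norm_of_nonneg hL.le]; exact inv_mul_cancel₀ hL.ne'
  clear_value d L
  have hLd : L • d = b - p := by rw [hddef, smul_smul, mul_inv_cancel₀ hL.ne', one_smul]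
  set γ : ℝ → E3 := fun t => p + t • d with hγdef
  have hγL : γ L = b := by simp [hγdef, hLd]
  have hbγ : ∀ t, b = γ t + (L - t) • d := fun t => by
    rw [← hγL]; simp only [hγdef]; rw [sub_smul]; abel
  have hγmem : ∀ t ∈ Icc 0 L, γ t ∈ convexHull ℝ (s : Set E3) := by
    intro t ht
    have := (convex_convexHull ℝ (s : Set E3)).add_smul_sub_mem hp hb
      (t := t / L) ⟨div_nonneg ht.1 hL.le, (div_le_one hL).2 ht.2⟩
    have e : (t / L) • (b - p) = t • d := by rw [hddef, smul_smul, div_eq_mul_inv]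
    rwa [e] at this
  have hder : ∀ t (S : Set ℝ), HasDerivWithinAt γ d S t := fun t S => by
    have := ((hasDerivAt_id t).smul_const d).const_add p
    rw [one_smul] at this
    exact this.hasDerivWithinAt
  have hfeas : ∀ t ∈ Ico 0 L, IsFeasibleDirection (carrier S) (γ t) d := by
    intro t ht
    refine ⟨L - t, sub_pos.2 ht.2, fun r hr => convexHull_subset_carrier hs ?_⟩
    have : γ t + r • d = γ (t + r) := by simp only [hγdef]; rw [add_smul]; abel
    rw [this]
    exact hγmem _ ⟨add_nonneg ht.1 hr.1, by linarith [hr.2]⟩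
  have hpath : IsAttractionPath (carrier S) b p L γ := by
    refine ⟨hL.le, by simp [hγdef], (by fun_prop : Continuous γ).continuousOn,
      fun t ht => convexHull_subset_carrier hs (hγmem t ht), fun t ht => ⟨d, ⟨hd, hfeas t ht, ?_, ?_⟩,
        hder t _⟩⟩
    · rw [hbγ t, add_sub_cancel_left, inner_smul_right, real_inner_self_eq_norm_sq, hd]
      simpa using ht.2
    · intro v hv _
      rw [hbγ t, add_sub_cancel_left, inner_smul_right, inner_smul_right, real_inner_self_eq_norm_sq, hd]
      refine mul_le_mul_of_nonneg_left ?_ (sub_pos.2 ht.2).le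
      have := real_inner_le_norm v d
      rw [hv, hd] at this
      simpa using this
  refine ⟨L, γ, hpath, hγL, fun L' γ' h' => ?_⟩
  have key : EqOn γ' γ (Icc 0 (min L L')) := by
    have hsub : Icc 0 (min L L') ⊆ Icc 0 L' := Icc_subset_Icc_right (min_le_right _ _)
    have hcl : IsClosed ({t | γ' t = γ t} ∩ Icc 0 (min L L')) := by
      have hc1 : ContinuousOn (fun t => γ' t - γ t) (Icc 0 (min L L')) :=
        (h'.continuousOn.mono hsub).sub (by fun_prop : Continuous γ).continuousOn
      have := hc1.preimage_isClosed_of_isClosed isClosed_Icc (isClosed_singleton (x := (0 : E3)))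
      convert this using 1
      ext t; simp [sub_eq_zero, and_comm]
    -- Continuous induction: the set of times of agreement is closed, and agreement at `t < min L
    -- L'` propagates to the right.
    refine hcl.Icc_subset_of_forall_mem_nhdsWithin (by simp [h'.start, hγdef]) ?_
    rintro t ⟨ht, ht0, ht1⟩
    have htL : t < L := ht1.trans_le (min_le_left _ _)
    have htL' : t < L' := ht1.trans_le (min_le_right _ _)
    simp only [mem_ofPred_eq] at ht
    have hder' : HasDerivWithinAt γ' d (Ici t) t := by
      obtain ⟨u, hu, hud⟩ := h'.steepest t ⟨ht0, htL'⟩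
      rw [ht, hbγ t] at hu
      have := hu.eq_of_feasible (sub_pos.2 htL) hd (hfeas t ⟨ht0, htL⟩)
      rwa [this] at hud
    have hev := (eventually_feasible_carrier hS hder').and (Ioo_mem_nhdsGT ht1)
    obtain ⟨t₁, ht₁, hsub₁⟩ := (mem_nhdsGT_iff_exists_Ioo_subset).1 hev
    have ht₁' : t < t₁ := ht₁
    have hIoo : ∀ r ∈ Ioo t t₁, r < min L L' ∧ IsFeasibleDirection (carrier S) (γ' r) d := by
      intro r hr
      have := hsub₁ hr
      exact ⟨this.2.2, this.1 (h'.mem r ⟨ht0.trans hr.1.le, this.2.2.le.trans (min_le_right _ _)⟩)⟩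
    choose! u hu using h'.steepest
    refine mem_nhdsGT_iff_exists_Ioo_subset.2 ⟨t₁, ht₁, fun r hr => ?_⟩
    have hrlt := (hIoo r hr).1
    have hico : ∀ x ∈ Ico t r, x ∈ Ico 0 L' := fun x hx =>
      ⟨ht0.trans hx.1, (hx.2.trans hrlt).trans_le (min_le_right _ _)⟩
    have hanti : AntitoneOn (fun x => ‖γ' x - γ x‖ ^ 2) (Icc t r) := by
      refine antitoneOn_of_rightDeriv_nonpos
        (f' := fun x => 2 * inner ℝ (γ' x - γ x) (u x - d)) ?_ ?_ ?_
      · refine ((ContinuousOn.sub (h'.continuousOn.mono ?_)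
          (by fun_prop : Continuous γ).continuousOn).norm).pow 2
        exact Icc_subset_Icc ht0 (hrlt.le.trans (min_le_right _ _))
      · intro x hx
        exact hasDerivWithinAt_norm_sq ((hu x (hico x hx)).2.sub (hder x _))
      · intro x hx
        rcases hx.1.eq_or_lt with h1 | h1
        · subst h1; simp [ht]
        · have hf := (hIoo x ⟨h1, hx.2.trans hr.2⟩).2
          have h2 := (hu x (hico x hx)).1.2.2.2 d hd hf
          have hu1 := (hu x (hico x hx)).1.1
          have hxL : 0 < L - x := sub_pos.2 ((hx.2.trans hrlt).trans_le (min_le_left _ _))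
          have e : b - γ' x = (L - x) • d - (γ' x - γ x) := by
            conv_lhs => rw [hbγ x]
            abel
          -- With `b - γ' x = (L - x) • d - (γ' x - γ x)`, this says that half the derivative of the
          -- squared distance is at most `(L - x) * (⟪u x, d⟫ - 1)`, which is not positive.
          have h3 : 0 ≤ inner ℝ (u x - d) (b - γ' x) := by
            rw [inner_sub_left]; linarith
          rw [e, inner_sub_right, inner_smul_right, inner_sub_left (u x) d d,
            real_inner_self_eq_norm_sq, hd, real_inner_comm (γ' x - γ x)] at h3
          have h4 := real_inner_le_norm (u x) d
          rw [hu1, hd] at h4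
          nlinarith [mul_nonneg hxL.le (by linarith : (0:ℝ) ≤ 1 - inner ℝ (u x) d)]
    have hle := hanti (left_mem_Icc.2 hr.1.le) (right_mem_Icc.2 hr.1.le) hr.1.le
    simp only [ht, sub_self, norm_zero] at hle
    have : ‖γ' r - γ r‖ = 0 := by nlinarith [norm_nonneg (γ' r - γ r)]
    exact sub_eq_zero.1 (norm_eq_zero.1 this)
  have hLL : L' ≤ L := by
    by_contra hlt
    push Not at hlt
    -- A longer path would have to continue from `b` itself, where no direction decreases the
    -- distance.
    obtain ⟨u, hu, -⟩ := h'.steepest L ⟨hL.le, hlt⟩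
    have h1 := hu.2.2.1
    rw [key ⟨hL.le, by simp [hlt.le]⟩, hγL] at h1
    simp at h1
  exact ⟨hLL, by simpa [min_eq_right hLL] using key⟩

/-! ### Surfaces cannot bound pinched sets. -/

/-- Completing a triangle to an affine basis gives coordinates for it in space; the coordinate of
the auxiliary vertex `w` vanishes exactly on the plane of the triangle. -/
lemma exists_isBarycentric_insert {t : Finset E3} (hcard : t.card = 3)
    (ht : AffineIndependent ℝ ((↑) : t → E3)) :
    ∃ w, w ∉ t ∧ ∃ c, IsBarycentric (insert w t) c := by
  classical
  obtain ⟨t', hsub, hind, htop⟩ := exists_subset_affineIndependent_affineSpan_eq_top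
    (k := ℝ) (s := (t : Set E3)) ht
  have hfin : t'.Finite := finite_set_of_fin_dim_affineIndependent ℝ hind
  lift t' to Finset E3 using hfin
  have hcard' : t'.card = 4 := by
    have h := hind.affineSpan_eq_top_iff_card_eq_finrank_add_one
    rw [Subtype.range_coe_subtype] at h
    have := h.1 (by simpa using htop)
    simpa using this
  have hsub' : t ⊆ t' := by exact_mod_cast hsub
  obtain ⟨w, hw⟩ : ∃ w, t' \ t = {w} := Finset.card_eq_one.1 (by
    rw [Finset.card_sdiff_of_subset hsub', hcard, hcard'])
  have hw' : w ∈ t' \ t := by rw [hw]; simp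
  have e : insert w t = t' := by
    rw [Finset.insert_eq, ← hw, Finset.sdiff_union_of_subset hsub']
  refine ⟨w, (Finset.mem_sdiff.1 hw').2, ?_⟩
  rw [e]
  exact exists_isBarycentric hcard' hind

/-- A non-constant affine function does not vanish on an open set. -/
lemma exists_affine_ne_zero {ℓ : E3 →ᵃ[ℝ] ℝ} {p q : E3} (hpq : ℓ p ≠ ℓ q) {U : Set E3}
    (hU : IsOpen U) (hne : U.Nonempty) : ∃ y ∈ U, ℓ y ≠ 0 := by
  obtain ⟨x, hx⟩ := hne
  by_cases h : ℓ x ≠ 0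
  · exact ⟨x, hx, h⟩
  push Not at h
  have hc : Continuous fun t : ℝ => x + t • (p - q) := by fun_prop
  have h1 : ∀ᶠ t in 𝓝 (0 : ℝ), x + t • (p - q) ∈ U :=
    hc.continuousAt.eventually (by simpa using hU.mem_nhds hx)
  have h2 : ∀ᶠ t in 𝓝[≠] (0 : ℝ), x + t • (p - q) ∈ U ∧ t ≠ 0 :=
    (h1.filter_mono nhdsWithin_le_nhds).and self_mem_nhdsWithin
  obtain ⟨t, ht, ht0⟩ := h2.exists
  refine ⟨_, ht, ?_⟩
  have e : ℓ (x + t • (p - q)) = ℓ x + t * (ℓ p - ℓ q) := by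
    have h := ℓ.map_vadd x (t • (p - q))
    rw [vadd_eq_add, vadd_eq_add, map_smul, smul_eq_mul] at h
    have h3 : ℓ.linear (p - q) = ℓ p - ℓ q := by
      have := ℓ.linearMap_vsub p q
      simpa using this
    rw [add_comm x, h, h3, add_comm]
  rw [e, h, zero_add]
  exact mul_ne_zero ht0 (sub_ne_zero.2 hpq)

/-- A convex set minus a half-plane is connected. -/
lemma isPreconnected_diff_halfPlane {ℓ g : E3 →ᵃ[ℝ] ℝ} {B : Set E3} (hB : Convex ℝ B) {z : E3}
    (hz : z ∈ B) (hℓ : ℓ z = 0) (hg : g z < 0) :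
    IsPreconnected (B \ {y | ℓ y = 0 ∧ 0 ≤ g y}) := by
  have hz' : z ∈ B \ {y | ℓ y = 0 ∧ 0 ≤ g y} := ⟨hz, fun h => not_lt.2 h.2 hg⟩
  have hstar : StarConvex ℝ z (B \ {y | ℓ y = 0 ∧ 0 ≤ g y}) := by
    intro y hy p q hp hq hpq
    refine ⟨hB hz hy.1 hp hq hpq, fun h => hy.2 ?_⟩
    obtain ⟨h1, h2⟩ := h
    rw [Convex.combo_affine_apply hpq] at h1 h2
    simp only [smul_eq_mul, hℓ, mul_zero, zero_add] at h1 h2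
    rcases hq.eq_or_lt with h3 | h3
    · subst h3
      have : p = 1 := by linarith
      subst this
      exfalso; linarith
    · refine ⟨(mul_eq_zero.1 h1).resolve_left h3.ne', ?_⟩
      by_contra h4
      push Not at h4
      nlinarith [mul_pos h3 (neg_pos.2 h4), mul_nonneg hp (neg_pos.2 hg).le]
  exact (hstar.isPathConnected hz').isConnected.isPreconnected

lemma subset_or_disjoint_of_frontier {U C : Set E3} (hU : IsPreconnected U)
    (h : ∀ y ∈ U, y ∉ frontier C) : U ⊆ C ∨ ∀ y ∈ U, y ∉ C := by
  have hsub : U ⊆ interior C ∪ interior Cᶜ := fun y hy => by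
    by_cases h1 : y ∈ closure C
    · left
      by_contra h2
      exact h y hy ⟨h1, h2⟩
    · right
      rwa [interior_compl]
  rcases hU.subset_or_subset isOpen_interior isOpen_interior
    (disjoint_compl_right.mono interior_subset interior_subset) hsub with h1 | h1
  · exact Or.inl (h1.trans interior_subset)
  · exact Or.inr fun y hy => interior_subset (h1 hy)

/-- If, near `x`, the frontier of a regular closed set is contained in a half-plane bounded by a
line through `x`, then `x` is an interior point. -/
lemma subset_of_frontier_subset_halfPlane {ℓ g : E3 →ᵃ[ℝ] ℝ} {C : Set E3} {x z : E3} {ε : ℝ}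
    (hε : 0 < ε) (hC : IsClosed C) (hreg : C ⊆ closure (interior C)) (hx : x ∈ C)
    (hℓx : ℓ x = 0) (hgx : g x = 0) (hℓz : ℓ z = 0) (hgz : g z < 0) {p : E3} (hp : ℓ p ≠ 0)
    (hfr : ∀ y ∈ Metric.ball x ε, y ∈ frontier C → ℓ y = 0 ∧ 0 ≤ g y) :
    Metric.ball x ε ⊆ C := by
  have hcont : Continuous fun t : ℝ => (1 - t) • x + t • z := by fun_prop
  have h1 : ∀ᶠ t in 𝓝 (0 : ℝ), (1 - t) • x + t • z ∈ Metric.ball x ε :=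
    hcont.continuousAt.eventually (by
      simp only [sub_zero, one_smul, zero_smul, add_zero]
      exact Metric.ball_mem_nhds x hε)
  obtain ⟨t, ht, ht0⟩ := ((h1.filter_mono nhdsWithin_le_nhds).and
    (self_mem_nhdsWithin : ∀ᶠ t in 𝓝[>] (0 : ℝ), t ∈ Ioi 0)).exists
  have hcombo : ∀ f : E3 →ᵃ[ℝ] ℝ, f ((1 - t) • x + t • z) = (1 - t) * f x + t * f z := fun f => by
    rw [Convex.combo_affine_apply (by ring)]; simp
  have hconn := isPreconnected_diff_halfPlane (ℓ := ℓ) (g := g) (convex_ball x ε) ht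
    (by rw [hcombo, hℓx, hℓz]; ring) (by rw [hcombo, hgx]; nlinarith [show (0 : ℝ) < t from ht0])
  have hpx : ℓ p ≠ ℓ x := by rwa [hℓx]
  -- The ball minus the half-plane is connected and free of frontier points, so it is inside or
  -- outside `C`. Inside, closedness adds the half-plane; outside, `C` would lie in a plane near
  -- `x`, against regularity.
  rcases subset_or_disjoint_of_frontier (C := C) hconn (fun y hy hyf => hy.2 (hfr y hy.1 hyf))
    with h2 | h2
  · intro y hy
    by_contra hyC
    obtain ⟨w, hw, hwℓ⟩ := exists_affine_ne_zero hpx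
      (Metric.isOpen_ball.inter hC.isOpen_compl) ⟨y, hy, hyC⟩
    exact hw.2 (h2 ⟨hw.1, fun h => hwℓ h.1⟩)
  · exfalso
    obtain ⟨y, hy1, hy2⟩ := mem_closure_iff.1 (hreg hx) _ Metric.isOpen_ball
      (Metric.mem_ball_self hε)
    obtain ⟨w, hw, hwℓ⟩ := exists_affine_ne_zero hpx
      (Metric.isOpen_ball.inter isOpen_interior) ⟨y, hy1, hy2⟩
    exact h2 w ⟨hw.1, fun h => hwℓ h.1⟩ (interior_subset hw.2)

lemma isClosed_carrier (T : Finset (Finset E3)) : IsClosed (carrier T) :=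
  T.finite_toSet.isClosed_biUnion fun s _ =>
    (s.finite_toSet.isCompact_convexHull ℝ).isClosed

/-- The vertices of the smallest face of `t` that contains `x` belong to every member of the family
that contains `x`. -/
lemma IsSimplexFamily.support_subset {k : ℕ} {T : Finset (Finset E3)} (hT : IsSimplexFamily k T)
    {s t t' : Finset E3} {c : E3 → E3 →ᵃ[ℝ] ℝ} (ht : t ∈ T) (ht' : t' ∈ T) (hts : t ⊆ s)
    (hc : IsBarycentric s c) {x : E3} (hx : x ∈ convexHull ℝ (t : Set E3))
    (hx' : x ∈ convexHull ℝ (t' : Set E3)) {a : E3} (ha : a ∈ s) (hax : c a x ≠ 0) : a ∈ t' := by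
  classical
  have h := hT.inter_eq t ht t' ht'
  have hmem : x ∈ convexHull ℝ ((t ∩ t' : Finset E3) : Set E3) := by
    rw [Finset.coe_inter, ← h]; exact ⟨hx, hx'⟩
  have := ((hc.mem_convexHull_iff (Finset.inter_subset_left.trans hts)).1 hmem).2 a ha
  by_contra hat
  exact hax (this fun h => hat (Finset.mem_inter.1 h).2)

lemma exists_ball_forall_mem_convexHull (T : Finset (Finset E3)) (x : E3) :
    ∀ᶠ y in 𝓝 x, ∀ t ∈ T, y ∈ convexHull ℝ (t : Set E3) → x ∈ convexHull ℝ (t : Set E3) := by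
  rw [Filter.eventually_all_finset]
  intro t _
  by_cases h : x ∈ convexHull ℝ (t : Set E3)
  · exact Eventually.of_forall fun _ _ => h
  · filter_upwards [(t.finite_toSet.isCompact_convexHull ℝ).isClosed.isOpen_compl.mem_nhds h]
      with y hy hyt using absurd hyt hy

set_option maxHeartbeats 2000000 in
/-- A polyhedral surface cannot bound a set that is pinched along an intersection of two
regular closed pieces. -/
theorem not_isPLSurface_of_pinched {Q : Bool → Set E3} (hcl : ∀ i, IsClosed (Q i))
    (hreg : ∀ i, Q i ⊆ closure (interior (Q i)))
    (hsep : ∀ U : Set E3, IsOpen U → Convex ℝ U → U ⊆ (⋃ i, Q i) → ∃ i, ∀ y ∈ U, y ∉ Q i)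
    (hX : (⋂ i, Q i).Nonempty) : ¬ IsPLSurface (frontier (⋃ i, Q i)) := by
  classical
  rintro ⟨T, hT, hcar, hedge, hlink⟩
  have hPcl : IsClosed (⋃ i, Q i) := isClosed_iUnion_of_finite hcl
  have hQP : ∀ i, Q i ⊆ ⋃ i, Q i := subset_iUnion Q
  have hnotall : ∀ {x ε}, 0 < ε → x ∈ frontier (⋃ i, Q i) → ¬ Metric.ball x ε ⊆ ⋃ i, Q i := by
    intro x ε hε hx hsub
    exact hx.2 (mem_interior.2 ⟨_, hsub, Metric.isOpen_ball, Metric.mem_ball_self hε⟩)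
  -- A ball around a common point that is contained in the union would miss one of the pieces by
  -- `hsep`, although its centre belongs to both.
  have hXF : ∀ x, (∀ i, x ∈ Q i) → x ∈ frontier (⋃ i, Q i) := by
    intro x hx
    rw [hPcl.frontier_eq]
    refine ⟨hQP true (hx true), fun hint => ?_⟩
    obtain ⟨ε, hε, hsub⟩ := Metric.isOpen_iff.1 isOpen_interior x hint
    obtain ⟨i, hi⟩ := hsep _ Metric.isOpen_ball (convex_ball x ε) (hsub.trans interior_subset)
    exact hi x (Metric.mem_ball_self hε) (hx i)
  have hfrQ : ∀ i, frontier (Q i) ⊆ frontier (⋃ i, Q i) := by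
    intro i y hy
    have hyQ := (hcl i).frontier_subset hy
    by_cases h : y ∈ Q (!i)
    · refine hXF y fun j => ?_
      cases i <;> cases j <;> simp_all
    · rw [hPcl.frontier_eq]
      refine ⟨hQP i hyQ, fun hint => hy.2 ?_⟩
      have h1 : ∀ᶠ z in 𝓝 y, z ∈ ⋃ i, Q i := mem_interior_iff_mem_nhds.1 hint
      have h2 : ∀ᶠ z in 𝓝 y, z ∉ Q (!i) := (hcl _).isOpen_compl.mem_nhds h
      refine mem_interior_iff_mem_nhds.2 ?_
      filter_upwards [h1, h2] with z hz1 hz2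
      obtain ⟨j, hj⟩ := mem_iUnion.1 hz1
      cases i <;> cases j <;> simp_all
  have hsplit : ∀ M : Set E3, IsPreconnected M → M ⊆ ⋃ i, Q i → (∀ y ∈ M, ¬ ∀ i, y ∈ Q i) →
      ∃ i, M ⊆ Q i := by
    intro M hM hMP hMX
    have := isPreconnected_iff_subset_of_disjoint_closed.1 hM (Q true) (Q false) (hcl _) (hcl _)
      (fun y hy => by
        obtain ⟨j, hj⟩ := mem_iUnion.1 (hMP hy)
        cases j
        · exact Or.inr hj
        · exact Or.inl hj)
      (by
        ext y
        simp only [mem_inter_iff, mem_empty_iff_false, iff_false]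
        rintro ⟨hy, h1, h2⟩
        exact hMX y hy fun i => by cases i <;> assumption)
    rcases this with h | h
    · exact ⟨_, h⟩
    · exact ⟨_, h⟩
  have hTF : ∀ t ∈ T, convexHull ℝ (t : Set E3) ⊆ frontier (⋃ i, Q i) := by
    intro t ht
    rw [← hcar]
    exact convexHull_subset_carrier ht
  have hFT : ∀ {y}, y ∈ frontier (⋃ i, Q i) → ∃ t ∈ T, y ∈ convexHull ℝ (t : Set E3) := by
    intro y hy
    rw [← hcar] at hy
    simpa [carrier] using hy
  have hFP : frontier (⋃ i, Q i) ⊆ ⋃ i, Q i := hPcl.frontier_subset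
  -- no common point lies in the interior of a triangle
  have htri : ∀ x, (∀ i, x ∈ Q i) → ∀ t ∈ T, ∀ w c, w ∉ t → IsBarycentric (insert w t) c →
      x ∈ convexHull ℝ (t : Set E3) → ∃ a ∈ t, c a x = 0 := by
    intro x hx t ht w c hw hc hxt
    by_contra! hpos
    have honly : ∀ t' ∈ T, x ∈ convexHull ℝ (t' : Set E3) → t' = t := by
      intro t' ht' hxt'
      refine (Finset.eq_of_subset_of_card_le (fun a ha => ?_) ?_).symm
      · exact hT.support_subset ht ht' (Finset.subset_insert _ _) hc hxt hxt'
          (Finset.mem_insert_of_mem ha) (hpos a ha)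
      · rw [hT.card_eq t ht, hT.card_eq t' ht']
    obtain ⟨ε, hε, hball⟩ := Metric.eventually_nhds_iff_ball.1
      (exists_ball_forall_mem_convexHull T x)
    have hplane : ∀ y ∈ Metric.ball x ε, y ∈ frontier (⋃ i, Q i) → c w y = 0 := by
      intro y hy hyF
      obtain ⟨t', ht', hyt'⟩ := hFT hyF
      have := honly t' ht' (hball y hy t' ht' hyt')
      subst this
      exact ((hc.mem_convexHull_iff (Finset.subset_insert _ _)).1 hyt').2 w
        (Finset.mem_insert_self _ _) hw
    have hxw : c w x = 0 := hplane x (Metric.mem_ball_self hε) (hXF x hx)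
    have hww : c w w = 1 := hc.apply_self w (Finset.mem_insert_self _ _)
    have hne : c w w ≠ c w x := by rw [hxw, hww]; norm_num
    have hconvp : Convex ℝ {y | 0 < c w y} := by
      have := (convex_Ioi (0 : ℝ)).affine_preimage (c w); exact this
    have hconvn : Convex ℝ {y | c w y < 0} := by
      have := (convex_Iio (0 : ℝ)).affine_preimage (c w); exact this
    have hop : IsOpen {y | 0 < c w y} := isOpen_lt continuous_const (hc.continuous w)
    have hon : IsOpen {y | c w y < 0} := isOpen_lt (hc.continuous w) continuous_const
    have half : ∀ V : Set E3, IsOpen V → Convex ℝ V → (∀ y ∈ V, c w y ≠ 0) →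
        -- Each open half of the ball is either outside the union or inside it, and in either case
        -- it misses at least one piece. As both pieces must occupy some half, both halves are
        -- inside, and by closedness so is the whole ball.
        (∀ i, ∀ y ∈ Metric.ball x ε ∩ V, y ∉ Q i) ∨
        (Metric.ball x ε ∩ V ⊆ (⋃ i, Q i) ∧ ∃ i, ∀ y ∈ Metric.ball x ε ∩ V, y ∉ Q i) := by
      intro V hV hVc hV0
      have hconv := (convex_ball x ε).inter hVc
      rcases subset_or_disjoint_of_frontier hconv.isPreconnected
        (fun y hy hyF => hV0 y hy.2 (hplane y hy.1 hyF)) with h | h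
      · exact Or.inr ⟨h, hsep _ (Metric.isOpen_ball.inter hV) hconv h⟩
      · exact Or.inl fun i y hy hyQ => h y hy (hQP i hyQ)
    have hnoti : ∀ i, ¬ ((∀ y ∈ Metric.ball x ε ∩ {y | 0 < c w y}, y ∉ Q i) ∧
        (∀ y ∈ Metric.ball x ε ∩ {y | c w y < 0}, y ∉ Q i)) := by
      rintro i ⟨h1, h2⟩
      obtain ⟨y, hy1, hy2⟩ := mem_closure_iff.1 (hreg i (hx i)) _ Metric.isOpen_ball
        (Metric.mem_ball_self hε)
      obtain ⟨z, hz, hz0⟩ := exists_affine_ne_zero hne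
        (Metric.isOpen_ball.inter isOpen_interior) ⟨y, hy1, hy2⟩
      rcases lt_or_gt_of_ne hz0 with h3 | h3
      · exact h2 z ⟨hz.1, h3⟩ (interior_subset hz.2)
      · exact h1 z ⟨hz.1, h3⟩ (interior_subset hz.2)
    rcases half _ hop hconvp (fun y hy => ne_of_gt hy) with h1 | ⟨h1, i, h1i⟩ <;>
    rcases half _ hon hconvn (fun y hy => ne_of_lt hy) with h2 | ⟨h2, j, h2j⟩
    · exact hnoti true ⟨h1 _, h2 _⟩
    · exact hnoti j ⟨h1 _, h2j⟩
    · exact hnoti i ⟨h1i, h2 _⟩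
    · refine hnotall hε (hXF x hx) fun y hy => ?_
      by_contra hyP
      obtain ⟨z, hz, hz0⟩ := exists_affine_ne_zero hne
        (Metric.isOpen_ball.inter hPcl.isOpen_compl) ⟨y, hy, hyP⟩
      rcases lt_or_gt_of_ne hz0 with h3 | h3
      · exact hz.2 (h2 ⟨hz.1, h3⟩)
      · exact hz.2 (h1 ⟨hz.1, h3⟩)
  -- no common point lies in the interior of an edge
  have hvert : ∀ x, (∀ i, x ∈ Q i) → ∀ t ∈ T, x ∈ convexHull ℝ (t : Set E3) → x ∈ t := by
    intro x hx t ht hxt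
    obtain ⟨w, hw, c, hc⟩ := exists_isBarycentric_insert (hT.card_eq t ht) (hT.affineIndependent t ht)
    obtain ⟨r, hr, hrx⟩ := htri x hx t ht w c hw hc hxt
    have hct := (hc.mem_convexHull_iff (Finset.subset_insert _ _)).1 hxt
    have hxw : c w x = 0 := hct.2 w (Finset.mem_insert_self _ _) hw
    by_cases hpos : ∃ q ∈ t.erase r, c q x = 0
    · obtain ⟨q, hq, hqx⟩ := hpos
      obtain ⟨p, hp⟩ := Finset.card_eq_one.1 (show ((t.erase r).erase q).card = 1 by
        rw [Finset.card_erase_of_mem hq, Finset.card_erase_of_mem hr, hT.card_eq t ht])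
      have hpt : p ∈ t := by
        have : p ∈ (t.erase r).erase q := by rw [hp]; simp
        exact Finset.mem_of_mem_erase (Finset.mem_of_mem_erase this)
      have hz : ∀ a ∈ insert w t, a ∉ ({p} : Finset E3) → c a x = 0 := by
        intro a ha hap
        rcases Finset.mem_insert.1 ha with rfl | ha
        · exact hxw
        · rw [← hp, Finset.mem_erase, Finset.mem_erase] at hap
          by_cases h1 : a = q
          · rwa [h1]
          by_cases h2 : a = r
          · rwa [h2]
          exact absurd ⟨h1, h2, ha⟩ hap
      have := (hc.mem_convexHull_iff (f := {p}) (by simp [hpt])).2 ⟨hct.1, hz⟩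
      simp at this
      rwa [this]
    exfalso
    push Not at hpos
    -- Now `x` is in the relative interior of the edge `e`, so near `x` the frontier consists of the
    -- two triangles `s` and `t` at `e`.
    set e := t.erase r with he
    have hecard : e.card = 2 := by rw [he, Finset.card_erase_of_mem hr, hT.card_eq t ht]
    have het : e ⊆ t := Finset.erase_subset _ _
    obtain ⟨s, hs⟩ : ∃ s, {s : Finset E3 | s ∈ T ∧ e ⊆ s} ⊆ {s, t} ∧ s ∈ T ∧ e ⊆ s := by
      obtain ⟨u, v, huv, h⟩ := Set.ncard_eq_two.1 (hedge t ht e het hecard)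
      have hu : u ∈ {s : Finset E3 | s ∈ T ∧ e ⊆ s} := by rw [h]; simp
      have hv : v ∈ {s : Finset E3 | s ∈ T ∧ e ⊆ s} := by rw [h]; simp
      have htm : t ∈ {s : Finset E3 | s ∈ T ∧ e ⊆ s} := ⟨ht, het⟩
      rw [h] at htm
      rcases htm with h1 | h1
      · exact ⟨v, by rw [h, h1]; exact (Set.pair_comm _ _).subset, hv⟩
      · exact ⟨u, by rw [h, ← mem_singleton_iff.1 h1], hu⟩
    obtain ⟨hst, hsT, hes⟩ := hs
    obtain ⟨w', hw', c', hc'⟩ :=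
      exists_isBarycentric_insert (hT.card_eq s hsT) (hT.affineIndependent s hsT)
    obtain ⟨r', hr'⟩ : ∃ r', s \ e = {r'} := Finset.card_eq_one.1 (by
      rw [Finset.card_sdiff_of_subset hes, hecard, hT.card_eq s hsT])
    have hr's : r' ∈ s ∧ r' ∉ e := by
      have : r' ∈ s \ e := by rw [hr']; simp
      simpa using this
    have hxe : x ∈ convexHull ℝ (e : Set E3) := by
      refine (hc.mem_convexHull_iff (het.trans (Finset.subset_insert _ _))).2 ⟨hct.1, ?_⟩
      intro a ha hae
      rcases Finset.mem_insert.1 ha with rfl | ha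
      · exact hxw
      · by_cases h : a = r
        · rwa [h]
        · exact absurd (Finset.mem_erase.2 ⟨h, ha⟩) hae
    have hsub' : e ⊆ insert w' s := hes.trans (Finset.subset_insert _ _)
    have hevpos : ∀ᶠ y in 𝓝 x, ∀ a ∈ e, 0 < c a y := by
      rw [Filter.eventually_all_finset]
      intro a ha
      exact (hc.continuous a).continuousAt.eventually_const_lt
        (lt_of_le_of_ne (hct.1 a (Finset.mem_insert_of_mem (het ha))) (hpos a ha).symm)
    obtain ⟨ε, hε, hball⟩ := Metric.eventually_nhds_iff_ball.1
      ((exists_ball_forall_mem_convexHull T x).and hevpos)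
    have htwo : ∀ y ∈ Metric.ball x ε, y ∈ frontier (⋃ i, Q i) →
        y ∈ convexHull ℝ (s : Set E3) ∨ y ∈ convexHull ℝ (t : Set E3) := by
      intro y hy hyF
      obtain ⟨t', ht', hyt'⟩ := hFT hyF
      have h1 := (hball y hy).1 t' ht' hyt'
      have h2 : t' ∈ ({s, t} : Set (Finset E3)) := hst ⟨ht', fun a ha =>
        hT.support_subset ht ht' (Finset.subset_insert _ _) hc hxt h1
          (Finset.mem_insert_of_mem (het ha)) (hpos a ha)⟩
      rcases h2 with rfl | h2
      · exact Or.inl hyt'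
      · rw [mem_singleton_iff.1 h2] at hyt'; exact Or.inr hyt'
    -- The part of `t` near `x` off the edge is convex and has no common points, so it belongs to a
    -- single piece `Q i`. The frontier of the other piece is then confined to `s` near `x`, hence
    -- to a half-plane bounded by the line of `e`.
    set M := (convexHull ℝ (t : Set E3) ∩ Metric.ball x ε) ∩ {y | 0 < c r y} with hM
    have hMX : ∀ y ∈ M, ¬ ∀ i, y ∈ Q i := by
      intro y hy hyX
      obtain ⟨a, ha, hay⟩ := htri y hyX t ht w c hw hc hy.1.1
      by_cases h : a = r
      · rw [h] at hay
        have h0 : 0 < c r y := hy.2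
        exact h0.ne' hay
      · exact ((hball y hy.1.2).2 a (Finset.mem_erase.2 ⟨h, ha⟩)).ne' hay
    have hMconv : Convex ℝ M := ((convex_convexHull ℝ _).inter (convex_ball _ _)).inter
      ((convex_Ioi (0 : ℝ)).affine_preimage (c r))
    obtain ⟨i, hi⟩ := hsplit M hMconv.isPreconnected
      (fun y hy => hFP (hTF t ht hy.1.1)) hMX
    have hw'm : w' ∈ insert w' s := Finset.mem_insert_self _ _
    have hr'm : r' ∈ insert w' s := Finset.mem_insert_of_mem hr's.1
    have hw'e : w' ∉ e := fun h => hw' (hes h)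
    have hxe' := (hc'.mem_convexHull_iff hsub').1 hxe
    obtain ⟨p, hp⟩ : e.Nonempty := Finset.card_pos.1 (by omega)
    have hpr' : r' ≠ p := fun h => hr's.2 (h ▸ hp)
    refine hnotall hε (hXF x hx) ((subset_of_frontier_subset_halfPlane (ℓ := c' w') (g := c' r')
      -- The reflection of `r'` in `p` lies in the plane of `s`, beyond the edge: its
      -- `r'`-coordinate is `-1`.
      (z := AffineMap.lineMap p r' (-1 : ℝ)) (p := w') hε (hcl (!i)) (hreg (!i)) (hx _)
      (hxe'.2 w' hw'm hw'e) (hxe'.2 r' hr'm hr's.2) ?_ ?_ ?_ ?_).trans (hQP _))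
    · rw [AffineMap.apply_lineMap, hc'.apply_ne w' hw'm p (hsub' hp) (fun h => hw'e (h ▸ hp)),
        hc'.apply_ne w' hw'm r' hr'm (fun h => hw' (h ▸ hr's.1))]
      simp
    · rw [AffineMap.apply_lineMap, hc'.apply_self r' hr'm, hc'.apply_ne r' hr'm p (hsub' hp) hpr']
      simp [AffineMap.lineMap_apply]
    · rw [hc'.apply_self w' hw'm]; norm_num
    · intro y hy hyf
      have hyQ := (hcl _).frontier_subset hyf
      have hys : y ∈ convexHull ℝ (s : Set E3) := by
        rcases htwo y hy (hfrQ _ hyf) with h | h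
        · exact h
        · have hyt := (hc.mem_convexHull_iff (Finset.subset_insert _ _)).1 h
          have hle : c r y ≤ 0 := by
            by_contra hlt
            push Not at hlt
            have hyM : y ∈ M := ⟨⟨h, hy⟩, hlt⟩
            refine hMX y hyM fun j => ?_
            have := hi hyM
            cases i <;> cases j <;> simp_all
          have : y ∈ convexHull ℝ (e : Set E3) := by
            refine (hc.mem_convexHull_iff (het.trans (Finset.subset_insert _ _))).2 ⟨hyt.1, ?_⟩
            intro a ha hae
            rcases Finset.mem_insert.1 ha with rfl | ha
            · exact hyt.2 _ (Finset.mem_insert_self _ _) hw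
            · by_cases h' : a = r
              · rw [h']
                exact le_antisymm hle (hyt.1 r (Finset.mem_insert_of_mem hr))
              · exact absurd (Finset.mem_erase.2 ⟨h', ha⟩) hae
          exact convexHull_mono (by exact_mod_cast hes) this
      have := (hc'.mem_convexHull_iff (Finset.subset_insert _ _)).1 hys
      exact ⟨this.2 w' hw'm hw', this.1 r' hr'm⟩
  -- a common point is a vertex; consider the triangles around it
  obtain ⟨x, hx⟩ := hX
  rw [mem_iInter] at hx
  obtain ⟨t₀, ht₀, hxt₀⟩ := hFT (hXF x hx)
  have hxt₀' := hvert x hx t₀ ht₀ hxt₀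
  -- By `hvert`, a triangle without its vertices has no common points. It is convex, being cut out
  -- by the conditions that no coordinate reaches 1, so it lies in one piece.
  have hside : ∀ t ∈ T, ∃ i, convexHull ℝ (t : Set E3) \ t ⊆ Q i := by
    intro t ht
    obtain ⟨w, hw, c, hc⟩ := exists_isBarycentric_insert (hT.card_eq t ht) (hT.affineIndependent t ht)
    have e : convexHull ℝ (t : Set E3) \ t = convexHull ℝ (t : Set E3) ∩ ⋂ a ∈ t, {y | c a y < 1} := by
      ext y
      refine and_congr_right fun hy => ?_
      have hyt := (hc.mem_convexHull_iff (Finset.subset_insert _ _)).1 hy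
      simp only [mem_iInter, Finset.mem_coe, mem_ofPred_eq]
      constructor
      · intro hyn a ha
        by_contra hge
        push Not at hge
        have hsum := hc.sum_eq_one y
        rw [← Finset.add_sum_erase _ _ (Finset.mem_insert_of_mem ha : a ∈ insert w t)] at hsum
        have h0 : ∀ b ∈ (insert w t).erase a, 0 ≤ c b y := fun b hb =>
          hyt.1 b (Finset.mem_of_mem_erase hb)
        have h1 : ∑ b ∈ (insert w t).erase a, c b y = 0 :=
          le_antisymm (by linarith) (Finset.sum_nonneg h0)
        have h2 := (Finset.sum_eq_zero_iff_of_nonneg h0).1 h1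
        have := (hc.mem_convexHull_iff (f := {a}) (by simp [ha])).2 ⟨hyt.1, fun b hb hba =>
          h2 b (Finset.mem_erase.2 ⟨by simpa using hba, hb⟩)⟩
        simp at this
        exact hyn (this ▸ ha)
      · intro h hyt
        have := h y hyt
        rw [hc.apply_self y (Finset.mem_insert_of_mem hyt)] at this
        exact lt_irrefl _ this
    have hconv : Convex ℝ (convexHull ℝ (t : Set E3) \ t) := by
      rw [e]
      refine (convex_convexHull ℝ _).inter (convex_iInter₂ fun a _ => ?_)
      exact (convex_Iio (1 : ℝ)).affine_preimage (c a)
    exact hsplit _ hconv.isPreconnected (fun y hy => hFP (hTF t ht hy.1))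
      (fun y hy hyX => hy.2 (hvert y hyX t ht hy.1))
  obtain ⟨i, hi⟩ := hside t₀ ht₀
  have hall : ∀ t ∈ T, x ∈ t → convexHull ℝ (t : Set E3) \ t ⊆ Q i := by
    intro t ht hxt
    have hchain := hlink x t₀ ht₀ t ht hxt₀' hxt
    clear hxt
    induction hchain with
    | refl => exact hi
    | @tail a b _ hab ih =>
      obtain ⟨ha, hb, e, hecard, -, hea, heb⟩ := hab
      have iha := ih ha
      obtain ⟨j, hj⟩ := hside b hb
      obtain ⟨p, q, hpq, rfl⟩ := Finset.card_eq_two.1 hecard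
      -- The midpoint of a shared edge is in both punctured triangles; if these belonged to
      -- different pieces, it would be a common point other than a vertex.
      have hmem : ∀ t ∈ T, ({p, q} : Finset E3) ⊆ t → midpoint ℝ p q ∈ convexHull ℝ (t : Set E3) \ t := by
        intro t ht hsub
        have hp : p ∈ t := hsub (by simp)
        have hq : q ∈ t := hsub (by simp)
        refine ⟨(convex_convexHull ℝ _).midpoint_mem (subset_convexHull ℝ _ hp)
          (subset_convexHull ℝ _ hq), fun hm => ?_⟩
        obtain ⟨w, hw, c, hc⟩ :=
          exists_isBarycentric_insert (hT.card_eq t ht) (hT.affineIndependent t ht)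
        have h1 : c p (midpoint ℝ p q) = 1 / 2 := by
          rw [AffineMap.map_midpoint, hc.apply_self p (Finset.mem_insert_of_mem hp),
            hc.apply_ne p (Finset.mem_insert_of_mem hp) q (Finset.mem_insert_of_mem hq) hpq]
          simp [midpoint_eq_smul_add]
        by_cases h2 : p = midpoint ℝ p q
        · rw [← h2, hc.apply_self p (Finset.mem_insert_of_mem hp)] at h1
          norm_num at h1
        · rw [hc.apply_ne p (Finset.mem_insert_of_mem hp) _ (Finset.mem_insert_of_mem hm) h2] at h1
          norm_num at h1
      have hma := iha (hmem a ha hea)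
      have hmb := hj (hmem b hb heb)
      by_cases hij : i = j
      · rwa [hij]
      · exfalso
        refine (hmem a ha hea).2 (hvert _ (fun l => ?_) a ha (hmem a ha hea).1)
        cases i <;> cases j <;> cases l <;> simp_all
  have hisol : ∀ᶠ y in 𝓝 x, ∀ t ∈ T, ∀ v ∈ t, y = v → x = v := by
    simp only [Filter.eventually_all_finset]
    intro t _ v _
    by_cases h : x = v
    · exact Eventually.of_forall fun _ _ => h
    · filter_upwards [isOpen_ne.mem_nhds h] with y hy hyv using absurd hyv hy
  obtain ⟨ε, hε, hball⟩ := Metric.eventually_nhds_iff_ball.1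
    ((exists_ball_forall_mem_convexHull T x).and hisol)
  obtain ⟨w, hw, c, hc⟩ :=
    exists_isBarycentric_insert (hT.card_eq t₀ ht₀) (hT.affineIndependent t₀ ht₀)
  obtain ⟨r, hr, hrx⟩ : ∃ r ∈ t₀, r ≠ x := by
    have : 1 < t₀.card := by rw [hT.card_eq t₀ ht₀]; norm_num
    exact Finset.exists_mem_ne this x
  have hxm : x ∈ insert w t₀ := Finset.mem_insert_of_mem hxt₀'
  have hrm : r ∈ insert w t₀ := Finset.mem_insert_of_mem hr
  have hwm : w ∈ insert w t₀ := Finset.mem_insert_self _ _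
  have hwx : w ≠ x := fun h => hw (h ▸ hxt₀')
  have hwr : w ≠ r := fun h => hw (h ▸ hr)
  -- All triangles at `x` belong to `Q i`, so near `x` the other piece has no frontier point except
  -- `x`. Any half-plane with `x` on its bounding line will do.
  refine hnotall hε (hXF x hx) ((subset_of_frontier_subset_halfPlane (ℓ := c w) (g := c r)
    (z := AffineMap.lineMap x r (-1 : ℝ)) (p := w) hε (hcl (!i)) (hreg (!i)) (hx _)
    (hc.apply_ne w hwm x hxm hwx) (hc.apply_ne r hrm x hxm hrx) ?_ ?_ ?_ ?_).trans (hQP _))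
  · rw [AffineMap.apply_lineMap, hc.apply_ne w hwm x hxm hwx, hc.apply_ne w hwm r hrm hwr]
    simp
  · rw [AffineMap.apply_lineMap, hc.apply_self r hrm, hc.apply_ne r hrm x hxm hrx]
    simp [AffineMap.lineMap_apply]
  · rw [hc.apply_self w hwm]; norm_num
  · intro y hy hyf
    have hyx : y = x := by
      have hyF := hfrQ _ hyf
      have hyQ := (hcl _).frontier_subset hyf
      obtain ⟨t, ht, hyt⟩ := hFT hyF
      have hxt := hvert x hx t ht ((hball y hy).1 t ht hyt)
      by_contra hne
      by_cases hyt' : y ∈ t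
      · exact hne ((hball y hy).2 t ht y hyt' rfl).symm
      · have hyi := hall t ht hxt ⟨hyt, hyt'⟩
        refine hyt' (hvert y (fun j => ?_) t ht hyt)
        cases i <;> cases j <;> simp_all
    rw [hyx]
    exact ⟨hc.apply_ne w hwm x hxm hwx, (hc.apply_ne r hrm x hxm hrx).ge⟩

/-! ### Connectedness of the dual graph. -/

/-- General position: proper affine subspaces have measure zero, nonempty open sets do not. -/
lemma exists_mem_open_forall_notMem {ι : Type*} (s : Finset ι) (A : ι → AffineSubspace ℝ E3)
    (hA : ∀ i ∈ s, A i ≠ ⊤) {U : Set E3} (hU : IsOpen U) (hne : U.Nonempty) :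
    ∃ y ∈ U, ∀ i ∈ s, y ∉ A i := by
  by_contra! h
  have h1 : U ⊆ ⋃ i ∈ s, (A i : Set E3) := fun y hy => by
    obtain ⟨i, hi, hyi⟩ := h y hy
    exact mem_biUnion hi hyi
  have h2 : MeasureTheory.volume (⋃ i ∈ s, (A i : Set E3)) = 0 :=
    (MeasureTheory.measure_biUnion_null_iff s.countable_toSet).2 fun i hi =>
      MeasureTheory.Measure.addHaar_affineSubspace _ _ (hA i hi)
  exact (hU.measure_pos MeasureTheory.volume hne).ne' (MeasureTheory.measure_mono_null h1 h2)

lemma affineSpan_ne_top_of_card_le {s : Finset E3} (hs : s.card ≤ 3) :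
    affineSpan ℝ (s : Set E3) ≠ ⊤ := by
  intro h
  rcases s.eq_empty_or_nonempty with rfl | hne
  · simp at h
  have h1 := finrank_vectorSpan_range_le ℝ ((↑) : s → E3) (n := s.card - 1) (by
    have := hne.card_pos
    rw [Fintype.card_coe]; omega)
  have h2 : vectorSpan ℝ (range ((↑) : s → E3)) = ⊤ := by
    rw [Subtype.range_coe_subtype]
    rw [← direction_affineSpan]
    change (affineSpan ℝ (s : Set E3)).direction = ⊤
    rw [h, AffineSubspace.direction_top]
  rw [h2, finrank_top] at h1
  simp at h1
  omega

lemma IsSimplexFamily.subset_closure_interior {T : Finset (Finset E3)} (hT : IsSimplexFamily 4 T) :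
    carrier T ⊆ closure (interior (carrier T)) := by
  refine iUnion₂_subset fun s hs => ?_
  have hint : (interior (convexHull ℝ (s : Set E3))).Nonempty := by
    rw [interior_convexHull_nonempty_iff_affineSpan_eq_top]
    have := ((hT.affineIndependent s hs).affineSpan_eq_top_iff_card_eq_finrank_add_one).2
      (by simp [hT.card_eq s hs])
    rwa [Subtype.range_coe_subtype] at this
  have h1 := (convex_convexHull ℝ (s : Set E3)).closure_interior_eq_closure_of_nonempty_interior hint
  calc convexHull ℝ (s : Set E3) ⊆ closure (convexHull ℝ (s : Set E3)) := subset_closure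
    _ = closure (interior (convexHull ℝ (s : Set E3))) := h1.symm
    _ ⊆ _ := closure_mono (interior_mono (convexHull_subset_carrier hs))

lemma IsSimplexFamily.subset {k : ℕ} {T T' : Finset (Finset E3)} (hT : IsSimplexFamily k T)
    (h : T' ⊆ T) : IsSimplexFamily k T' :=
  ⟨fun s hs => hT.card_eq s (h hs), fun s hs => hT.affineIndependent s (h hs),
    fun s hs t ht => hT.inter_eq s (h hs) t (h ht)⟩

/-- Two parts of a family of tetrahedra without common triangles cannot both meet an open convex
subset of the union. -/
lemma disjoint_of_card_inter_le {S T : Finset (Finset E3)} (hS : IsSimplexFamily 4 S)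
    (hT : IsSimplexFamily 4 T)
    (hST : ∀ s ∈ S, ∀ t ∈ T, convexHull ℝ (s : Set E3) ∩ convexHull ℝ (t : Set E3) =
      convexHull ℝ ((s : Set E3) ∩ (t : Set E3)))
    (hcard : ∀ s ∈ S, ∀ t ∈ T, ∀ e : Finset E3, e ⊆ s → e ⊆ t → e.card ≤ 2)
    {U : Set E3} (hU : IsOpen U) (hconv : Convex ℝ U) (hsub : U ⊆ carrier S ∪ carrier T) :
    (∀ y ∈ U, y ∉ carrier S) ∨ ∀ y ∈ U, y ∉ carrier T := by
  classical
  by_contra! hcon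
  obtain ⟨⟨x, hx, hxS⟩, y, hy, hyT⟩ := hcon
  have hx' := mem_closure_iff.1 (hS.subset_closure_interior hxS) U hU hx
  have hy' := mem_closure_iff.1 (hT.subset_closure_interior hyT) U hU hy
  -- Choose `a` inside one part and off the lines spanned by the common edges, then `b` inside the
  -- other part and off the planes spanned by `a` and these edges. The segment from `a` to `b` stays
  -- in `U` and has to pass from one part to the other through a common edge, which puts `b` into
  -- such a plane.
  obtain ⟨a, ha, haA⟩ := exists_mem_open_forall_notMem (S ×ˢ T)
    (fun p => affineSpan ℝ ((p.1 ∩ p.2 : Finset E3) : Set E3)) (fun p hp => by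
      rw [Finset.mem_product] at hp
      exact affineSpan_ne_top_of_card_le ((hcard _ hp.1 _ hp.2 _ Finset.inter_subset_left
        Finset.inter_subset_right).trans (by norm_num))) (hU.inter isOpen_interior) hx'
  obtain ⟨b, hb, hbA⟩ := exists_mem_open_forall_notMem (S ×ˢ T)
    (fun p => affineSpan ℝ ((insert a (p.1 ∩ p.2) : Finset E3) : Set E3)) (fun p hp => by
      rw [Finset.mem_product] at hp
      refine affineSpan_ne_top_of_card_le ((Finset.card_insert_le _ _).trans ?_)
      have := hcard _ hp.1 _ hp.2 _ Finset.inter_subset_left Finset.inter_subset_right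
      omega) (hU.inter isOpen_interior) hy'
  have hseg : segment ℝ a b ⊆ U := hconv.segment_subset ha.1 hb.1
  obtain ⟨z, hz, hzS, hzT⟩ := isPreconnected_closed_iff.1 (convex_segment a b).isPreconnected
    _ _ (isClosed_carrier S) (isClosed_carrier T) (hseg.trans hsub)
    ⟨a, left_mem_segment ℝ a b, interior_subset ha.2⟩
    ⟨b, right_mem_segment ℝ a b, interior_subset hb.2⟩
  obtain ⟨s, hs, hzs⟩ := mem_iUnion₂.1 hzS
  obtain ⟨t, ht, hzt⟩ := mem_iUnion₂.1 hzT
  have hzst : z ∈ convexHull ℝ ((s ∩ t : Finset E3) : Set E3) := by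
    rw [Finset.coe_inter, ← hST s hs t ht]; exact ⟨hzs, hzt⟩
  have hst : (s, t) ∈ S ×ˢ T := Finset.mem_product.2 ⟨hs, ht⟩
  have hzspan := convexHull_subset_affineSpan (𝕜 := ℝ) _ hzst
  rw [segment_eq_image_lineMap] at hz
  obtain ⟨r, hr, rfl⟩ := hz
  have hr0 : r ≠ 0 := by
    rintro rfl
    rw [AffineMap.lineMap_apply_zero] at hzspan
    exact haA _ hst hzspan
  have hA1 : a ∈ affineSpan ℝ ((insert a (s ∩ t) : Finset E3) : Set E3) :=
    subset_affineSpan ℝ _ (by simp)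
  have hA2 : AffineMap.lineMap a b r ∈ affineSpan ℝ ((insert a (s ∩ t) : Finset E3) : Set E3) :=
    affineSpan_mono ℝ (by exact_mod_cast Finset.subset_insert _ _) hzspan
  have := AffineMap.lineMap_mem r⁻¹ hA1 hA2
  rw [AffineMap.lineMap_lineMap_right, inv_mul_cancel₀ hr0, AffineMap.lineMap_apply_one] at this
  exact hbA _ hst this

/-- The dual graph of a tetrahedral decomposition of a polyhedron is connected. -/
theorem exists_card_inter_eq_three {P : Set E3} {S S₁ : Finset (Finset E3)} [DecidableEq E3]
    (hP : IsPolyhedron P) (hS : IsTetrahedralDecomposition P S) (hsub : S₁ ⊆ S)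
    (hne : S₁.Nonempty) (hne' : S₁ ≠ S) :
    ∃ s ∈ S₁, ∃ t ∈ S, t ∉ S₁ ∧ (s ∩ t).card = 3 := by
  classical
  obtain ⟨hS, rfl⟩ := hS
  -- If no triangle is shared, `S₁` and its complement meet only in faces with at most two vertices.
  -- They still have a common point because `P` is connected, so `P` is pinched there.
  by_contra! hcon
  set S₂ := S \ S₁ with hS₂
  have h1 := hS.subset hsub
  have h2 : IsSimplexFamily 4 S₂ := hS.subset Finset.sdiff_subset
  have hne₂ : S₂.Nonempty := Finset.sdiff_nonempty.2 fun h => hne' (hsub.antisymm h)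
  have hcarne : ∀ {T : Finset (Finset E3)}, IsSimplexFamily 4 T → T.Nonempty → (carrier T).Nonempty := by
    rintro T hT ⟨s, hs⟩
    obtain ⟨a, ha⟩ : s.Nonempty := Finset.card_pos.1 (by rw [hT.card_eq s hs]; norm_num)
    exact ⟨a, convexHull_subset_carrier hs (subset_convexHull ℝ _ ha)⟩
  have hcard : ∀ s ∈ S₁, ∀ t ∈ S₂, ∀ e : Finset E3, e ⊆ s → e ⊆ t → e.card ≤ 2 := by
    intro s hs t ht e hes het
    rw [hS₂, Finset.mem_sdiff] at ht
    have h3 := hcon s hs t ht.1 ht.2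
    have h4 : e.card ≤ (s ∩ t).card := Finset.card_le_card (Finset.subset_inter hes het)
    have h5 : (s ∩ t).card < 4 := by
      rw [← hS.card_eq s (hsub hs)]
      refine Finset.card_lt_card ⟨Finset.inter_subset_left, fun h => ht.2 ?_⟩
      have : s = t := Finset.eq_of_subset_of_card_le (h.trans Finset.inter_subset_right)
        (by rw [hS.card_eq s (hsub hs), hS.card_eq t ht.1])
      rwa [← this]
    omega
  have hunion : carrier S₁ ∪ carrier S₂ = carrier S := by
    simp only [carrier, ← Finset.set_biUnion_union, hS₂, Finset.union_sdiff_of_subset hsub]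
  let Q : Bool → Set E3 := fun i => if i then carrier S₁ else carrier S₂
  have hQ : ⋃ i, Q i = carrier S := by
    rw [← hunion, union_eq_iUnion]
    refine iUnion_congr fun b => ?_
    cases b <;> simp [Q]
  have hPL := hP.isPLSurface_frontier
  rw [← hQ] at hPL
  refine not_isPLSurface_of_pinched (Q := Q) (fun i => ?_) (fun i => ?_) (fun U hU hc hUQ => ?_) ?_ hPL
  · cases i <;> simp only [Q] <;> exact isClosed_carrier _
  · cases i
    · simpa [Q] using h2.subset_closure_interior
    · simpa [Q] using h1.subset_closure_interior
  · rw [hQ, ← hunion] at hUQ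
    rcases disjoint_of_card_inter_le h1 h2
      (fun s hs t ht => hS.inter_eq s (hsub hs) t (Finset.sdiff_subset ht)) hcard hU hc hUQ with h | h
    · exact ⟨true, by simpa [Q] using h⟩
    · exact ⟨false, by simpa [Q] using h⟩
  · have hc := hP.isConnected.isPreconnected
    rw [← hunion] at hc
    obtain ⟨a, ha⟩ := hcarne h1 hne
    obtain ⟨b, hb⟩ := hcarne h2 hne₂
    obtain ⟨x, -, hx1, hx2⟩ := isPreconnected_closed_iff.1 hc _ _ (isClosed_carrier S₁)
      (isClosed_carrier S₂) subset_rfl ⟨a, Or.inl ha, ha⟩ ⟨b, Or.inr hb, hb⟩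
    refine ⟨x, mem_iInter.2 fun i => ?_⟩
    cases i <;> simpa [Q]

/-! ### Small connected transversals of coloured trees. -/

section ColouredTree

set_option linter.unusedSectionVars false

variable {ι V : Type*} [DecidableEq ι] [DecidableEq V]

/-- A finite rooted tree `W` with root `r`, parent function `par` and depth function `dep`, each
node `i` of which carries a 4-coloured set `g i`, where a node differs from its parent in at most
one colour. -/
structure IsColouredTree (W : Finset ι) (r : ι) (par : ι → ι) (dep : ι → ℕ) (g : ι → Fin 4 → V) :
    Prop where
  root_mem : r ∈ W
  par_mem : ∀ i ∈ W, i ≠ r → par i ∈ W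
  dep_par : ∀ i ∈ W, i ≠ r → dep i = dep (par i) + 1
  dep_root : dep r = 0
  colour : ∀ i ∈ W, i ≠ r → ∃ c, ∀ k ≠ c, g i k = g (par i) k

/-- `a` and `b` belong to `B` and to a common node. -/
def Linked (W : Finset ι) (g : ι → Fin 4 → V) (B : Finset V) (a b : V) : Prop :=
  a ∈ B ∧ b ∈ B ∧ ∃ i ∈ W, a ∈ range (g i) ∧ b ∈ range (g i)

/-- `B` is a set of at most `n` points that meets all nodes and is connected by common nodes. -/
structure IsConnectedTransversal (W : Finset ι) (g : ι → Fin 4 → V) (n : ℕ) (B : Finset V) :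
    Prop where
  card_le : B.card ≤ n
  meets : ∀ i ∈ W, ∃ k, g i k ∈ B
  mem : ∀ a ∈ B, ∃ i ∈ W, a ∈ range (g i)
  connected : ∀ a ∈ B, ∀ b ∈ B, Relation.ReflTransGen (Linked W g B) a b

lemma exists_isConnectedTransversal_of_subset_node {W : Finset ι} {g : ι → Fin 4 → V} {n : ℕ}
    {B : Finset V} {j : ι} (hn : B.card ≤ n) (hj : j ∈ W) (hB : ∀ a ∈ B, a ∈ range (g j))
    (h : ∀ i ∈ W, ∃ k, g i k ∈ B) : ∃ B, IsConnectedTransversal W g n B :=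
  ⟨B, hn, h, fun a ha => ⟨j, hj, hB a ha⟩, fun a ha b hb =>
    Relation.ReflTransGen.single ⟨ha, hb, j, hj, hB a ha, hB b hb⟩⟩

/-- Extension of a connected transversal of a smaller system by `k` new points of one node. -/
lemma exists_isConnectedTransversal_extend {W W' : Finset ι} {g g' : ι → Fin 4 → V} {k : ℕ}
    {C : Finset V} {x j : ι} (hcard : W'.card + 3 * k ≤ W.card) (hk : C.card ≤ k) (hx : x ∈ W')
    (hxC : ∃ c, g' x c ∈ C) (hj : j ∈ W) (hC : ∀ a ∈ C, a ∈ range (g j))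
    (hrange : ∀ i ∈ W', ∃ j ∈ W, range (g' i) ⊆ range (g j))
    (hmeets : ∀ B, C ⊆ B → (∀ i ∈ W', ∃ c, g' i c ∈ B) → ∀ i ∈ W, ∃ c, g i c ∈ B)
    (ih : 2 ≤ W'.card → ∃ B, IsConnectedTransversal W' g' ((W'.card + 1) / 3) B) :
    ∃ B, IsConnectedTransversal W g ((W.card + 1) / 3) B := by
  -- The bound is false for one node, where it would be 0, so that case is separate: the node `x` is
  -- then already met by `C`.
  by_cases h2 : 2 ≤ W'.card
  · obtain ⟨B, hB⟩ := ih h2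
    have hBW : ∀ {a b}, Linked W' g' B a b → Linked W g (B ∪ C) a b := by
      rintro a b ⟨ha, hb, i, hi, hai, hbi⟩
      obtain ⟨j, hj, hij⟩ := hrange i hi
      exact ⟨Finset.mem_union_left _ ha, Finset.mem_union_left _ hb, j, hj, hij hai, hij hbi⟩
    have hBB : ∀ a ∈ B, ∀ b ∈ B, Relation.ReflTransGen (Linked W g (B ∪ C)) a b :=
      fun a ha b hb =>
      Relation.ReflTransGen.lift id (fun _ _ => hBW) _ _ (hB.connected a ha b hb)
    have hCC : ∀ a ∈ C, ∀ b ∈ C, Relation.ReflTransGen (Linked W g (B ∪ C)) a b :=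
      fun a ha b hb => Relation.ReflTransGen.single
        ⟨Finset.mem_union_right _ ha, Finset.mem_union_right _ hb, j, hj, hC a ha, hC b hb⟩
    obtain ⟨c, hc⟩ := hxC
    obtain ⟨d, hd⟩ := hB.meets x hx
    obtain ⟨l, hl, hxl⟩ := hrange x hx
    -- The old and the new points are connected through `x`, which is met by both sets.
    have hcd : Linked W g (B ∪ C) (g' x c) (g' x d) :=
      ⟨Finset.mem_union_right _ hc, Finset.mem_union_left _ hd, l, hl, hxl ⟨c, rfl⟩, hxl ⟨d, rfl⟩⟩
    have hdc : Linked W g (B ∪ C) (g' x d) (g' x c) :=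
      ⟨hcd.2.1, hcd.1, l, hl, hxl ⟨d, rfl⟩, hxl ⟨c, rfl⟩⟩
    refine ⟨B ∪ C, ?_, hmeets _ Finset.subset_union_right fun i hi => ?_, fun a ha => ?_,
      fun a ha b hb => ?_⟩
    · refine (Finset.card_union_le _ _).trans ?_
      have := hB.card_le
      omega
    · obtain ⟨e, he⟩ := hB.meets i hi
      exact ⟨e, Finset.mem_union_left _ he⟩
    · rcases Finset.mem_union.1 ha with ha | ha
      · obtain ⟨i, hi, hai⟩ := hB.mem a ha
        obtain ⟨j, hj, hij⟩ := hrange i hi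
        exact ⟨j, hj, hij hai⟩
      · exact ⟨j, hj, hC a ha⟩
    · rcases Finset.mem_union.1 ha with ha | ha <;> rcases Finset.mem_union.1 hb with hb | hb
      · exact hBB a ha b hb
      · exact ((hBB a ha _ hd).tail hdc).trans (hCC _ hc b hb)
      · exact ((hCC a ha _ hc).tail hcd).trans (hBB _ hd b hb)
      · exact hCC a ha b hb
  · have h1 : W' = {x} := by
      have : W'.card = 1 := by
        have := Finset.card_pos.2 ⟨x, hx⟩
        omega
      obtain ⟨z, rfl⟩ := Finset.card_eq_one.1 this
      rw [Finset.mem_singleton.1 hx]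
    refine exists_isConnectedTransversal_of_subset_node (B := C) ?_ hj hC
      (hmeets C subset_rfl fun i hi => ?_)
    · omega
    · rw [h1, Finset.mem_singleton] at hi
      rwa [hi]

namespace IsColouredTree

variable {W : Finset ι} {r : ι} {par : ι → ι} {dep : ι → ℕ} {g : ι → Fin 4 → V}

/-- The children of a node. -/
def children (W : Finset ι) (r : ι) (par : ι → ι) (y : ι) : Finset ι :=
  W.filter fun i => i ≠ r ∧ par i = y

lemma mem_children {y i : ι} : i ∈ children W r par y ↔ i ∈ W ∧ i ≠ r ∧ par i = y :=
  Finset.mem_filter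

lemma sdiff (h : IsColouredTree W r par dep g) {U : Finset ι} (hr : r ∉ U)
    (hU : ∀ y ∈ U, children W r par y ⊆ U) : IsColouredTree (W \ U) r par dep g where
  root_mem := Finset.mem_sdiff.2 ⟨h.root_mem, hr⟩
  par_mem i hi hir := by
    rw [Finset.mem_sdiff] at hi ⊢
    exact ⟨h.par_mem i hi.1 hir, fun hp => hi.2 (hU _ hp (mem_children.2 ⟨hi.1, hir, rfl⟩))⟩
  dep_par i hi := h.dep_par i (Finset.mem_sdiff.1 hi).1
  dep_root := h.dep_root
  colour i hi := h.colour i (Finset.mem_sdiff.1 hi).1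

/-- Removal of a part `U` of the tree, whose nodes and a remaining node `x` are met by `k` points
of a node `j`. -/
lemma exists_of_sdiff (h : IsColouredTree W r par dep g) {U : Finset ι} {k : ℕ} {C : Finset V}
    {x j : ι} (hUW : U ⊆ W) (hr : r ∉ U) (hU : ∀ y ∈ U, children W r par y ⊆ U)
    (hcard : 3 * k ≤ U.card) (hk : C.card ≤ k) (hx : x ∈ W) (hxU : x ∉ U) (hj : j ∈ W)
    (hC : ∀ a ∈ C, a ∈ range (g j)) (hxC : ∃ c, g x c ∈ C) (hUC : ∀ i ∈ U, ∃ c, g i c ∈ C)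
    (ih : IsColouredTree (W \ U) r par dep g → 2 ≤ (W \ U).card →
      ∃ B, IsConnectedTransversal (W \ U) g (((W \ U).card + 1) / 3) B) :
    ∃ B, IsConnectedTransversal W g ((W.card + 1) / 3) B := by
  refine exists_isConnectedTransversal_extend (W' := W \ U) (g' := g) (x := x) (j := j) ?_ hk
    (Finset.mem_sdiff.2 ⟨hx, hxU⟩) hxC hj hC (fun i hi => ⟨i, (Finset.mem_sdiff.1 hi).1, subset_rfl⟩)
    (fun B hCB hB i hi => ?_) (ih (h.sdiff hr hU))
  · have := Finset.card_sdiff_add_card_eq_card hUW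
    omega
  · by_cases hiU : i ∈ U
    · obtain ⟨c, hc⟩ := hUC i hiU
      exact ⟨c, hCB hc⟩
    · exact hB i (Finset.mem_sdiff.2 ⟨hi, hiU⟩)

end IsColouredTree

lemma exists_ne_three (a b c : Fin 4) : ∃ k, k ≠ a ∧ k ≠ b ∧ k ≠ c := by
  revert a b c; decide

/-- Two pairs that cover the four colours are complementary. Used for the colours changed along two
branches of length two, with `δ` the colour changed at their common parent. -/
lemma exists_of_cover (a b a' b' δ : Fin 4) (h : ∀ k, k ∈ ({a, b} : Finset (Fin 4)) ∨
    k ∈ ({a', b'} : Finset (Fin 4))) (hδ : δ ∈ ({a, b} : Finset (Fin 4))) :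
    (∃ κ, κ ≠ δ ∧ κ ∉ ({a', b'} : Finset (Fin 4))) ∧ a' ∉ ({a, b} : Finset (Fin 4)) := by
  revert a b a' b' δ; decide

/-- There are six pairs of colours, and each of the three sets contains at most one of them. -/
lemma exists_pair_not_subset {s₁ s₂ s₃ : Finset (Fin 4)} (h₁ : s₁.card ≤ 2) (h₂ : s₂.card ≤ 2)
    (h₃ : s₃.card ≤ 2) :
    ∃ e : Finset (Fin 4), e.card = 2 ∧ ¬ e ⊆ s₁ ∧ ¬ e ⊆ s₂ ∧ ¬ e ⊆ s₃ := by
  have hlt : ({s₁, s₂, s₃} : Finset (Finset (Fin 4))).card <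
      (Finset.powersetCard 2 (Finset.univ : Finset (Fin 4))).card := by
    refine Finset.card_le_three.trans_lt ?_
    rw [Finset.card_powersetCard]
    decide
  obtain ⟨e, he, hne⟩ := Finset.exists_mem_notMem_of_card_lt_card hlt
  have hcard := (Finset.mem_powersetCard.1 he).2
  simp only [Finset.mem_insert, Finset.mem_singleton, not_or] at hne
  have key : ∀ s : Finset (Fin 4), s.card ≤ 2 → e ≠ s → ¬ e ⊆ s := fun s hs hes hsub =>
    hes (Finset.eq_of_subset_of_card_le hsub (by omega))
  exact ⟨e, hcard, key _ h₁ hne.1, key _ h₂ hne.2.1, key _ h₃ hne.2.2⟩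

open IsColouredTree in
/-- A coloured tree with `n ≥ 2` nodes has a connected transversal of at most `(n + 1) / 3`
points. -/
theorem IsColouredTree.exists_isConnectedTransversal (n : ℕ) :
    ∀ {W : Finset ι} {r : ι} {par : ι → ι} {dep : ι → ℕ} {g : ι → Fin 4 → V},
      IsColouredTree W r par dep g → W.card = n → 2 ≤ n →
        ∃ B, IsConnectedTransversal W g ((W.card + 1) / 3) B := by
  induction n using Nat.strong_induction_on with
  | _ n IH =>
  intro W r par dep g h hn h2
  have ih : ∀ {U : Finset ι} {k : ℕ} {C : Finset V} {x j : ι}, U.Nonempty → U ⊆ W → r ∉ U →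
      (∀ y ∈ U, children W r par y ⊆ U) → 3 * k ≤ U.card → C.card ≤ k → x ∈ W → x ∉ U → j ∈ W →
      (∀ a ∈ C, a ∈ range (g j)) → (∃ c, g x c ∈ C) → (∀ i ∈ U, ∃ c, g i c ∈ C) →
      ∃ B, IsConnectedTransversal W g ((W.card + 1) / 3) B := by
    intro U k C x j hne hUW hr hU hcard hk hx hxU hj hC hxC hUC
    refine h.exists_of_sdiff hUW hr hU hcard hk hx hxU hj hC hxC hUC fun hT hT2 =>
      IH _ ?_ hT rfl hT2
    have := Finset.card_sdiff_add_card_eq_card hUW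
    have := hne.card_pos
    omega
  -- `α i` is a colour outside of which `i` agrees with its parent.
  choose! α hα using h.colour
  -- a deepest node
  obtain ⟨d, hd, hmax⟩ := Finset.exists_max_image W dep ⟨r, h.root_mem⟩
  obtain ⟨i₀, hi₀, hi₀r⟩ := Finset.exists_mem_ne (by omega : 1 < W.card) r
  have hD : 1 ≤ dep d := by
    have := h.dep_par i₀ hi₀ hi₀r
    have := hmax i₀ hi₀
    omega
  have hdr : d ≠ r := fun e => by rw [e, h.dep_root] at hD; omega
  have hleaf : ∀ y, dep y = dep d → children W r par y = ∅ := by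
    intro y hy
    by_contra hne
    obtain ⟨i, hi⟩ := Finset.nonempty_iff_ne_empty.2 hne
    obtain ⟨hiW, hir, hip⟩ := mem_children.1 hi
    have h1 := h.dep_par i hiW hir
    have h2 := hmax i hiW
    rw [hip] at h1
    omega
  have hdepch : ∀ {y i}, i ∈ children W r par y → dep i = dep y + 1 := by
    intro y i hi
    obtain ⟨hiW, hir, hip⟩ := mem_children.1 hi
    rw [← hip]
    exact h.dep_par i hiW hir
  have hcol : ∀ {y i}, i ∈ children W r par y → ∀ k ≠ α i, g i k = g y k := by
    intro y i hi k hk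
    obtain ⟨hiW, hir, hip⟩ := mem_children.1 hi
    rw [← hip]
    exact hα i hiW hir k hk
  have hchW : ∀ {y i}, i ∈ children W r par y → i ∈ W := fun hi => (mem_children.1 hi).1
  have hchr : ∀ {y i}, i ∈ children W r par y → i ≠ r := fun hi => (mem_children.1 hi).2.1
  have hself : ∀ {i}, i ∈ W → i ≠ r → i ∈ children W r par (par i) := fun hi hir =>
    mem_children.2 ⟨hi, hir, rfl⟩
  -- First, a node on the last but one level with several children: three leaf children are served
  -- by one point of `p`; exactly two are removed together with `p`, served by one point of the
  -- parent of `p`.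
  by_cases hA : ∃ p ∈ W, dep p + 1 = dep d ∧ 2 ≤ (children W r par p).card
  · obtain ⟨p, hp, hpd, hp2⟩ := hA
    have hleaf' : ∀ i ∈ children W r par p, children W r par i = ∅ := fun i hi =>
      hleaf i (by rw [hdepch hi, hpd])
    have hpU : ∀ U ⊆ children W r par p, p ∉ U := fun U hU hpU => by
      have := hdepch (hU hpU); omega
    by_cases h3 : 3 ≤ (children W r par p).card
    · obtain ⟨U, hU, hU3⟩ := Finset.exists_subset_card_eq h3
      obtain ⟨a, b, c, -, -, -, rfl⟩ := Finset.card_eq_three.1 hU3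
      obtain ⟨k, hka, hkb, hkc⟩ := exists_ne_three (α a) (α b) (α c)
      refine ih (k := 1) (C := {g p k}) (x := p) (j := p) ⟨a, by simp⟩ (hU.trans fun i => hchW)
        (fun hr => hchr (hU hr) rfl) (fun y hy => by rw [hleaf' y (hU hy)]; simp) (by omega)
        (by simp) hp (hpU _ hU) hp (by simp) ⟨k, by simp⟩ ?_
      intro i hi
      refine ⟨k, Finset.mem_singleton.2 (hcol (hU hi) k ?_)⟩
      simp only [Finset.mem_insert, Finset.mem_singleton] at hi
      rcases hi with rfl | rfl | rfl <;> assumption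
    · obtain ⟨a, b, hab, hch⟩ := Finset.card_eq_two.1 (by omega : (children W r par p).card = 2)
      have ha : a ∈ children W r par p := by rw [hch]; simp
      have hb : b ∈ children W r par p := by rw [hch]; simp
      by_cases hpr : p = r
      · subst hpr
        obtain ⟨k, hka, hkb, -⟩ := exists_ne_three (α a) (α b) (α b)
        refine exists_isConnectedTransversal_of_subset_node (B := {g p k}) (j := p) ?_ hp (by simp) ?_
        · simp; omega
        · intro i hi
          by_cases hip : i = p
          · exact ⟨k, by simp [hip]⟩
          have h1 := h.dep_par i hi hip
          have h2 := hmax i hi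
          have h3 : par i = p := by
            by_contra hne
            have := h.dep_par _ (h.par_mem i hi hip) hne
            have := h.dep_root
            omega
          have hic : i ∈ children W p par p := mem_children.2 ⟨hi, hip, h3⟩
          refine ⟨k, Finset.mem_singleton.2 (hcol hic k ?_)⟩
          rw [hch] at hic
          simp only [Finset.mem_insert, Finset.mem_singleton] at hic
          rcases hic with rfl | rfl <;> assumption
      · obtain ⟨k, hka, hkb, hkp⟩ := exists_ne_three (α a) (α b) (α p)
        have hpx := hself hp hpr
        have hda := hdepch ha
        have hdb := hdepch hb
        have hdx := hdepch hpx
        have hpa : p ≠ a := fun e => by rw [← e] at hda; omega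
        have hpb : p ≠ b := fun e => by rw [← e] at hdb; omega
        refine ih (U := {p, a, b}) (k := 1) (C := {g (par p) k}) (x := par p) (j := par p)
          ⟨a, by simp⟩ ?_ ?_ ?_ ?_ (by simp) (h.par_mem p hp hpr) ?_ (h.par_mem p hp hpr) (by simp)
          ⟨k, by simp⟩ ?_
        · intro i hi
          simp only [Finset.mem_insert, Finset.mem_singleton] at hi
          rcases hi with rfl | rfl | rfl
          exacts [hp, hchW ha, hchW hb]
        · intro hr
          simp only [Finset.mem_insert, Finset.mem_singleton] at hr
          rcases hr with rfl | rfl | rfl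
          exacts [hpr rfl, hchr ha rfl, hchr hb rfl]
        · intro i hi
          simp only [Finset.mem_insert, Finset.mem_singleton] at hi
          rcases hi with rfl | rfl | rfl
          · rw [hch]; exact Finset.subset_insert _ _
          · rw [hleaf' _ ha]; simp
          · rw [hleaf' _ hb]; simp
        · rw [Finset.card_eq_three.2 ⟨p, a, b, hpa, hpb, hab, rfl⟩]
        · intro hx
          simp only [Finset.mem_insert, Finset.mem_singleton] at hx
          rcases hx with e | e | e <;> rw [e] at hdx <;> omega
        · intro i hi
          refine ⟨k, Finset.mem_singleton.2 ?_⟩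
          have hp' := hcol hpx k hkp
          simp only [Finset.mem_insert, Finset.mem_singleton] at hi
          rcases hi with rfl | rfl | rfl
          exacts [hp', (hcol ha k hka).trans hp', (hcol hb k hkb).trans hp']
  push Not at hA
  set p := par d with hpdef
  have hdp : d ∈ children W r par p := hself hd hdr
  have hp : p ∈ W := h.par_mem d hd hdr
  have hdepd := hdepch hdp
  -- a node of the last but one level is a leaf or has a single child
  have hone : ∀ q ∈ W, dep q = dep p → ∀ e ∈ children W r par q, children W r par q = {e} := by
    intro q hq hqp e he
    have := hA q hq (by omega)
    obtain ⟨e', he'⟩ := Finset.card_eq_one.1 (show (children W r par q).card = 1 by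
      have := Finset.card_pos.2 ⟨e, he⟩
      omega)
    rw [he'] at he ⊢
    rw [Finset.mem_singleton.1 he]
  by_cases hpr : p = r
  · have hdr1 : dep d = 1 := by rw [hdepd, hpr, h.dep_root]
    obtain ⟨k, hkd, -, -⟩ := exists_ne_three (α d) (α d) (α d)
    refine exists_isConnectedTransversal_of_subset_node (B := {g p k}) (j := p) ?_ hp (by simp) ?_
    · simp; omega
    · intro i hi
      by_cases hip : i = r
      · exact ⟨k, by simp [hip, hpr]⟩
      have h1 := h.dep_par i hi hip
      have h2 := hmax i hi
      have h3 : par i = p := by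
        by_contra hne
        have := h.dep_par _ (h.par_mem i hi hip) (hpr ▸ hne)
        omega
      have hic : i ∈ children W r par p := mem_children.2 ⟨hi, hip, h3⟩
      rw [hone p hp rfl d hdp, Finset.mem_singleton] at hic
      rw [hic]
      exact ⟨k, Finset.mem_singleton.2 (hcol hdp k hkd)⟩
  set y := par p with hydef
  have hpy : p ∈ children W r par y := hself hp hpr
  have hy : y ∈ W := h.par_mem p hp hpr
  have hdepp := hdepch hpy
  have hleafd : ∀ {q e}, q ∈ children W r par y → e ∈ children W r par q →
      children W r par e = ∅ := by
    intro q e hq he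
    refine hleaf e ?_
    rw [hdepch he, hdepch hq]; omega
  -- A leaf child `q` of `y` can be removed together with `p` and `d`: these change at most three
  -- colours of `y`.
  by_cases hC1 : ∃ q ∈ children W r par y, children W r par q = ∅
  · obtain ⟨q, hq, hq0⟩ := hC1
    have hqp : p ≠ q := by rintro rfl; rw [hq0] at hdp; simp at hdp
    obtain ⟨k, hkp, hkd, hkq⟩ := exists_ne_three (α p) (α d) (α q)
    have hdq := hdepch hq
    have hpd : p ≠ d := fun e => by rw [← e] at hdepd; omega
    have hdq' : d ≠ q := fun e => by rw [← e] at hdq; omega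
    refine ih (U := {p, d, q}) (k := 1) (C := {g y k}) (x := y) (j := y)
      ⟨p, by simp⟩ ?_ ?_ ?_ ?_ (by simp) hy ?_ hy (by simp) ⟨k, by simp⟩ ?_
    · intro i hi
      simp only [Finset.mem_insert, Finset.mem_singleton] at hi
      rcases hi with rfl | rfl | rfl
      exacts [hp, hd, hchW hq]
    · intro hr
      simp only [Finset.mem_insert, Finset.mem_singleton] at hr
      rcases hr with e | e | e
      exacts [hpr e.symm, hdr e.symm, hchr hq e.symm]
    · intro i hi
      simp only [Finset.mem_insert, Finset.mem_singleton] at hi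
      rcases hi with e | e | e
      · rw [e, hone p hp rfl d hdp]; simp
      · rw [e, hleafd hpy hdp]; simp
      · rw [e, hq0]; simp
    · rw [Finset.card_eq_three.2 ⟨p, d, q, hpd, hqp, hdq', rfl⟩]
    · intro hx
      simp only [Finset.mem_insert, Finset.mem_singleton] at hx
      rcases hx with e | e | e
      · rw [← e] at hdepp; omega
      · rw [← e] at hdepd; omega
      · rw [← e] at hdq; omega
    · intro i hi
      refine ⟨k, Finset.mem_singleton.2 ?_⟩
      simp only [Finset.mem_insert, Finset.mem_singleton] at hi
      rcases hi with e | e | e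
      · rw [e]; exact hcol hpy k hkp
      · rw [e]; exact (hcol hdp k hkd).trans (hcol hpy k hkp)
      · rw [e]; exact hcol hq k hkq
  push Not at hC1
  -- From here on every branch below `y` is a pair consisting of a child `q` and its only child `e
  -- q`. Such a pair keeps all points of `y` whose colours are outside `{α q, α (e q)}`.
  have hkid : ∀ q, ∃ e, q ∈ children W r par y → e ∈ children W r par q := by
    intro q
    by_cases hq : q ∈ children W r par y
    · obtain ⟨e, he⟩ := hC1 q hq
      exact ⟨e, fun _ => he⟩
    · exact ⟨q, fun h => absurd h hq⟩
  choose e he using hkid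
  have hche : ∀ q ∈ children W r par y, children W r par q = {e q} := fun q hq =>
    hone q (hchW hq) (by rw [hdepch hq, hdepp]) _ (he q hq)
  have hcole : ∀ q ∈ children W r par y, ∀ k ∉ ({α q, α (e q)} : Finset (Fin 4)),
      g q k = g y k ∧ g (e q) k = g y k := by
    intro q hq k hk
    simp only [Finset.mem_insert, Finset.mem_singleton, not_or] at hk
    exact ⟨hcol hq k hk.1, (hcol (he q hq) k hk.2).trans (hcol hq k hk.1)⟩
  have hdepq : ∀ q ∈ children W r par y, dep q = dep y + 1 := fun q hq => hdepch hq
  have hdepe : ∀ q ∈ children W r par y, dep (e q) = dep y + 2 := fun q hq => by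
    rw [hdepch (he q hq), hdepq q hq]
  have hpare : ∀ q ∈ children W r par y, par (e q) = q := fun q hq => (mem_children.1 (he q hq)).2.2
  -- all nodes, if `y` is the root
  have hroot : y = r → ∀ i ∈ W, i = y ∨ ∃ q ∈ children W r par y, i = q ∨ i = e q := by
    intro hyr i hi
    by_cases hir : i = r
    · exact Or.inl (hir.trans hyr.symm)
    have h0 := h.dep_root
    rw [← hyr] at h0
    have h1 := h.dep_par i hi hir
    have h2 := hmax i hi
    by_cases h3 : par i = r
    · exact Or.inr ⟨i, mem_children.2 ⟨hi, hir, h3.trans hyr.symm⟩, Or.inl rfl⟩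
    have h4 := h.dep_par _ (h.par_mem i hi hir) h3
    have h5 : par (par i) = y := by
      by_contra hne
      have := h.dep_par _ (h.par_mem _ (h.par_mem i hi hir) h3) (hyr ▸ hne)
      omega
    have h6 : par i ∈ children W r par y := mem_children.2 ⟨h.par_mem i hi hir, h3, h5⟩
    refine Or.inr ⟨par i, h6, Or.inr ?_⟩
    have := hself hi hir
    rwa [hche _ h6, Finset.mem_singleton] at this
  have hpairs : ∀ K ⊆ children W r par y, (K ∪ K.image e).card = 2 * K.card := by
    intro K hK
    rw [Finset.card_union_of_disjoint, Finset.card_image_of_injOn, two_mul]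
    · intro q hq q' hq' hqq
      rw [← hpare q (hK hq), ← hpare q' (hK hq')]
      exact congrArg par hqq
    · rw [Finset.disjoint_left]
      intro q hq hq'
      obtain ⟨q', hq'', rfl⟩ := Finset.mem_image.1 hq'
      have := hdepe q' (hK hq'')
      have := hdepq _ (hK hq)
      omega
  -- removal of some pairs `q, e q`
  have hremove : ∀ (K : Finset ι) (k : ℕ) (E : Finset (Fin 4)), K ⊆ children W r par y → K.Nonempty →
      3 * k ≤ 2 * K.card → E.card ≤ k → E.Nonempty →
      (∀ q ∈ K, ∃ k ∈ E, k ∉ ({α q, α (e q)} : Finset (Fin 4))) →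
      ∃ B, IsConnectedTransversal W g ((W.card + 1) / 3) B := by
    intro K k E hK hKne hkK hEk hE hKE
    have hcard := hpairs K hK
    have hmem : ∀ i ∈ K ∪ K.image e, ∃ q ∈ K, i = q ∨ i = e q := by
      intro i hi
      rcases Finset.mem_union.1 hi with hi | hi
      · exact ⟨i, hi, Or.inl rfl⟩
      · obtain ⟨q, hq, rfl⟩ := Finset.mem_image.1 hi
        exact ⟨q, hq, Or.inr rfl⟩
    refine ih (U := K ∪ K.image e) (k := k) (C := E.image (g y)) (x := y) (j := y)
      (hKne.mono Finset.subset_union_left) ?_ ?_ ?_ (by omega) (Finset.card_image_le.trans hEk) hy ?_ hy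
      ?_ ?_ ?_
    · intro i hi
      obtain ⟨q, hq, rfl | rfl⟩ := hmem i hi
      exacts [hchW (hK hq), hchW (he q (hK hq))]
    · intro hr
      obtain ⟨q, hq, hq' | hq'⟩ := hmem r hr
      exacts [hchr (hK hq) hq'.symm, hchr (he q (hK hq)) hq'.symm]
    · intro i hi
      obtain ⟨q, hq, rfl | rfl⟩ := hmem i hi
      · rw [hche i (hK hq)]
        simp only [Finset.singleton_subset_iff]
        exact Finset.mem_union_right _ (Finset.mem_image_of_mem e hq)
      · rw [hleafd (hK hq) (he q (hK hq))]; simp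
    · intro hyK
      obtain ⟨q, hq, hq' | hq'⟩ := hmem y hyK
      · have := hdepq q (hK hq); rw [← hq'] at this; omega
      · have := hdepe q (hK hq); rw [← hq'] at this; omega
    · intro a ha
      obtain ⟨k, -, rfl⟩ := Finset.mem_image.1 ha
      exact ⟨k, rfl⟩
    · obtain ⟨k, hk⟩ := hE
      exact ⟨k, Finset.mem_image_of_mem _ hk⟩
    · intro i hi
      obtain ⟨q, hq, hiq⟩ := hmem i hi
      obtain ⟨k, hkE, hk⟩ := hKE q hq
      obtain ⟨h1, h2⟩ := hcole q (hK hq) k hk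
      refine ⟨k, ?_⟩
      rcases hiq with rfl | rfl
      · rw [h1]; exact Finset.mem_image_of_mem _ hkE
      · rw [h2]; exact Finset.mem_image_of_mem _ hkE
  -- Three pairs are six nodes, for which two points of `y` may be spent; a pair of colours works if
  -- it is not contained in any of the three sets of changed colours.
  by_cases h3 : 3 ≤ (children W r par y).card
  · obtain ⟨K, hK, hK3⟩ := Finset.exists_subset_card_eq h3
    obtain ⟨q₁, q₂, q₃, -, -, -, rfl⟩ := Finset.card_eq_three.1 hK3
    obtain ⟨E, hE2, hE₁, hE₂, hE₃⟩ := exists_pair_not_subset (s₁ := {α q₁, α (e q₁)})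
      (s₂ := {α q₂, α (e q₂)}) (s₃ := {α q₃, α (e q₃)}) Finset.card_le_two Finset.card_le_two
      Finset.card_le_two
    refine hremove _ 2 E hK ⟨q₁, by simp⟩ (by omega) hE2.le (Finset.card_pos.1 (by omega)) ?_
    intro q hq
    simp only [Finset.mem_insert, Finset.mem_singleton] at hq
    rcases hq with rfl | rfl | rfl
    exacts [Finset.not_subset.1 hE₁, Finset.not_subset.1 hE₂, Finset.not_subset.1 hE₃]
  by_cases h1 : (children W r par y).card = 1
  · have hch : children W r par y = {p} := by
      obtain ⟨p', hp'⟩ := Finset.card_eq_one.1 h1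
      rw [hp'] at hpy ⊢
      rw [Finset.mem_singleton.1 hpy]
    have hep : e p = d := by
      have := hche p hpy
      rw [hone p hp rfl d hdp] at this
      exact (Finset.singleton_inj.1 this).symm
    by_cases hyr : y = r
    · obtain ⟨k, hkp, hkd, -⟩ := exists_ne_three (α p) (α d) (α d)
      refine exists_isConnectedTransversal_of_subset_node (B := {g y k}) (j := y) ?_ hy (by simp) ?_
      · simp; omega
      · intro i hi
        refine ⟨k, Finset.mem_singleton.2 ?_⟩
        rcases hroot hyr i hi with rfl | ⟨q, hq, hiq⟩
        · rfl
        · rw [hch, Finset.mem_singleton] at hq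
          rw [hq, hep] at hiq
          rcases hiq with rfl | rfl
          · exact hcol hpy k hkp
          · exact (hcol hdp k hkd).trans (hcol hpy k hkp)
    -- With a single branch, `y`, `p` and `d` are removed and served by one point of the parent of
    -- `y`.
    · obtain ⟨k, hkp, hkd, hky⟩ := exists_ne_three (α p) (α d) (α y)
      have hyx := hself hy hyr
      have hdx := hdepch hyx
      have hyp : y ≠ p := fun e => by rw [← e] at hdepp; omega
      have hyd : y ≠ d := fun e => by rw [← e] at hdepd; omega
      have hpd : p ≠ d := fun e => by rw [← e] at hdepd; omega
      refine ih (U := {y, p, d}) (k := 1) (C := {g (par y) k}) (x := par y) (j := par y)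
        ⟨y, by simp⟩ ?_ ?_ ?_ ?_ (by simp) (h.par_mem y hy hyr) ?_ (h.par_mem y hy hyr) (by simp)
        ⟨k, by simp⟩ ?_
      · intro i hi
        simp only [Finset.mem_insert, Finset.mem_singleton] at hi
        rcases hi with e | e | e <;> rw [e] <;> assumption
      · intro hr
        simp only [Finset.mem_insert, Finset.mem_singleton] at hr
        rcases hr with e | e | e
        exacts [hyr e.symm, hpr e.symm, hdr e.symm]
      · intro i hi
        simp only [Finset.mem_insert, Finset.mem_singleton] at hi
        rcases hi with e | e | e
        · rw [e, hch]; simp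
        · rw [e, hone p hp rfl d hdp]; simp
        · rw [e, hleafd hpy hdp]; simp
      · rw [Finset.card_eq_three.2 ⟨y, p, d, hyp, hyd, hpd, rfl⟩]
      · intro hx
        simp only [Finset.mem_insert, Finset.mem_singleton] at hx
        rcases hx with e | e | e <;> rw [e] at hdx <;> omega
      · intro i hi
        refine ⟨k, Finset.mem_singleton.2 ?_⟩
        have hy' := hcol hyx k hky
        simp only [Finset.mem_insert, Finset.mem_singleton] at hi
        rcases hi with e | e | e <;> rw [e]
        exacts [hy', (hcol hpy k hkp).trans hy',
          ((hcol hdp k hkd).trans (hcol hpy k hkp)).trans hy']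
  obtain ⟨q₁, q₂, hq12, hch⟩ := Finset.card_eq_two.1 (show (children W r par y).card = 2 by
    have := Finset.card_pos.2 ⟨p, hpy⟩
    omega)
  have hq₁ : q₁ ∈ children W r par y := by rw [hch]; simp
  have hq₂ : q₂ ∈ children W r par y := by rw [hch]; simp
  -- A colour that neither of two branches changes serves all four of their nodes at the price of
  -- one point.
  by_cases hcommon : ∃ k, k ∉ ({α q₁, α (e q₁)} : Finset (Fin 4)) ∧
      k ∉ ({α q₂, α (e q₂)} : Finset (Fin 4))
  · obtain ⟨k, hk₁, hk₂⟩ := hcommon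
    refine hremove {q₁, q₂} 1 {k} (by rw [hch]) ⟨q₁, by simp⟩ ?_ (by simp) (by simp) ?_
    · rw [Finset.card_pair hq12]; norm_num
    · intro q hq
      simp only [Finset.mem_insert, Finset.mem_singleton] at hq
      rcases hq with rfl | rfl
      exacts [⟨k, by simp, hk₁⟩, ⟨k, by simp, hk₂⟩]
  -- If `y` is the root, the tree has at least five nodes, so two points of `y` are allowed, one for
  -- each branch.
  by_cases hyr : y = r
  · obtain ⟨k₁, hk₁, hk₁', -⟩ := exists_ne_three (α q₁) (α (e q₁)) (α q₁)
    obtain ⟨k₂, hk₂, hk₂', -⟩ := exists_ne_three (α q₂) (α (e q₂)) (α q₂)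
    have hcard : 5 ≤ W.card := by
      have h4 := hpairs _ subset_rfl
      rw [hch, Finset.card_pair hq12] at h4
      have hsub : insert y ({q₁, q₂} ∪ Finset.image e {q₁, q₂}) ⊆ W := by
        intro i hi
        simp only [Finset.mem_union, Finset.mem_insert, Finset.mem_singleton, Finset.mem_image,
          exists_eq_or_imp, exists_eq_left] at hi
        rcases hi with e | (e | e) | (e | e)
        exacts [e ▸ hy, e ▸ hchW hq₁, e ▸ hchW hq₂, e ▸ hchW (he _ hq₁), e ▸ hchW (he _ hq₂)]
      have hyn : y ∉ ({q₁, q₂} ∪ Finset.image e {q₁, q₂} : Finset ι) := by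
        intro hi
        simp only [Finset.mem_union, Finset.mem_insert, Finset.mem_singleton, Finset.mem_image,
          exists_eq_or_imp, exists_eq_left] at hi
        have e1 := hdepq _ hq₁
        have e2 := hdepq _ hq₂
        have e3 := hdepe _ hq₁
        have e4 := hdepe _ hq₂
        rcases hi with (h | h) | (h | h) <;> have := congrArg dep h <;> omega
      have := Finset.card_le_card hsub
      rw [Finset.card_insert_of_notMem hyn] at this
      omega
    refine exists_isConnectedTransversal_of_subset_node (B := {g y k₁, g y k₂}) (j := y) ?_ hy ?_ ?_
    · refine Finset.card_le_two.trans ?_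
      omega
    · simp
    · intro i hi
      rcases hroot hyr i hi with hiy | ⟨q, hq, hiq⟩
      · exact ⟨k₁, by simp [hiy]⟩
      · rw [hch] at hq
        simp only [Finset.mem_insert, Finset.mem_singleton] at hq
        rcases hq with rfl | rfl
        · have := hcole q hq₁ k₁ (by simp [hk₁, hk₁'])
          exact ⟨k₁, by rcases hiq with rfl | rfl <;> simp [this]⟩
        · have := hcole q hq₂ k₂ (by simp [hk₂, hk₂'])
          exact ⟨k₂, by rcases hiq with rfl | rfl <;> simp [this]⟩
  push Not at hcommon
  -- The hard case. The colour changed at `y` is among those changed by the branch of `q`. Hence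
  -- every point of `x = par y` whose colour survives in that branch is also a point of `y`, `q` and
  -- `e q`. Meanwhile one point of `x`, of colour `κ`, serves `y`, `q'` and `e q'`.
  have key : ∀ q q', children W r par y = {q, q'} → q ≠ q' →
      (∀ k, k ∈ ({α q, α (e q)} : Finset (Fin 4)) ∨ k ∈ ({α q', α (e q')} : Finset (Fin 4))) →
      α y ∈ ({α q, α (e q)} : Finset (Fin 4)) →
      ∃ B, IsConnectedTransversal W g ((W.card + 1) / 3) B := by
    intro q q' hch hqq hcov hδ
    obtain ⟨⟨κ, hκδ, hκ⟩, hm⟩ := exists_of_cover _ _ _ _ _ hcov hδ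
    set m := α q' with hmdef
    have hq : q ∈ children W r par y := by rw [hch]; simp
    have hq' : q' ∈ children W r par y := by rw [hch]; simp
    have hyx := hself hy hyr
    set x := par y with hx
    have hxW : x ∈ W := h.par_mem y hy hyr
    have hdx := hdepch hyx
    have hdq := hdepq q hq
    have hdq' := hdepq q' hq'
    have hde := hdepe q hq
    have hde' := hdepe q' hq'
    have hne : ∀ {i j : ι}, dep i ≠ dep j → i ≠ j := fun hij e => hij (congrArg dep e)
    have hee : e q ≠ e q' := fun h => hqq (by rw [← hpare q hq, ← hpare q' hq', h])
    have hyk : ∀ k ∉ ({α q, α (e q)} : Finset (Fin 4)), g y k = g x k := fun k hk =>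
      hcol hyx k (fun e => hk (e ▸ hδ))
    set U : Finset ι := {y, q', e q'} with hU
    have hmemU : ∀ i, i ∈ U ↔ i = y ∨ i = q' ∨ i = e q' := fun i => by simp [hU]
    have hUW : U ⊆ W := by
      intro i hi
      rcases (hmemU i).1 hi with rfl | rfl | rfl
      exacts [hy, hchW hq', hchW (he _ hq')]
    have hUcard : U.card = 3 := Finset.card_eq_three.2
      ⟨y, q', e q', hne (by omega), hne (by omega), hne (by omega), rfl⟩
    have hxU : x ∉ U := by
      rw [hmemU]
      rintro (h | h | h)
      exacts [hne (by omega) h, hne (by omega) h, hne (by omega) h]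
    have hqU : q ∉ U := by
      rw [hmemU]
      rintro (h | h | h)
      exacts [hne (by omega) h, hqq h, hne (by omega) h]
    have heU : e q ∉ U := by
      rw [hmemU]
      rintro (h | h | h)
      exacts [hne (by omega) h, hne (by omega) h, hee h]
    -- The branch of `q` is reattached to `x`. The points of colours `α q` and `α (e q)` are
    -- overwritten one after the other by the point of `x` of the surviving colour `m`. The new node
    -- `e q` then consists of exactly the surviving points of `x`, while parent and child still
    -- differ in at most one colour.
    set g' : ι → Fin 4 → V := fun i => if i = q then Function.update (g x) (α q) (g x m) else
      if i = e q then Function.update (Function.update (g x) (α q) (g x m)) (α (e q)) (g x m)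
      else g i with hg'
    -- Both nodes of the branch move up one level, as `q` becomes a child of the parent of `y`.
    set dep' : ι → ℕ := fun i => if i = q ∨ i = e q then dep i - 1 else dep i with hdep'
    have heq : e q ≠ q := hne (by omega)
    have hg'q : g' q = Function.update (g x) (α q) (g x m) := by simp [hg']
    have hg'e : g' (e q) = Function.update (Function.update (g x) (α q) (g x m)) (α (e q)) (g x m) := by
      simp [hg', heq]
    have hg'o : ∀ i, i ≠ q → i ≠ e q → g' i = g i := fun i h1 h2 => by simp [hg', h1, h2]
    have hdep'o : ∀ i, i ≠ q → i ≠ e q → dep' i = dep i := fun i h1 h2 => by simp [hdep', h1, h2]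
    have hxq : x ≠ q := hne (by omega)
    have hxe : x ≠ e q := hne (by omega)
    have hparo : ∀ i ∈ W, i ≠ r → i ≠ q → i ≠ e q → i ∉ U → par i ≠ q ∧ par i ≠ e q ∧ par i ∉ U := by
      intro i hi hir hiq hie hiU
      have hic := hself hi hir
      rw [hmemU] at hiU ⊢
      push Not at hiU ⊢
      refine ⟨fun h => hie ?_, fun h => ?_, fun h => ?_, fun h => hiU.2.2 ?_, fun h => ?_⟩
      · rwa [h, hche q hq, Finset.mem_singleton] at hic
      · rw [h, hleafd hq (he q hq)] at hic; simp at hic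
      · rw [h, hch, Finset.mem_insert, Finset.mem_singleton] at hic
        exact hic.elim hiq hiU.2.1
      · rwa [h, hche q' hq', Finset.mem_singleton] at hic
      · rw [h, hleafd hq' (he q' hq')] at hic; simp at hic
    have hT : IsColouredTree (W \ U) r (Function.update par q x) dep' g' := by
      refine ⟨?_, ?_, ?_, ?_, ?_⟩
      · rw [Finset.mem_sdiff, hmemU]
        refine ⟨h.root_mem, ?_⟩
        rintro (h | h | h)
        exacts [hyr h.symm, hchr hq' h.symm, hchr (he _ hq') h.symm]
      · intro i hi hir
        rw [Finset.mem_sdiff] at hi ⊢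
        by_cases h1 : i = q
        · rw [h1, Function.update_self]; exact ⟨hxW, hxU⟩
        rw [Function.update_of_ne h1]
        by_cases h2 : i = e q
        · rw [h2, hpare q hq]; exact ⟨hchW hq, hqU⟩
        exact ⟨h.par_mem i hi.1 hir, (hparo i hi.1 hir h1 h2 hi.2).2.2⟩
      · intro i hi hir
        rw [Finset.mem_sdiff] at hi
        by_cases h1 : i = q
        · rw [h1, Function.update_self, hdep'o x hxq hxe]
          simp only [hdep', true_or, if_true]; omega
        rw [Function.update_of_ne h1]
        by_cases h2 : i = e q
        · rw [h2, hpare q hq]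
          simp only [hdep', or_true, true_or, if_true]; omega
        have := hparo i hi.1 hir h1 h2 hi.2
        rw [hdep'o i h1 h2, hdep'o _ this.1 this.2.1]
        exact h.dep_par i hi.1 hir
      · rw [hdep'o r (hchr hq).symm (hchr (he q hq)).symm, h.dep_root]
      · intro i hi hir
        rw [Finset.mem_sdiff] at hi
        by_cases h1 : i = q
        · rw [h1, Function.update_self, hg'o x hxq hxe, hg'q]
          exact ⟨α q, fun k hk => Function.update_of_ne hk _ _⟩
        rw [Function.update_of_ne h1]
        by_cases h2 : i = e q
        · rw [h2, hpare q hq, hg'q, hg'e]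
          exact ⟨α (e q), fun k hk => Function.update_of_ne hk _ _⟩
        have := hparo i hi.1 hir h1 h2 hi.2
        rw [hg'o i h1 h2, hg'o _ this.1 this.2.1]
        exact ⟨α i, hα i hi.1 hir⟩
    have hWU := Finset.card_sdiff_add_card_eq_card hUW
    refine exists_isConnectedTransversal_extend (W' := W \ U) (g' := g') (k := 1) (C := {g x κ})
      (x := x) (j := x) (by omega) (by simp) (Finset.mem_sdiff.2 ⟨hxW, hxU⟩) ?_ hxW (by simp) ?_ ?_
      (fun h2 => IH _ (by omega) hT rfl h2)
    · rw [hg'o x hxq hxe]; exact ⟨κ, by simp⟩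
    · intro i hi
      by_cases h1 : i = q
      · refine ⟨x, hxW, ?_⟩
        rw [h1, hg'q]
        rintro _ ⟨k, rfl⟩
        by_cases hk : k = α q
        · rw [hk, Function.update_self]; exact ⟨m, rfl⟩
        · rw [Function.update_of_ne hk]; exact ⟨k, rfl⟩
      by_cases h2 : i = e q
      · refine ⟨x, hxW, ?_⟩
        rw [h2, hg'e]
        rintro _ ⟨k, rfl⟩
        by_cases hk' : k = α (e q)
        · rw [hk', Function.update_self]; exact ⟨m, rfl⟩
        rw [Function.update_of_ne hk']
        by_cases hk : k = α q
        · rw [hk, Function.update_self]; exact ⟨m, rfl⟩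
        · rw [Function.update_of_ne hk]; exact ⟨k, rfl⟩
      · exact ⟨i, (Finset.mem_sdiff.1 hi).1, by rw [hg'o i h1 h2]⟩
    · intro B hCB hB i hi
      have hκB : g x κ ∈ B := hCB (by simp)
      have hκy : g y κ = g x κ := hcol hyx κ hκδ
      -- A set that meets the modified node `e q` contains a surviving point of `x`, and this point
      -- meets the original nodes `q` and `e q`.
      have hpair : ∃ k ∉ ({α q, α (e q)} : Finset (Fin 4)), g x k ∈ B := by
        obtain ⟨k, hk⟩ := hB (e q) (Finset.mem_sdiff.2 ⟨hchW (he q hq), heU⟩)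
        rw [hg'e] at hk
        by_cases h1 : k = α (e q)
        · rw [h1, Function.update_self] at hk
          exact ⟨m, hm, hk⟩
        rw [Function.update_of_ne h1] at hk
        by_cases h2 : k = α q
        · rw [h2, Function.update_self] at hk
          exact ⟨m, hm, hk⟩
        rw [Function.update_of_ne h2] at hk
        exact ⟨k, by simp [h1, h2], hk⟩
      obtain ⟨k, hk, hkB⟩ := hpair
      have hk' := hcole q hq k hk
      rw [hyk k hk] at hk'
      by_cases hiU : i ∈ U
      · have hκ' := hcole q' hq' κ hκ
        rw [hκy] at hκ'
        rcases (hmemU i).1 hiU with h | h | h <;> rw [h]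
        · exact ⟨κ, by rwa [hκy]⟩
        · exact ⟨κ, by rwa [hκ'.1]⟩
        · exact ⟨κ, by rwa [hκ'.2]⟩
      by_cases h1 : i = q
      · rw [h1]; exact ⟨k, by rwa [hk'.1]⟩
      by_cases h2 : i = e q
      · rw [h2]; exact ⟨k, by rwa [hk'.2]⟩
      obtain ⟨l, hl⟩ := hB i (Finset.mem_sdiff.2 ⟨hi, hiU⟩)
      exact ⟨l, by rwa [hg'o i h1 h2] at hl⟩
  have hcov : ∀ k, k ∈ ({α q₁, α (e q₁)} : Finset (Fin 4)) ∨ k ∈ ({α q₂, α (e q₂)} : Finset (Fin 4)) :=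
    fun k => by
      by_cases hk : k ∈ ({α q₁, α (e q₁)} : Finset (Fin 4))
      · exact Or.inl hk
      · exact Or.inr (hcommon k hk)
  rcases hcov (α y) with h4 | h4
  · exact key q₁ q₂ hch hq12 hcov h4
  · exact key q₂ q₁ (by rw [hch, Finset.pair_comm]) hq12.symm (fun k => (hcov k).symm) h4

end ColouredTree

/-! ### From tetrahedra to trees and from transversals to beacons. -/

/-- The tetrahedra of a decomposition of a polyhedron form a coloured tree. -/
lemma exists_isColouredTree [DecidableEq E3] {P : Set E3} {S : Finset (Finset E3)}
    (hP : IsPolyhedron P) (hS : IsTetrahedralDecomposition P S) (n : ℕ) (h1 : 1 ≤ n)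
    (hn : n ≤ S.card) :
    ∃ (S₁ : Finset (Finset E3)) (r : Finset E3) (par : Finset E3 → Finset E3) (dep : Finset E3 → ℕ)
      (g : Finset E3 → Fin 4 → E3), S₁ ⊆ S ∧ S₁.card = n ∧ IsColouredTree S₁ r par dep g ∧
        ∀ s ∈ S₁, Function.Injective (g s) ∧ ∀ k, g s k ∈ s := by
  induction n, h1 using Nat.le_induction with
  | base =>
    obtain ⟨r, hr⟩ := Finset.card_pos.1 hn
    have e : r ≃ Fin 4 := r.equivFinOfCardEq (hS.1.card_eq r hr)
    refine ⟨{r}, r, id, fun _ => 0, fun _ k => (e.symm k : E3), by simpa using hr, by simp,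
      ⟨by simp, ?_, ?_, rfl, ?_⟩, ?_⟩
    · intro i hi hir; exact absurd (Finset.mem_singleton.1 hi) hir
    · intro i hi hir; exact absurd (Finset.mem_singleton.1 hi) hir
    · intro i hi hir; exact absurd (Finset.mem_singleton.1 hi) hir
    · intro s hs
      rw [Finset.mem_singleton.1 hs]
      exact ⟨fun a b hab => e.symm.injective (Subtype.ext hab), fun k => (e.symm k).2⟩
  | succ n h1 ih =>
    obtain ⟨S₁, r, par, dep, g, hsub, hcard, hT, hg⟩ := ih (by omega)
    -- The tree grows by a tetrahedron `t` that shares a triangle with some `s` in it; `t` becomes a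
    -- child of `s`, and its new vertex `b` inherits the colour of the vertex `a` of `s` that is
    -- lost.
    obtain ⟨s, hs, t, ht, htS, hst⟩ := exists_card_inter_eq_three hP hS hsub
      (Finset.card_pos.1 (by omega)) (fun h => by rw [h] at hcard; omega)
    have hs4 := hS.1.card_eq s (hsub hs)
    have ht4 := hS.1.card_eq t ht
    obtain ⟨b, hb⟩ : ∃ b, b ∈ t \ s := by
      refine Finset.card_pos.1 ?_
      rw [Finset.card_sdiff, hst]; omega
    rw [Finset.mem_sdiff] at hb
    obtain ⟨a, ha⟩ : ∃ a, s \ t = {a} := Finset.card_eq_one.1 (by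
      rw [Finset.card_sdiff, Finset.inter_comm, hst, hs4])
    have hout : ∀ k, g s k ∉ t → g s k = a := fun k hk =>
      Finset.mem_singleton.1 (ha ▸ Finset.mem_sdiff.2 ⟨(hg s hs).2 k, hk⟩)
    have hne : ∀ i ∈ S₁, i ≠ t := fun i hi h => htS (h ▸ hi)
    have hrt : r ≠ t := hne r hT.root_mem
    refine ⟨insert t S₁, r, Function.update par t s, Function.update dep t (dep s + 1),
      Function.update g t (fun k => if g s k ∈ t then g s k else b),
      Finset.insert_subset ht hsub, by rw [Finset.card_insert_of_notMem htS, hcard],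
      ⟨Finset.mem_insert_of_mem hT.root_mem, ?_, ?_, ?_, ?_⟩, ?_⟩
    · intro i hi hir
      rcases Finset.mem_insert.1 hi with rfl | hi
      · rw [Function.update_self]; exact Finset.mem_insert_of_mem hs
      · rw [Function.update_of_ne (hne i hi)]
        exact Finset.mem_insert_of_mem (hT.par_mem i hi hir)
    · intro i hi hir
      rcases Finset.mem_insert.1 hi with rfl | hi
      · rw [Function.update_self, Function.update_self, Function.update_of_ne (hne s hs)]
      · rw [Function.update_of_ne (hne i hi), Function.update_of_ne (hne i hi),
          Function.update_of_ne (hne _ (hT.par_mem i hi hir))]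
        exact hT.dep_par i hi hir
    · rw [Function.update_of_ne hrt]; exact hT.dep_root
    · intro i hi hir
      rcases Finset.mem_insert.1 hi with rfl | hi
      · rw [Function.update_self, Function.update_self, Function.update_of_ne (hne s hs)]
        by_cases hc : ∃ c, g s c ∉ i
        · obtain ⟨c, hc⟩ := hc
          refine ⟨c, fun k hk => if_pos ?_⟩
          by_contra hk'
          exact hk ((hg s hs).1 ((hout k hk').trans (hout c hc).symm))
        · push Not at hc
          exact ⟨0, fun k _ => if_pos (hc k)⟩
      · rw [Function.update_of_ne (hne i hi), Function.update_of_ne (hne i hi),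
          Function.update_of_ne (hne _ (hT.par_mem i hi hir))]
        exact hT.colour i hi hir
    · intro i hi
      rcases Finset.mem_insert.1 hi with rfl | hi
      · rw [Function.update_self]
        constructor
        · intro k l hkl
          dsimp only at hkl
          split_ifs at hkl with hk hl hl
          · exact (hg s hs).1 hkl
          · exact absurd (hkl ▸ (hg s hs).2 k) hb.2
          · exact absurd (hkl ▸ (hg s hs).2 l) hb.2
          · exact (hg s hs).1 ((hout k hk).trans (hout l hl).symm)
        · intro k
          split_ifs with hk
          exacts [hk, hb.1]
      · rw [Function.update_of_ne (hne i hi)]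
        exact hg i hi

lemma canRoute_of_reflTransGen {cov : E3 → E3 → Prop} {B : Finset E3} {R : E3 → E3 → Prop}
    (hR : ∀ a b, R a b → b ∈ B ∧ cov b a) {p b b' q : E3} (hb : b ∈ B) (hpb : cov b p)
    (hbb : Relation.ReflTransGen R b b') (hq : cov q b') : CanRoute cov B p q := by
  have key : ∃ l : List E3, (∀ x ∈ l, x ∈ B) ∧ List.IsChain (fun x b => cov b x) (b :: (l ++ [q])) := by
    clear hpb hb
    induction hbb using Relation.ReflTransGen.head_induction_on with
    | refl => exact ⟨[], by simp, by simpa using hq⟩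
    | @head a c hac _ ih =>
      obtain ⟨l, hl, hch⟩ := ih
      obtain ⟨hc, hcov⟩ := hR _ _ hac
      exact ⟨c :: l, by simpa using ⟨hc, hl⟩, by simpa using ⟨hcov, hch⟩⟩
  obtain ⟨l, hl, hch⟩ := key
  exact ⟨b :: l, by simpa using ⟨hb, hl⟩, by simpa using ⟨hpb, hch⟩⟩

/-- The beacons are the points of a connected transversal: two points of one tetrahedron cover each
other, so each link between points of the transversal is a step of a route. -/
theorem exists_beacons {P : Set E3} {S : Finset (Finset E3)} (hP : IsPolyhedron P)
    (hS : IsTetrahedralDecomposition P S) :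
    ∃ B : Finset E3, (B : Set E3) ⊆ P ∧ B.card ≤ (S.card + 1) / 3 ∧
      ∀ p ∈ P, ∀ q ∈ P, CanRoute (Covers P) B p q := by
  classical
  have hmem : ∀ p ∈ P, ∃ s ∈ S, p ∈ convexHull ℝ (s : Set E3) := fun p hp => by
    rw [← hS.2] at hp
    simpa [carrier] using hp
  have hcov : ∀ s ∈ S, ∀ p ∈ convexHull ℝ (s : Set E3), ∀ b ∈ convexHull ℝ (s : Set E3),
      Covers P b p := fun s hs p hp b hb => hS.2 ▸ covers_of_mem_convexHull hS.1 hs hp hb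
  obtain ⟨p₀, hp₀⟩ := hP.isConnected.nonempty
  obtain ⟨s₀, hs₀, -⟩ := hmem p₀ hp₀
  have hpos : 1 ≤ S.card := Finset.card_pos.2 ⟨s₀, hs₀⟩
  -- The transversal needs two nodes; a single tetrahedron needs no beacon at all.
  by_cases h1 : S.card = 1
  · refine ⟨∅, by simp, by simp, fun p hp q hq => ⟨[], by simp, ?_⟩⟩
    obtain ⟨s, hs, hps⟩ := hmem p hp
    obtain ⟨t, ht, hqt⟩ := hmem q hq
    have : t = s := Finset.card_le_one.1 h1.le t ht s hs
    subst this
    simpa using hcov t hs p hps q hqt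
  obtain ⟨S₁, r, par, dep, g, hsub, hcard, hT, hg⟩ := exists_isColouredTree hP hS S.card hpos le_rfl
  obtain rfl : S₁ = S := Finset.eq_of_subset_of_card_le hsub hcard.ge
  obtain ⟨B, hB⟩ := hT.exists_isConnectedTransversal _ rfl (by omega)
  have hin : ∀ s ∈ S₁, ∀ a ∈ range (g s), a ∈ convexHull ℝ (s : Set E3) := by
    rintro s hs _ ⟨k, rfl⟩
    exact subset_convexHull ℝ _ ((hg s hs).2 k)
  refine ⟨B, fun a ha => ?_, hB.card_le, fun p hp q hq => ?_⟩
  · obtain ⟨s, hs, has⟩ := hB.mem a ha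
    rw [← hS.2]
    exact convexHull_subset_carrier hs (hin s hs a has)
  · obtain ⟨s, hs, hps⟩ := hmem p hp
    obtain ⟨t, ht, hqt⟩ := hmem q hq
    obtain ⟨k, hk⟩ := hB.meets s hs
    obtain ⟨l, hl⟩ := hB.meets t ht
    refine canRoute_of_reflTransGen (R := Linked S₁ g B) ?_ hk
      (hcov s hs p hps _ (hin s hs _ ⟨k, rfl⟩)) (hB.connected _ hk _ hl)
      (hcov t ht _ (hin t ht _ ⟨l, rfl⟩) q hqt)
    rintro a b ⟨-, hb, i, hi, hai, hbi⟩
    exact ⟨hb, hcov i hi a (hin i hi a hai) b (hin i hi b hbi)⟩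

/-! ### Gluing tetrahedra onto a triangulated boundary. -/

/-- The combinatorial conditions on the triangles of a closed surface. -/
structure IsClosedTriangulation (T : Finset (Finset E3)) : Prop where
  card_eq : ∀ t ∈ T, t.card = 3
  ncard_edge : ∀ t ∈ T, ∀ e : Finset E3, e ⊆ t → e.card = 2 →
    {s : Finset E3 | s ∈ T ∧ e ⊆ s}.ncard = 2
  link : ∀ v : E3, ∀ a ∈ T, ∀ b ∈ T, v ∈ a → v ∈ b → Relation.ReflTransGen (AdjacentAt T v) a b

section

variable [DecidableEq E3]

lemma ncard_supersets (T : Finset (Finset E3)) (e : Finset E3) :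
    {s : Finset E3 | s ∈ T ∧ e ⊆ s}.ncard = (T.filter (e ⊆ ·)).card := by
  rw [← Set.ncard_coe_finset]
  congr 1
  ext s; simp

/-- The face opposite to `a` contains `e` precisely when `a ∉ e`. -/
lemma card_filter_faces {s f e : Finset E3} (hf : f ⊆ s) (he : e ⊆ s) :
    ((f.image s.erase).filter (e ⊆ ·)).card = (f \ e).card := by
  have : (f.image s.erase).filter (e ⊆ ·) = (f \ e).image s.erase := by
    ext t
    simp only [Finset.mem_filter, Finset.mem_image, Finset.mem_sdiff]
    constructor
    · rintro ⟨⟨a, ha, rfl⟩, h⟩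
      exact ⟨a, ⟨ha, fun hae => Finset.notMem_erase a s (h hae)⟩, rfl⟩
    · rintro ⟨a, ⟨ha, hae⟩, rfl⟩
      exact ⟨⟨a, ha, rfl⟩, fun x hx => Finset.mem_erase.2 ⟨fun h => hae (h ▸ hx), he hx⟩⟩
  rw [this, Finset.card_image_of_injOn]
  exact (Finset.erase_injOn s).mono fun a ha => hf (Finset.mem_sdiff.1 ha).1

lemma adjacentAt_faces {T : Finset (Finset E3)} {s : Finset E3} (hs : s.card = 4) {x a b : E3}
    (hx : x ∈ s) (hxa : x ≠ a) (hxb : x ≠ b) (ha : s.erase a ∈ T) (hb : s.erase b ∈ T) :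
    AdjacentAt T x (s.erase a) (s.erase b) := by
  obtain ⟨y, hy⟩ : (s \ {a, b, x}).Nonempty := by
    refine Finset.card_pos.1 ?_
    have := Finset.le_card_sdiff ({a, b, x} : Finset E3) s
    have h3 : ({a, b, x} : Finset E3).card ≤ 3 := Finset.card_le_three
    omega
  simp only [Finset.mem_sdiff, Finset.mem_insert, Finset.mem_singleton, not_or] at hy
  refine ⟨ha, hb, {x, y}, Finset.card_pair (Ne.symm hy.2.2.2), by simp, ?_, ?_⟩ <;>
  · intro z hz
    simp only [Finset.mem_insert, Finset.mem_singleton] at hz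
    rw [Finset.mem_erase]
    rcases hz with rfl | rfl
    · exact ⟨by assumption, hx⟩
    · exact ⟨by first | exact hy.2.1 | exact hy.2.2.1, hy.1⟩

/-- The boundary of a tetrahedron. -/
lemma isClosedTriangulation_faces {s : Finset E3} (hs : s.card = 4) :
    IsClosedTriangulation (s.image s.erase) where
  card_eq := by
    intro t ht
    obtain ⟨a, ha, rfl⟩ := Finset.mem_image.1 ht
    rw [Finset.card_erase_of_mem ha, hs]
  ncard_edge := by
    intro t ht e het he
    obtain ⟨a, ha, rfl⟩ := Finset.mem_image.1 ht
    have hes := het.trans (Finset.erase_subset _ _)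
    rw [ncard_supersets, card_filter_faces subset_rfl hes, Finset.card_sdiff_of_subset hes, hs, he]
  link := by
    intro x t ht t' ht' hx hx'
    have ht0 := ht
    have ht0' := ht'
    obtain ⟨a, ha, rfl⟩ := Finset.mem_image.1 ht
    obtain ⟨b, hb, rfl⟩ := Finset.mem_image.1 ht'
    rw [Finset.mem_erase] at hx hx'
    exact Relation.ReflTransGen.single (adjacentAt_faces hs hx.2 hx.1 hx'.1 ht0 ht0')

/-- Replacing a triangle by the three other faces of a tetrahedron on it. -/
lemma IsClosedTriangulation.glue {T : Finset (Finset E3)} (hT : IsClosedTriangulation T)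
    {f : Finset E3} (hf : f ∈ T) {v : E3} (hv : ∀ t ∈ T, v ∉ t) :
    IsClosedTriangulation (T.erase f ∪ f.image (insert v f).erase) := by
  have hvf := hv f hf
  have hfc := hT.card_eq f hf
  have hs : (insert v f).card = 4 := by rw [Finset.card_insert_of_notMem hvf, hfc]
  set s := insert v f with hsdef
  have hfs : f ⊆ s := Finset.subset_insert _ _
  have hvs : v ∈ s := Finset.mem_insert_self _ _
  have hvnew : ∀ a ∈ f, v ∈ s.erase a := fun a ha =>
    Finset.mem_erase.2 ⟨fun h => hvf (h ▸ ha), hvs⟩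
  refine ⟨?_, ?_, ?_⟩
  · intro t ht
    rcases Finset.mem_union.1 ht with ht | ht
    · exact hT.card_eq t (Finset.mem_of_mem_erase ht)
    · obtain ⟨a, ha, rfl⟩ := Finset.mem_image.1 ht
      rw [Finset.card_erase_of_mem (hfs ha), hs]
  · intro t ht e het he
    rw [ncard_supersets, Finset.filter_union, Finset.card_union_of_disjoint]
    swap
    · rw [Finset.disjoint_left]
      intro t ht ht'
      obtain ⟨a, ha, rfl⟩ := Finset.mem_image.1 (Finset.mem_filter.1 ht').1
      exact hv _ (Finset.mem_of_mem_erase (Finset.mem_filter.1 ht).1) (hvnew a ha)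
    -- An edge at `v` lies only in new faces, in two of them. An edge of `f` loses `f` and gains one
    -- new face. All other edges keep their triangles.
    by_cases hve : v ∈ e
    · have h0 : (T.erase f).filter (e ⊆ ·) = ∅ := by
        refine Finset.filter_eq_empty_iff.2 fun t ht h => ?_
        exact hv t (Finset.mem_of_mem_erase ht) (h hve)
      have hes : e ⊆ s := by
        rcases Finset.mem_union.1 ht with ht | ht
        · exact absurd (het hve) (hv t (Finset.mem_of_mem_erase ht))
        · obtain ⟨a, ha, rfl⟩ := Finset.mem_image.1 ht
          exact het.trans (Finset.erase_subset _ _)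
      rw [h0, card_filter_faces hfs hes, Finset.card_empty, zero_add]
      have h1 : f \ e = f \ e.erase v := by
        ext x
        simp only [Finset.mem_sdiff, Finset.mem_erase, not_and]
        refine and_congr_right fun hx => ⟨fun h _ => h, fun h => h fun hxv => hvf (hxv ▸ hx)⟩
      have h2 : e.erase v ⊆ f := fun x hx => by
        rw [Finset.mem_erase] at hx
        exact (Finset.mem_insert.1 (hes hx.2)).resolve_left hx.1
      rw [h1, Finset.card_sdiff_of_subset h2, Finset.card_erase_of_mem hve, he, hfc]
    · by_cases hes : e ⊆ s
      · have hef : e ⊆ f := fun x hx =>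
          (Finset.mem_insert.1 (hes hx)).resolve_left fun h => hve (h ▸ hx)
        have h1 := hT.ncard_edge f hf e hef he
        rw [ncard_supersets] at h1
        rw [card_filter_faces hfs hes, Finset.card_sdiff_of_subset hef, hfc, he, Finset.filter_erase,
          Finset.card_erase_of_mem (Finset.mem_filter.2 ⟨hf, hef⟩), h1]
      · have htT : t ∈ T := by
          rcases Finset.mem_union.1 ht with ht | ht
          · exact Finset.mem_of_mem_erase ht
          · obtain ⟨a, ha, rfl⟩ := Finset.mem_image.1 ht
            exact absurd (het.trans (Finset.erase_subset _ _)) hes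
        have h0 : (f.image s.erase).filter (e ⊆ ·) = ∅ := by
          refine Finset.filter_eq_empty_iff.2 fun t ht h => ?_
          obtain ⟨a, ha, rfl⟩ := Finset.mem_image.1 ht
          exact hes (h.trans (Finset.erase_subset _ _))
        rw [h0, Finset.card_empty, add_zero, Finset.filter_erase, Finset.erase_eq_of_notMem,
          ← ncard_supersets, hT.ncard_edge t htT e het he]
        exact fun h => hes ((Finset.mem_filter.1 h).2.trans hfs)
  · -- links
    have hnew : ∀ a ∈ f, s.erase a ∈ T.erase f ∪ f.image s.erase := fun a ha =>
      Finset.mem_union_right _ (Finset.mem_image_of_mem _ ha)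
    have hold : ∀ t ∈ T, t ≠ f → t ∈ T.erase f ∪ f.image s.erase := fun t ht htf =>
      Finset.mem_union_left _ (Finset.mem_erase.2 ⟨htf, ht⟩)
    have hnn : ∀ x a b, a ∈ f → b ∈ f → x ∈ s.erase a → x ∈ s.erase b →
        AdjacentAt (T.erase f ∪ f.image s.erase) x (s.erase a) (s.erase b) := by
      intro x a b ha hb hxa hxb
      rw [Finset.mem_erase] at hxa hxb
      exact adjacentAt_faces hs hxa.2 hxa.1 hxb.1 (hnew a ha) (hnew b hb)
    have hcases : ∀ t ∈ T.erase f ∪ f.image s.erase, (t ∈ T ∧ t ≠ f) ∨ ∃ a ∈ f, t = s.erase a := by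
      intro t ht
      rcases Finset.mem_union.1 ht with ht | ht
      · exact Or.inl (Finset.mem_erase.1 ht).symm
      · obtain ⟨a, ha, rfl⟩ := Finset.mem_image.1 ht
        exact Or.inr ⟨a, ha, rfl⟩
    have hsymm : ∀ {x : E3} {T : Finset (Finset E3)} {a b : Finset E3}, AdjacentAt T x a b →
        AdjacentAt T x b a := fun ⟨h1, h2, e, h3, h4, h5, h6⟩ => ⟨h2, h1, e, h3, h4, h6, h5⟩
    -- adjacency in `T` to a triangle different from `f`
    have hfa : ∀ {x b}, AdjacentAt T x f b → b ≠ f → ∃ a ∈ f, x ≠ a ∧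
        AdjacentAt (T.erase f ∪ f.image s.erase) x (s.erase a) b := by
      rintro x b ⟨-, hb, e, he, hxe, hef, heb⟩ hbf
      obtain ⟨a, ha⟩ : (f \ e).Nonempty := Finset.card_pos.1 (by
        rw [Finset.card_sdiff_of_subset hef]; omega)
      rw [Finset.mem_sdiff] at ha
      exact ⟨a, ha.1, fun h => ha.2 (h ▸ hxe), hnew a ha.1, hold b hb hbf, e, he, hxe,
        fun z hz => Finset.mem_erase.2 ⟨fun h => ha.2 (h ▸ hz), hfs (hef hz)⟩, heb⟩
    -- chains of `T` yield chains of the new triangulation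
    have hchain : ∀ x t u, Relation.ReflTransGen (AdjacentAt T x) t u → t ∈ T → x ∈ t →
        ∀ t' u', t' ∈ T.erase f ∪ f.image s.erase → u' ∈ T.erase f ∪ f.image s.erase →
        x ∈ t' → x ∈ u' →
        (t' = t ∨ t = f ∧ ∃ a ∈ f, t' = s.erase a) → (u' = u ∨ u = f ∧ ∃ a ∈ f, u' = s.erase a) →
        Relation.ReflTransGen (AdjacentAt (T.erase f ∪ f.image s.erase) x) t' u' := by
      intro x t u htu ht hxt
      have hfnot : f ∉ T.erase f ∪ f.image s.erase := by
        intro h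
        rcases hcases f h with h | ⟨a, ha, h⟩
        · exact h.2 rfl
        · exact hvf (h ▸ hvnew a ha)
      induction htu with
      | refl =>
        intro t' u' ht' hu' hxt' hxu' h1 h2
        rcases h1 with rfl | ⟨hf1, a, ha, rfl⟩
        · rcases h2 with rfl | ⟨rfl, -⟩
          · exact Relation.ReflTransGen.refl
          · exact absurd ht' hfnot
        · rcases h2 with rfl | ⟨-, b, hb, rfl⟩
          · exact absurd (hf1 ▸ hu') hfnot
          · exact Relation.ReflTransGen.single (hnn x a b ha hb hxt' hxu')
      | @tail b c htb hbc ih =>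
        intro t' u' ht' hu' hxt' hxu' h1 h2
        have hxb : x ∈ b := by obtain ⟨-, -, e, -, hxe, heb, -⟩ := hbc; exact heb hxe
        by_cases hcf : c = f
        · subst hcf
          obtain ⟨a, ha, rfl⟩ : ∃ a ∈ c, u' = s.erase a := by
            rcases h2 with rfl | ⟨-, h⟩
            · exact absurd hu' hfnot
            · exact h
          by_cases hbf : b = c
          · exact ih t' _ ht' hu' hxt' hxu' h1 (Or.inr ⟨hbf, a, ha, rfl⟩)
          · obtain ⟨a', ha', hxa', hadj⟩ := hfa (hsymm hbc) hbf
            refine ((ih t' b ht' (hold b hbc.1 hbf) hxt' hxb h1 (Or.inl rfl)).tail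
              (hsymm hadj)).tail (hnn x a' a ha' ha ?_ hxu')
            have hxc : x ∈ c := by obtain ⟨-, -, e, -, hxe, -, hec⟩ := hbc; exact hec hxe
            exact Finset.mem_erase.2 ⟨hxa', hfs hxc⟩
        · have hu : u' = c := by
            rcases h2 with h | ⟨h, -⟩
            · exact h
            · exact absurd h hcf
          subst hu
          by_cases hbf : b = f
          · subst hbf
            obtain ⟨a, ha, hxa, hadj⟩ := hfa hbc hcf
            exact (ih t' (s.erase a) ht' (hnew a ha) hxt' (Finset.mem_erase.2 ⟨hxa, hfs hxb⟩) h1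
              (Or.inr ⟨rfl, a, ha, rfl⟩)).tail hadj
          · obtain ⟨hb, hc, e, he⟩ := hbc
            exact (ih t' b ht' (hold b hb hbf) hxt' hxb h1 (Or.inl rfl)).tail
              ⟨hold b hb hbf, hu', e, he⟩
    intro x t ht u hu hxt hxu
    by_cases hxv : x = v
    · subst hxv
      obtain ⟨a, ha, rfl⟩ : ∃ a ∈ f, t = s.erase a :=
        (hcases t ht).resolve_left fun h => hv t h.1 hxt
      obtain ⟨b, hb, rfl⟩ : ∃ a ∈ f, u = s.erase a :=
        (hcases u hu).resolve_left fun h => hv u h.1 hxu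
      exact Relation.ReflTransGen.single (hnn x a b ha hb hxt hxu)
    · have hxf : ∀ a, x ∈ s.erase a → x ∈ f := fun a hx =>
        (Finset.mem_insert.1 (Finset.mem_of_mem_erase hx)).resolve_left hxv
      have hrep : ∀ t ∈ T.erase f ∪ f.image s.erase, x ∈ t → ∃ t₀ ∈ T, x ∈ t₀ ∧
          (t = t₀ ∨ t₀ = f ∧ ∃ a ∈ f, t = s.erase a) := by
        intro t ht hxt
        rcases hcases t ht with h | ⟨a, ha, rfl⟩
        · exact ⟨t, h.1, hxt, Or.inl rfl⟩
        · exact ⟨f, hf, hxf a hxt, Or.inr ⟨rfl, a, ha, rfl⟩⟩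
      obtain ⟨t₀, ht₀, hxt₀, h1⟩ := hrep t ht hxt
      obtain ⟨u₀, hu₀, hxu₀, h2⟩ := hrep u hu hxu
      exact hchain x t₀ u₀ (hT.link x t₀ ht₀ u₀ hu₀ hxt₀ hxu₀) ht₀ hxt₀ t u ht hu hxt hxu h1 h2

end

namespace IsBarycentric

variable {s t : Finset E3} {c c' : E3 → E3 →ᵃ[ℝ] ℝ}

/-- On a common face the coordinates do not depend on the tetrahedron. This transfers positivity or
vanishing from one side of the face to the other. -/
lemma eq_of_mem_convexHull (h : IsBarycentric s c) (h' : IsBarycentric t c') {e : Finset E3}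
    (hes : e ⊆ s) (het : e ⊆ t) {x w : E3} (hx : x ∈ convexHull ℝ (e : Set E3)) (hw : w ∈ e) :
    c' w x = c w x := by
  rw [h.eq_one_of_mem_affine (g := c' w) x, Finset.sum_eq_single w]
  · rw [h'.apply_self w (het hw), mul_one]
  · intro b hb hbw
    by_cases hbe : b ∈ e
    · rw [h'.apply_ne w (het hw) b (het hbe) hbw.symm, mul_zero]
    · rw [((h.mem_convexHull_iff hes).1 hx).2 b hb hbe, zero_mul]
  · exact fun hn => absurd (hes hw) hn

lemma mem_frontier_iff (h : IsBarycentric s c) {x : E3} (hx : x ∈ convexHull ℝ (s : Set E3)) :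
    x ∈ frontier (convexHull ℝ (s : Set E3)) ↔ ∃ b ∈ s, c b x = 0 := by
  have h0 := h.mem_convexHull_self_iff.1 hx
  have hcl : IsClosed (convexHull ℝ (s : Set E3)) := (s.finite_toSet.isCompact_convexHull ℝ).isClosed
  rw [hcl.frontier_eq]
  constructor
  · rintro ⟨-, hint⟩
    by_contra! hne
    refine hint (mem_interior_iff_mem_nhds.2 ?_)
    have : ∀ᶠ y in 𝓝 x, ∀ b ∈ s, 0 < c b y := by
      rw [Filter.eventually_all_finset]
      exact fun b hb => (h.continuous b).continuousAt.eventually_const_lt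
        (lt_of_le_of_ne (h0 b hb) (hne b hb).symm)
    filter_upwards [this] with y hy
    exact h.mem_convexHull_self_iff.2 fun b hb => (hy b hb).le
  · rintro ⟨b, hb, hbx⟩
    refine ⟨hx, fun hint => ?_⟩
    have hc : Continuous fun t : ℝ => AffineMap.lineMap b x t := AffineMap.lineMap_continuous
    -- Moving from `b` slightly beyond `x` makes the coordinate of `b` negative.
    have h1 : ∀ᶠ t in 𝓝 (1 : ℝ), AffineMap.lineMap b x t ∈ convexHull ℝ (s : Set E3) :=
      hc.continuousAt.eventually (by
        simp only [AffineMap.lineMap_apply_one]; exact mem_interior_iff_mem_nhds.1 hint)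
    obtain ⟨t, ht, ht1⟩ := ((h1.filter_mono nhdsWithin_le_nhds).and
      (self_mem_nhdsWithin : ∀ᶠ t in 𝓝[>] (1 : ℝ), t ∈ Ioi 1)).exists
    have h2 := h.mem_convexHull_self_iff.1 ht b hb
    rw [AffineMap.apply_lineMap, hbx, h.apply_self b hb, AffineMap.lineMap_apply] at h2
    have h3 : (1 : ℝ) < t := ht1
    simp at h2
    linarith

end IsBarycentric

lemma mem_frontier_union {A B : Set E3} (hA : IsClosed A) (hB : IsClosed B) {x : E3}
    (hx : x ∈ frontier A) (hxB : x ∉ B) : x ∈ frontier (A ∪ B) := by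
  rw [(hA.union hB).frontier_eq]
  refine ⟨Or.inl (hA.frontier_subset hx), fun hint => hx.2 (mem_interior_iff_mem_nhds.2 ?_)⟩
  filter_upwards [mem_interior_iff_mem_nhds.1 hint, hB.isOpen_compl.mem_nhds hxB] with y hy hyB
  exact hy.resolve_right hyB

/-- Faces of the members of a family of tetrahedra form a family. -/
lemma IsSimplexFamily.faces {S T : Finset (Finset E3)} (hS : IsSimplexFamily 4 S)
    (hcard : ∀ t ∈ T, t.card = 3) (hT : ∀ t ∈ T, ∃ s ∈ S, t ⊆ s) : IsSimplexFamily 3 T where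
  card_eq := hcard
  affineIndependent t ht := by
    obtain ⟨s, hs, hts⟩ := hT t ht
    exact (hS.affineIndependent s hs).mono (by exact_mod_cast hts)
  inter_eq a ha b hb := by
    classical
    obtain ⟨s, hs, has⟩ := hT a ha
    obtain ⟨t, ht, hbt⟩ := hT b hb
    refine subset_antisymm ?_ (subset_inter (convexHull_mono inter_subset_left)
      (convexHull_mono inter_subset_right))
    rintro x ⟨hxa, hxb⟩
    obtain ⟨c, hc⟩ := exists_isBarycentric (hS.card_eq s hs) (hS.affineIndependent s hs)
    obtain ⟨c', hc'⟩ := exists_isBarycentric (hS.card_eq t ht) (hS.affineIndependent t ht)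
    have hxs := convexHull_mono (𝕜 := ℝ) (Finset.coe_subset.2 has) hxa
    have hxt := convexHull_mono (𝕜 := ℝ) (Finset.coe_subset.2 hbt) hxb
    have hxst : x ∈ convexHull ℝ ((s ∩ t : Finset E3) : Set E3) := by
      rw [Finset.coe_inter, ← hS.inter_eq s hs t ht]; exact ⟨hxs, hxt⟩
    have h1 := (hc.mem_convexHull_iff has).1 hxa
    have h2 := (hc.mem_convexHull_iff Finset.inter_subset_left).1 hxst
    have h3 := (hc'.mem_convexHull_iff hbt).1 hxb
    rw [← Finset.coe_inter, hc.mem_convexHull_iff (Finset.inter_subset_left.trans has)]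
    refine ⟨h1.1, fun z hz hzab => ?_⟩
    by_cases hza : z ∈ a
    · by_cases hzt : z ∈ s ∩ t
      · rw [← hc.eq_of_mem_convexHull hc' Finset.inter_subset_left Finset.inter_subset_right hxst hzt]
        exact h3.2 z (Finset.mem_inter.1 hzt).2 fun hzb => hzab (Finset.mem_inter.2 ⟨hza, hzb⟩)
      · exact h2.2 z hz hzt
    · exact h1.2 z hz hza

/-- A connected family of tetrahedra together with a triangulation of its boundary. -/
structure IsTriangulatedBody (S T : Finset (Finset E3)) : Prop where
  family : IsSimplexFamily 4 S
  isConnected : IsConnected (carrier S)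
  faces : ∀ t ∈ T, ∃ s ∈ S, t ⊆ s
  closed : IsClosedTriangulation T
  frontier_eq : frontier (carrier S) = carrier T

lemma IsTriangulatedBody.isPolyhedron {S T : Finset (Finset E3)} (h : IsTriangulatedBody S T) :
    IsPolyhedron (carrier S) where
  isCompact := S.finite_toSet.isCompact_biUnion fun s _ => s.finite_toSet.isCompact_convexHull ℝ
  isConnected := h.isConnected
  isPLSurface_frontier := ⟨T, h.family.faces h.closed.card_eq h.faces, h.frontier_eq.symm,
    h.closed.ncard_edge, h.closed.link⟩

lemma mem_carrier {T : Finset (Finset E3)} {x : E3} :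
    x ∈ carrier T ↔ ∃ t ∈ T, x ∈ convexHull ℝ (t : Set E3) := by simp [carrier]

section

variable [DecidableEq E3]

lemma isTriangulatedBody_singleton {s : Finset E3} (hcard : s.card = 4)
    (hs : AffineIndependent ℝ ((↑) : s → E3)) : IsTriangulatedBody {s} (s.image s.erase) := by
  have hcar : carrier {s} = convexHull ℝ (s : Set E3) := by simp [carrier]
  refine ⟨⟨by simpa, by simpa, by simp⟩, ?_, ?_, isClosedTriangulation_faces hcard, ?_⟩
  · rw [hcar]
    refine (convex_convexHull ℝ _).isConnected ?_
    rw [convexHull_nonempty_iff]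
    exact Finset.card_pos.1 (by omega)
  · intro t ht
    obtain ⟨a, ha, rfl⟩ := Finset.mem_image.1 ht
    exact ⟨s, by simp, Finset.erase_subset _ _⟩
  · obtain ⟨c, hc⟩ := exists_isBarycentric hcard hs
    rw [hcar]
    ext x
    rw [mem_carrier]
    have hcl : IsClosed (convexHull ℝ (s : Set E3)) :=
      (s.finite_toSet.isCompact_convexHull ℝ).isClosed
    constructor
    · intro hx
      have hxs := hcl.frontier_subset hx
      obtain ⟨b, hb, hbx⟩ := (hc.mem_frontier_iff hxs).1 hx
      refine ⟨s.erase b, Finset.mem_image_of_mem _ hb, ?_⟩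
      rw [hc.mem_convexHull_iff (Finset.erase_subset _ _)]
      refine ⟨hc.mem_convexHull_self_iff.1 hxs, fun a ha hab => ?_⟩
      have : a = b := by
        by_contra h
        exact hab (Finset.mem_erase.2 ⟨h, ha⟩)
      rwa [this]
    · rintro ⟨t, ht, hxt⟩
      obtain ⟨b, hb, rfl⟩ := Finset.mem_image.1 ht
      rw [hc.mem_convexHull_iff (Finset.erase_subset _ _)] at hxt
      exact (hc.mem_frontier_iff (hc.mem_convexHull_self_iff.2 hxt.1)).2
        ⟨b, hb, hxt.2 b hb (Finset.notMem_erase b s)⟩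

/-- Gluing a tetrahedron onto a boundary triangle `f`, where the plane `ℓ = 0` of `f` separates the
new vertex from all other old vertices. -/
lemma IsTriangulatedBody.glue {S T : Finset (Finset E3)} (h : IsTriangulatedBody S T)
    {f : Finset E3} (hf : f ∈ T) {v : E3} (hcard : (insert v f).card = 4)
    (hind : AffineIndependent ℝ ((↑) : ↥(insert v f) → E3)) {ℓ : E3 →ᵃ[ℝ] ℝ}
    (hℓf : ∀ b ∈ f, ℓ b = 0) (hℓv : 0 < ℓ v) (hℓS : ∀ s ∈ S, ∀ b ∈ s, b ∉ f → ℓ b < 0) :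
    IsTriangulatedBody (insert (insert v f) S) (T.erase f ∪ f.image (insert v f).erase) := by
  have hfam3 := h.family.faces h.closed.card_eq h.faces
  have hf3 := h.closed.card_eq f hf
  have hvf : v ∉ f := fun hv => hℓv.ne' (hℓf v hv)
  have hℓS' : ∀ s ∈ S, ∀ b ∈ s, ℓ b ≤ 0 := fun s hs b hb => by
    by_cases hbf : b ∈ f
    · exact (hℓf b hbf).le
    · exact (hℓS s hs b hb hbf).le
  set σ := insert v f with hσ
  have hvσ : v ∈ σ := Finset.mem_insert_self _ _
  have hfσ : f ⊆ σ := Finset.subset_insert _ _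
  obtain ⟨c, hc⟩ := exists_isBarycentric hcard hind
  set P := carrier S with hP
  set K := convexHull ℝ (σ : Set E3) with hK
  have hPcl : IsClosed P := isClosed_carrier S
  have hKcl : IsClosed K := (σ.finite_toSet.isCompact_convexHull ℝ).isClosed
  have hℓc : ∀ x : E3, ℓ x = c v x * ℓ v := fun x => by
    rw [hc.eq_one_of_mem_affine (g := ℓ) x, Finset.sum_insert hvf, Finset.sum_eq_zero, add_zero]
    intro b hb
    rw [hℓf b hb, mul_zero]
  have hcface : ∀ {b x}, b ∈ σ → (x ∈ convexHull ℝ ((σ.erase b : Finset E3) : Set E3) ↔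
      x ∈ K ∧ c b x = 0) := by
    intro b x hb
    rw [hc.mem_convexHull_iff (Finset.erase_subset _ _), hK, hc.mem_convexHull_self_iff]
    refine and_congr_right fun _ => ⟨fun h => h b hb (Finset.notMem_erase _ _), fun h a ha hab => ?_⟩
    have : a = b := by
      by_contra h
      exact hab (Finset.mem_erase.2 ⟨h, ha⟩)
    rwa [this]
  have hcf : ∀ {x}, x ∈ convexHull ℝ (f : Set E3) ↔ x ∈ K ∧ c v x = 0 := by
    intro x
    rw [← hcface hvσ, hσ, Finset.erase_insert hvf]
  -- The old body is on the side `ℓ ≤ 0` and touches the plane only in `f`, because `ℓ` is negative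
  -- at every old vertex outside `f`. The new tetrahedron is on the side `ℓ ≥ 0`.
  have hzero : ∀ s ∈ S, ∀ x ∈ convexHull ℝ (s : Set E3), ℓ x ≤ 0 ∧
      (ℓ x = 0 → x ∈ convexHull ℝ ((s ∩ f : Finset E3) : Set E3)) := by
    intro s hs x hx
    obtain ⟨c', hc'⟩ := exists_isBarycentric (h.family.card_eq s hs) (h.family.affineIndependent s hs)
    have hx0 := hc'.mem_convexHull_self_iff.1 hx
    have hterm : ∀ a ∈ s, c' a x * ℓ a ≤ 0 := fun a ha =>
      mul_nonpos_of_nonneg_of_nonpos (hx0 a ha) (hℓS' s hs a ha)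
    rw [hc'.eq_one_of_mem_affine (g := ℓ) x]
    refine ⟨Finset.sum_nonpos hterm, fun h0 => ?_⟩
    rw [hc'.mem_convexHull_iff Finset.inter_subset_left]
    refine ⟨hx0, fun a ha haf => ?_⟩
    have h1 := (Finset.sum_eq_zero_iff_of_nonpos hterm).1 h0 a ha
    have h2 := hℓS s hs a ha fun h => haf (Finset.mem_inter.2 ⟨ha, h⟩)
    exact (mul_eq_zero.1 h1).resolve_right h2.ne
  have hzero' : ∀ x ∈ P, ℓ x ≤ 0 := fun x hx => by
    obtain ⟨s, hs, hxs⟩ := mem_carrier.1 hx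
    exact (hzero s hs x hxs).1
  have hcv : ∀ x ∈ K, ∀ a ∈ σ, 0 ≤ c a x := fun x hx => hc.mem_convexHull_self_iff.1 hx
  have hcvzero : ∀ x ∈ K, ℓ x ≤ 0 → c v x = 0 := fun x hx h0 => by
    rw [hℓc] at h0
    exact le_antisymm (by
      by_contra hlt
      push Not at hlt
      exact not_lt.2 h0 (mul_pos hlt hℓv)) (hcv x hx v hvσ)
  have hinter : ∀ t ∈ S, K ∩ convexHull ℝ (t : Set E3) = convexHull ℝ ((σ : Set E3) ∩ (t : Set E3)) := by
    intro t ht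
    refine subset_antisymm ?_ (subset_inter (convexHull_mono inter_subset_left)
      (convexHull_mono inter_subset_right))
    rintro x ⟨hxK, hxt⟩
    have h1 := (hzero t ht x hxt).1
    have h2 := hcvzero x hxK h1
    have h3 := (hzero t ht x hxt).2 (by rw [hℓc, h2, zero_mul])
    refine convexHull_mono ?_ h3
    rw [Finset.coe_inter, inter_comm]
    exact inter_subset_inter_left _ (by exact_mod_cast hfσ)
  have hcar : carrier (insert σ S) = P ∪ K := by
    rw [union_comm]; simp [carrier, hP, hK]
  obtain ⟨s₀, hs₀, hfs₀⟩ := h.faces f hf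
  have hfP : convexHull ℝ (f : Set E3) ⊆ P :=
    (convexHull_mono (Finset.coe_subset.2 hfs₀)).trans (convexHull_subset_carrier hs₀)
  have hfne : f.Nonempty := Finset.card_pos.1 (by omega)
  refine ⟨⟨?_, ?_, ?_⟩, ?_, ?_, h.closed.glue hf ?_, ?_⟩
  · intro s hs
    rcases Finset.mem_insert.1 hs with rfl | hs
    exacts [hcard, h.family.card_eq s hs]
  · intro s hs
    rcases Finset.mem_insert.1 hs with rfl | hs
    exacts [hind, h.family.affineIndependent s hs]
  · intro s hs t ht
    rcases Finset.mem_insert.1 hs with rfl | hs <;> rcases Finset.mem_insert.1 ht with rfl | ht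
    · rw [inter_self, inter_self]
    · exact hinter t ht
    · rw [inter_comm, inter_comm (s : Set E3)]; exact hinter s hs
    · exact h.family.inter_eq s hs t ht
  · rw [hcar]
    obtain ⟨b, hb⟩ := hfne
    refine IsConnected.union ⟨b, hfP (subset_convexHull ℝ _ hb), subset_convexHull ℝ _ (hfσ hb)⟩
      h.isConnected ((convex_convexHull ℝ _).isConnected ?_)
    exact ⟨b, subset_convexHull ℝ _ (hfσ hb)⟩
  · intro t ht
    rcases Finset.mem_union.1 ht with ht | ht
    · obtain ⟨s, hs, hts⟩ := h.faces t (Finset.mem_of_mem_erase ht)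
      exact ⟨s, Finset.mem_insert_of_mem hs, hts⟩
    · obtain ⟨a, ha, rfl⟩ := Finset.mem_image.1 ht
      exact ⟨σ, Finset.mem_insert_self _ _, Finset.erase_subset _ _⟩
  · intro t ht hvt
    obtain ⟨s, hs, hts⟩ := h.faces t ht
    exact not_lt.2 (hℓS' s hs v (hts hvt)) hℓv
  · rw [hcar]
    -- relative interior points of `f` become interior
    have hrel : ∀ x ∈ convexHull ℝ (f : Set E3), x ∈ frontier (P ∪ K) → ∃ b ∈ f, c b x = 0 := by
      intro x hx hfr
      by_contra! hne
      obtain ⟨a, ha⟩ : ∃ a, s₀ \ f = {a} := Finset.card_eq_one.1 (by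
        rw [Finset.card_sdiff_of_subset hfs₀, hf3, h.family.card_eq s₀ hs₀])
      have ha' : a ∈ s₀ ∧ a ∉ f := Finset.mem_sdiff.1 (ha ▸ Finset.mem_singleton_self a)
      have hs₀' : s₀ = insert a f := by
        rw [Finset.insert_eq, ← ha, Finset.sdiff_union_of_subset hfs₀]
      have hℓa := hℓS s₀ hs₀ a ha'.1 ha'.2
      obtain ⟨c', hc'⟩ :=
        exists_isBarycentric (h.family.card_eq s₀ hs₀) (h.family.affineIndependent s₀ hs₀)
      have hℓc' : ∀ x, ℓ x = c' a x * ℓ a := fun x => by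
        have hc'' := hc'
        rw [hs₀'] at hc''
        rw [hc''.eq_one_of_mem_affine (g := ℓ) x, Finset.sum_insert ha'.2, Finset.sum_eq_zero, add_zero]
        intro b hb
        rw [hℓf b hb, mul_zero]
      have h1 : ∀ᶠ y in 𝓝 x, ∀ b ∈ f, 0 < c b y ∧ 0 < c' b y := by
        rw [Filter.eventually_all_finset]
        intro b hb
        have hpos : 0 < c b x := lt_of_le_of_ne (hcv x (hcf.1 hx).1 b (hfσ hb)) (hne b hb).symm
        have hpos' : 0 < c' b x := by rwa [hc.eq_of_mem_convexHull hc' hfσ hfs₀ hx hb]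
        exact ((hc.continuous b).continuousAt.eventually_const_lt hpos).and
          ((hc'.continuous b).continuousAt.eventually_const_lt hpos')
      -- Around such a point the new tetrahedron fills the side `ℓ ≥ 0` and the old tetrahedron `s₀`
      -- on `f` fills the side `ℓ ≤ 0`.
      refine hfr.2 (mem_interior_iff_mem_nhds.2 ?_)
      filter_upwards [h1] with y hy
      rcases le_total 0 (ℓ y) with hl | hl
      · right
        refine hc.mem_convexHull_self_iff.2 fun b hb => ?_
        rcases Finset.mem_insert.1 hb with rfl | hb
        · rw [hℓc] at hl
          exact nonneg_of_mul_nonneg_left hl hℓv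
        · exact (hy b hb).1.le
      · left
        refine convexHull_subset_carrier hs₀ (hc'.mem_convexHull_self_iff.2 fun b hb => ?_)
        rw [hs₀'] at hb
        rcases Finset.mem_insert.1 hb with rfl | hb
        · rw [hℓc'] at hl
          by_contra hlt
          push Not at hlt
          exact not_lt.2 hl (mul_pos_of_neg_of_neg hlt hℓa)
        · exact (hy b hb).2.le
    have hnewmem : ∀ x ∈ K, ∀ b ∈ f, c b x = 0 → x ∈ carrier (T.erase f ∪ f.image σ.erase) := by
      intro x hx b hb hbx
      exact mem_carrier.2 ⟨σ.erase b, Finset.mem_union_right _ (Finset.mem_image_of_mem _ hb),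
        (hcface (hfσ hb)).2 ⟨hx, hbx⟩⟩
    -- Pushed towards `v`, the point stays on the new face but leaves the old body, so the frontier
    -- of `K` is the frontier of the union there; then let the push tend to zero.
    have hnewfr : ∀ x ∈ K, ∀ b ∈ f, c b x = 0 → x ∈ frontier (P ∪ K) := by
      intro x hx b hb hbx
      have hbv : b ≠ v := fun e => hvf (e ▸ hb)
      have hmem : ∀ t ∈ Ioc (0 : ℝ) 1, AffineMap.lineMap x v t ∈ frontier (P ∪ K) := by
        intro t ht
        have hyK : AffineMap.lineMap x v t ∈ K :=
          (convex_convexHull ℝ _).lineMap_mem hx (subset_convexHull ℝ _ hvσ) ⟨ht.1.le, ht.2⟩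
        have hcb : c b (AffineMap.lineMap x v t) = 0 := by
          rw [AffineMap.apply_lineMap, hbx, hc.apply_ne b (hfσ hb) v hvσ hbv]; simp
        have hcvpos : 0 < c v (AffineMap.lineMap x v t) := by
          rw [AffineMap.apply_lineMap, hc.apply_self v hvσ, AffineMap.lineMap_apply]
          simp only [vsub_eq_sub, smul_eq_mul, vadd_eq_add]
          have h0 := hcv x hx v hvσ
          nlinarith [ht.1, ht.2, mul_nonneg h0 (sub_nonneg.2 ht.2)]
        rw [union_comm]
        refine mem_frontier_union hKcl hPcl ((hc.mem_frontier_iff hyK).2 ⟨b, hfσ hb, hcb⟩) fun hyP => ?_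
        have := hzero' _ hyP
        rw [hℓc] at this
        exact not_lt.2 this (mul_pos hcvpos hℓv)
      have hlim : Tendsto (fun t : ℝ => AffineMap.lineMap x v t) (𝓝[>] 0) (𝓝 x) := by
        have hcont : Continuous fun t : ℝ => AffineMap.lineMap x v t := AffineMap.lineMap_continuous
        have := hcont.tendsto 0
        rw [AffineMap.lineMap_apply_zero] at this
        exact this.mono_left nhdsWithin_le_nhds
      exact isClosed_frontier.mem_of_tendsto hlim
        (mem_of_superset (Ioc_mem_nhdsGT one_pos) hmem)
    refine subset_antisymm ?_ ?_
    · intro x hx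
      have hf' : x ∈ convexHull ℝ (f : Set E3) → x ∈ carrier (T.erase f ∪ f.image σ.erase) := by
        intro hxf
        obtain ⟨b, hb, hbx⟩ := hrel x hxf hx
        exact hnewmem x (hcf.1 hxf).1 b hb hbx
      rcases frontier_union_subset P K hx with ⟨hxP, -⟩ | ⟨-, hxK⟩
      · rw [h.frontier_eq, mem_carrier] at hxP
        obtain ⟨t, ht, hxt⟩ := hxP
        by_cases htf : t = f
        · exact hf' (htf ▸ hxt)
        · exact mem_carrier.2 ⟨t, Finset.mem_union_left _ (Finset.mem_erase.2 ⟨htf, ht⟩), hxt⟩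
      · have hxK' := hKcl.frontier_subset hxK
        obtain ⟨b, hb, hbx⟩ := (hc.mem_frontier_iff hxK').1 hxK
        rcases Finset.mem_insert.1 hb with rfl | hb
        · exact hf' (hcf.2 ⟨hxK', hbx⟩)
        · exact hnewmem x hxK' b hb hbx
    · intro x hx
      obtain ⟨t, ht, hxt⟩ := mem_carrier.1 hx
      rcases Finset.mem_union.1 ht with ht | ht
      · obtain ⟨htf, ht⟩ := Finset.mem_erase.1 ht
        have hxfr : x ∈ frontier P := by rw [h.frontier_eq]; exact convexHull_subset_carrier ht hxt
        by_cases hxK : x ∈ K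
        · have hxf : x ∈ convexHull ℝ (f : Set E3) :=
            hcf.2 ⟨hxK, hcvzero x hxK (hzero' x (hPcl.frontier_subset hxfr))⟩
          -- An old triangle `t ≠ f` meets `K` only in a proper face of `f`, and such a face is part
          -- of a new face.
          obtain ⟨b, hb⟩ : (f \ t).Nonempty := by
            rw [Finset.sdiff_nonempty]
            intro hsub
            exact htf (Finset.eq_of_subset_of_card_le hsub
              (by rw [hf3, h.closed.card_eq t ht])).symm
          rw [Finset.mem_sdiff] at hb
          refine hnewfr x hxK b hb.1 ?_
          have hxft : x ∈ convexHull ℝ ((f ∩ t : Finset E3) : Set E3) := by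
            rw [Finset.coe_inter, ← hfam3.inter_eq f hf t ht]; exact ⟨hxf, hxt⟩
          exact ((hc.mem_convexHull_iff (Finset.inter_subset_left.trans hfσ)).1 hxft).2 b (hfσ hb.1)
            fun hbt => hb.2 (Finset.mem_inter.1 hbt).2
        · exact mem_frontier_union hPcl hKcl hxfr hxK
      · obtain ⟨b, hb, rfl⟩ := Finset.mem_image.1 ht
        obtain ⟨h1, h2⟩ := (hcface (hfσ hb)).1 hxt
        exact hnewfr x h1 b hb h2

end

/-! ### The zigzag of stacked tetrahedra. -/

/-- The affine function `x ↦ a x₀ + b x₁ + c x₂ + d`. -/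
noncomputable def affineForm (a b c d : ℝ) : E3 →ᵃ[ℝ] ℝ :=
  (a • (EuclideanSpace.proj (0 : Fin 3) : E3 →L[ℝ] ℝ).toLinearMap +
    b • (EuclideanSpace.proj (1 : Fin 3) : E3 →L[ℝ] ℝ).toLinearMap +
    c • (EuclideanSpace.proj (2 : Fin 3) : E3 →L[ℝ] ℝ).toLinearMap).toAffineMap +
    AffineMap.const ℝ E3 d

lemma affineForm_apply (a b c d : ℝ) (x : E3) :
    affineForm a b c d x = a * x 0 + b * x 1 + c * x 2 + d := by
  simp [affineForm]

/-- The amplitude of the zigzag at level `i`. -/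
noncomputable def amp (i : ℕ) : ℝ := 1000 * 4 ^ i

/-- The three vertices, `r = 0, 1, 2`, of the zigzag at level `i`. -/
noncomputable def levelVertex (i r : ℕ) : E3 :=
  !₂[(-1) ^ i * (amp i + match r with | 0 => 2 * (i : ℝ) | 1 => 0 | _ => -(2 * (i : ℝ) + 1)),
    (-1) ^ i * ((r : ℝ) - 1), (i : ℝ)]

/-- The vertices of the zigzag. -/
noncomputable def vertex (n : ℕ) : E3 := levelVertex ((n + 2) / 3) ((n + 2) % 3)

lemma vertex_eq {n i r : ℕ} (hr : r < 3) (h : n + 2 = 3 * i + r) : vertex n = levelVertex i r := by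
  unfold vertex
  rw [show (n + 2) / 3 = i by omega, show (n + 2) % 3 = r by omega]

lemma exists_level (n : ℕ) : ∃ i r, r < 3 ∧ n + 2 = 3 * i + r :=
  ⟨(n + 2) / 3, (n + 2) % 3, Nat.mod_lt _ (by norm_num), by omega⟩

lemma levelVertex_two (i r : ℕ) : levelVertex i r 2 = i := by simp [levelVertex]

lemma neg_one_pow_cases (i : ℕ) : ((-1 : ℝ) ^ i = 1 ∧ (-1 : ℝ) ^ (i + 1) = -1) ∨
    ((-1 : ℝ) ^ i = -1 ∧ (-1 : ℝ) ^ (i + 1) = 1) := by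
  rcases neg_one_pow_eq_or ℝ i with h | h
  · exact Or.inl ⟨h, by rw [pow_succ, h]; ring⟩
  · exact Or.inr ⟨h, by rw [pow_succ, h]; ring⟩

lemma cast_add_one_le_pow (i : ℕ) : (i : ℝ) + 1 ≤ 4 ^ i := by
  have h : i + 1 ≤ 4 ^ i := Nat.lt_pow_self (by norm_num)
  exact_mod_cast h

lemma abs_levelVertex_zero_sub_le {i r : ℕ} (hr : r < 3) :
    |(-1) ^ i * levelVertex i r 0 - amp i| ≤ 2 * 4 ^ i := by
  have h := cast_add_one_le_pow i
  have hi : (0 : ℝ) ≤ i := Nat.cast_nonneg i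
  rw [abs_le]
  interval_cases r <;> rcases neg_one_pow_cases i with ⟨h1, -⟩ | ⟨h1, -⟩ <;>
    simp [levelVertex, h1] <;> constructor <;> linarith

lemma abs_levelVertex_one_le {i r : ℕ} (hr : r < 3) : |levelVertex i r 1| ≤ 1 := by
  interval_cases r <;> rcases neg_one_pow_cases i with ⟨h1, -⟩ | ⟨h1, -⟩ <;>
    simp [levelVertex, h1] <;> norm_num

lemma abs_levelVertex_zero_le {l i r : ℕ} (hr : r < 3) (hl : l < i) :
    |levelVertex l r 0| ≤ 251 * 4 ^ i := by
  have h1 := abs_le.1 (abs_levelVertex_zero_sub_le (i := l) hr)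
  have h2 : (4 : ℝ) ^ l * 4 ≤ 4 ^ i := by
    rw [← pow_succ]
    exact pow_le_pow_right₀ (by norm_num) hl
  have h3 : (0 : ℝ) < 4 ^ l := by positivity
  unfold amp at h1
  rw [abs_le]
  rcases neg_one_pow_cases l with ⟨h4, -⟩ | ⟨h4, -⟩ <;> rw [h4] at h1 <;> constructor <;> linarith

/-- The plane of three consecutive vertices separates the next vertex from all earlier ones. -/
lemma exists_separating_plane (m : ℕ) : ∃ ℓ : E3 →ᵃ[ℝ] ℝ, ℓ (vertex m) = 0 ∧
    ℓ (vertex (m + 1)) = 0 ∧ ℓ (vertex (m + 2)) = 0 ∧ 0 < ℓ (vertex (m + 3)) ∧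
      ∀ j < m, ℓ (vertex j) < 0 := by
  obtain ⟨i, r, hr, hm⟩ := exists_level m
  have hi := cast_add_one_le_pow i
  have hi0 : (0 : ℝ) ≤ i := Nat.cast_nonneg i
  have hpow : (4 : ℝ) ^ (i + 1) = 4 * 4 ^ i := by ring
  have hlow : ∀ {l s : ℕ}, s < 3 → l < i → (l : ℝ) ≤ i - 1 ∧
      -(251 * 4 ^ i) ≤ (-1) ^ i * levelVertex l s 0 ∧ (-1) ^ i * levelVertex l s 0 ≤ 251 * 4 ^ i ∧
      (-1) ^ i * levelVertex l s 1 ≤ 1 := by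
    intro l s hs hl
    have h1 := abs_le.1 (abs_levelVertex_zero_le hs hl)
    have h2 := abs_le.1 (abs_levelVertex_one_le (i := l) hs)
    have h3 : ((l + 1 : ℕ) : ℝ) ≤ i := by exact_mod_cast hl
    push_cast at h3
    rcases neg_one_pow_cases i with ⟨h4, -⟩ | ⟨h4, -⟩ <;> rw [h4] <;>
      refine ⟨?_, ?_, ?_, ?_⟩ <;> linarith
  -- Projected to the first two coordinates and with the signs removed, the two edges of level `i`
  -- descend with slopes `2i` and `2i + 1`, so the slopes increase by one from edge to edge through
  -- all levels. The plane of three consecutive vertices on two levels contains one of these edges.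
  -- Because of the slopes, `ℓ` is 1 at the next vertex and at most `-1` at the earlier vertices of
  -- level `i`; at the levels below, the large coefficient of the height decides. For three vertices
  -- of one level, the plane is horizontal.
  interval_cases r
  · refine ⟨affineForm 0 0 1 (-i), ?_, ?_, ?_, ?_, fun j hj => ?_⟩
    · rw [vertex_eq (i := i) (r := 0) (by norm_num) (by omega), affineForm_apply, levelVertex_two]; ring
    · rw [vertex_eq (i := i) (r := 1) (by norm_num) (by omega), affineForm_apply, levelVertex_two]; ring
    · rw [vertex_eq (i := i) (r := 2) (by norm_num) (by omega), affineForm_apply, levelVertex_two]; ring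
    · rw [vertex_eq (i := i + 1) (r := 0) (by norm_num) (by omega), affineForm_apply, levelVertex_two]
      push_cast; linarith
    · obtain ⟨l, s, hs, hj'⟩ := exists_level j
      rw [vertex_eq hs hj', affineForm_apply, levelVertex_two]
      have := (hlow hs (l := l) (by omega)).1
      linarith
  · refine ⟨affineForm ((-1) ^ i) ((2 * i + 1) * (-1) ^ i) (amp (i + 1) + amp i + 1)
      (-amp i - (amp (i + 1) + amp i + 1) * i), ?_, ?_, ?_, ?_, fun j hj => ?_⟩
    · rw [vertex_eq (i := i) (r := 1) (by norm_num) (by omega), affineForm_apply]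
      rcases neg_one_pow_cases i with ⟨h4, -⟩ | ⟨h4, -⟩ <;> simp [levelVertex, h4]
    · rw [vertex_eq (i := i) (r := 2) (by norm_num) (by omega), affineForm_apply]
      rcases neg_one_pow_cases i with ⟨h4, -⟩ | ⟨h4, -⟩ <;> simp [levelVertex, h4] <;> ring
    · rw [vertex_eq (i := i + 1) (r := 0) (by norm_num) (by omega), affineForm_apply]
      rcases neg_one_pow_cases i with ⟨h4, h5⟩ | ⟨h4, h5⟩ <;> simp [levelVertex, h4, h5] <;> ring
    · rw [vertex_eq (i := i + 1) (r := 1) (by norm_num) (by omega), affineForm_apply]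
      rcases neg_one_pow_cases i with ⟨h4, h5⟩ | ⟨h4, h5⟩ <;> simp [levelVertex, h4, h5] <;> linarith
    · obtain ⟨l, s, hs, hj'⟩ := exists_level j
      rw [vertex_eq hs hj', affineForm_apply]
      rcases (show l < i ∨ l = i by omega) with hl | rfl
      · obtain ⟨h1, h2, h3, h4⟩ := hlow hs hl
        have h5 := mul_le_mul_of_nonneg_left h4 (by linarith : (0 : ℝ) ≤ 2 * i + 1)
        have h7 : (0 : ℝ) ≤ amp (i + 1) + amp i + 1 := by unfold amp; positivity
        have h6 := mul_le_mul_of_nonneg_left h1 h7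
        rw [levelVertex_two]
        unfold amp at *
        rw [hpow] at *
        nlinarith
      · obtain rfl : s = 0 := by omega
        rcases neg_one_pow_cases l with ⟨h4, -⟩ | ⟨h4, -⟩ <;> simp [levelVertex, h4] <;> linarith
  · refine ⟨affineForm ((-1) ^ i) ((2 * i + 2) * (-1) ^ i) (amp i + amp (i + 1) + 1)
      (amp (i + 1) - (amp i + amp (i + 1) + 1) * (i + 1)), ?_, ?_, ?_, ?_, fun j hj => ?_⟩
    · rw [vertex_eq (i := i) (r := 2) (by norm_num) (by omega), affineForm_apply]
      rcases neg_one_pow_cases i with ⟨h4, -⟩ | ⟨h4, -⟩ <;> simp [levelVertex, h4] <;> ring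
    · rw [vertex_eq (i := i + 1) (r := 0) (by norm_num) (by omega), affineForm_apply]
      rcases neg_one_pow_cases i with ⟨h4, h5⟩ | ⟨h4, h5⟩ <;> simp [levelVertex, h4, h5] <;> ring
    · rw [vertex_eq (i := i + 1) (r := 1) (by norm_num) (by omega), affineForm_apply]
      rcases neg_one_pow_cases i with ⟨h4, h5⟩ | ⟨h4, h5⟩ <;> simp [levelVertex, h4, h5]
    · rw [vertex_eq (i := i + 1) (r := 2) (by norm_num) (by omega), affineForm_apply]
      rcases neg_one_pow_cases i with ⟨h4, h5⟩ | ⟨h4, h5⟩ <;> simp [levelVertex, h4, h5] <;> linarith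
    · obtain ⟨l, s, hs, hj'⟩ := exists_level j
      rw [vertex_eq hs hj', affineForm_apply]
      rcases (show l < i ∨ l = i by omega) with hl | rfl
      · obtain ⟨h1, h2, h3, h4⟩ := hlow hs hl
        have h5 := mul_le_mul_of_nonneg_left h4 (by linarith : (0 : ℝ) ≤ 2 * i + 2)
        have h7 : (0 : ℝ) ≤ amp i + amp (i + 1) + 1 := by unfold amp; positivity
        have h6 := mul_le_mul_of_nonneg_left h1 h7
        rw [levelVertex_two]
        unfold amp at *
        rw [hpow] at *
        nlinarith
      · rcases (show s = 0 ∨ s = 1 by omega) with rfl | rfl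
        · rcases neg_one_pow_cases l with ⟨h4, -⟩ | ⟨h4, -⟩ <;> simp [levelVertex, h4] <;> linarith
        · rcases neg_one_pow_cases l with ⟨h4, -⟩ | ⟨h4, -⟩ <;> simp [levelVertex, h4] <;> linarith

lemma vertex_injective : Function.Injective vertex := by
  have key : ∀ j k, j < k → vertex j ≠ vertex k := by
    intro j k hjk h
    obtain ⟨ℓ, h0, -, -, -, hlt⟩ := exists_separating_plane k
    have := hlt j hjk
    rw [h, h0] at this
    exact lt_irrefl _ this
  intro j k h
  rcases lt_trichotomy j k with hjk | hjk | hjk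
  · exact absurd h (key j k hjk)
  · exact hjk
  · exact absurd h.symm (key k j hjk)

section

variable [DecidableEq E3]

/-- The triangle of three consecutive vertices. -/
noncomputable def stackFace (m : ℕ) : Finset E3 := {vertex m, vertex (m + 1), vertex (m + 2)}

/-- The tetrahedron of four consecutive vertices. -/
noncomputable def stackTetra (m : ℕ) : Finset E3 := insert (vertex (m + 3)) (stackFace m)

/-- The first `m` tetrahedra of the zigzag. -/
noncomputable def stack (m : ℕ) : Finset (Finset E3) := (Finset.range m).image stackTetra

lemma mem_stackFace {m : ℕ} {x : E3} : x ∈ stackFace m ↔ ∃ k, m ≤ k ∧ k ≤ m + 2 ∧ x = vertex k := by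
  simp only [stackFace, Finset.mem_insert, Finset.mem_singleton]
  constructor
  · rintro (rfl | rfl | rfl)
    exacts [⟨m, by omega, by omega, rfl⟩, ⟨m + 1, by omega, by omega, rfl⟩,
      ⟨m + 2, by omega, by omega, rfl⟩]
  · rintro ⟨k, h1, h2, rfl⟩
    obtain rfl | rfl | rfl : k = m ∨ k = m + 1 ∨ k = m + 2 := by omega
    all_goals simp

lemma mem_stackTetra {m : ℕ} {x : E3} :
    x ∈ stackTetra m ↔ ∃ k, m ≤ k ∧ k ≤ m + 3 ∧ x = vertex k := by
  rw [stackTetra, Finset.mem_insert, mem_stackFace]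
  constructor
  · rintro (rfl | ⟨k, h1, h2, rfl⟩)
    exacts [⟨m + 3, by omega, by omega, rfl⟩, ⟨k, by omega, by omega, rfl⟩]
  · rintro ⟨k, h1, h2, rfl⟩
    by_cases hk : k = m + 3
    · exact Or.inl (by rw [hk])
    · exact Or.inr ⟨k, h1, by omega, rfl⟩

lemma card_stackFace (m : ℕ) : (stackFace m).card = 3 := by
  refine Finset.card_eq_three.2 ⟨_, _, _, ?_, ?_, ?_, rfl⟩ <;>
  · intro h
    have := vertex_injective h
    omega

lemma card_stackTetra (m : ℕ) : (stackTetra m).card = 4 := by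
  rw [stackTetra, Finset.card_insert_of_notMem, card_stackFace]
  rw [mem_stackFace]
  rintro ⟨k, h1, h2, h⟩
  have := vertex_injective h
  omega

lemma stackTetra_injective : Function.Injective stackTetra := by
  have key : ∀ j k, j < k → stackTetra j ≠ stackTetra k := by
    intro j k hjk h
    have h1 : vertex j ∈ stackTetra k := h ▸ mem_stackTetra.2 ⟨j, le_rfl, by omega, rfl⟩
    obtain ⟨l, hl, -, hl'⟩ := mem_stackTetra.1 h1
    have := vertex_injective hl'
    omega
  intro j k h
  rcases lt_trichotomy j k with hjk | hjk | hjk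
  · exact absurd h (key j k hjk)
  · exact hjk
  · exact absurd h.symm (key k j hjk)

lemma card_stack (m : ℕ) : (stack m).card = m := by
  rw [stack, Finset.card_image_of_injective _ stackTetra_injective, Finset.card_range]

/-- Apply the separating planes at `m`, `m + 1` and `m + 2` to a dependence: they isolate the
weights of the last, the first and the second vertex in turn, and the remaining weight vanishes with
the sum. -/
lemma affineIndependent_stackTetra (m : ℕ) :
    AffineIndependent ℝ ((↑) : ↥(stackTetra m) → E3) := by
  have h : AffineIndependent ℝ (fun i : Fin 4 => vertex (m + i)) := by
    rw [affineIndependent_iff_of_fintype]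
    intro w h0 h1
    rw [Finset.univ.weightedVSub_eq_linear_combination h0] at h1
    have key : ∀ ℓ : E3 →ᵃ[ℝ] ℝ, ∑ i : Fin 4, w i * ℓ (vertex (m + i)) = 0 := by
      intro ℓ
      have h2 : ∀ x, ℓ x = ℓ.linear x + ℓ 0 := fun x => congrFun ℓ.decomp x
      have h3 := congrArg ℓ.linear h1
      rw [map_sum, map_zero] at h3
      simp only [map_smul, smul_eq_mul] at h3
      simp only [h2 (vertex _), mul_add, Finset.sum_add_distrib, h3, ← Finset.sum_mul, h0]
      ring
    obtain ⟨ℓ, a0, a1, a2, a3, -⟩ := exists_separating_plane m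
    obtain ⟨ℓ', b1, b2, b3, -, b0⟩ := exists_separating_plane (m + 1)
    obtain ⟨ℓ'', c2, c3, -, -, c1⟩ := exists_separating_plane (m + 2)
    have e1 := key ℓ
    have e2 := key ℓ'
    have e3 := key ℓ''
    rw [Fin.sum_univ_four] at e1 e2 e3 h0
    simp only [Fin.val_zero, Fin.val_one, Fin.val_two, show ((3 : Fin 4) : ℕ) = 3 from rfl,
      add_zero] at e1 e2 e3
    rw [show m + 1 + 1 = m + 2 by omega] at b2
    rw [show m + 1 + 2 = m + 3 by omega] at b3
    rw [show m + 2 + 1 = m + 3 by omega] at c3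
    have b0' := b0 m (by omega)
    have c1' := c1 (m + 1) (by omega)
    have w3 : w 3 = 0 := by
      rw [a0, a1, a2] at e1
      exact (mul_eq_zero.1 (by linarith : w 3 * ℓ (vertex (m + 3)) = 0)).resolve_right a3.ne'
    have w0 : w 0 = 0 := by
      rw [b1, b2, b3] at e2
      exact (mul_eq_zero.1 (by linarith : w 0 * ℓ' (vertex m) = 0)).resolve_right b0'.ne
    have w1 : w 1 = 0 := by
      rw [c2, c3, w0] at e3
      exact (mul_eq_zero.1 (by linarith : w 1 * ℓ'' (vertex (m + 1)) = 0)).resolve_right c1'.ne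
    intro i
    fin_cases i
    · exact w0
    · exact w1
    · change w 2 = 0
      linarith
    · exact w3
  refine h.range.mono fun x hx => ?_
  obtain ⟨k, h1, h2, rfl⟩ := mem_stackTetra.1 hx
  exact ⟨⟨k - m, by omega⟩, by simp [Nat.add_sub_cancel' h1]⟩

lemma stackTetra_erase (m : ℕ) : (stackTetra m).erase (vertex m) = stackFace (m + 1) := by
  ext x
  rw [Finset.mem_erase, mem_stackTetra, mem_stackFace]
  constructor
  · rintro ⟨hx, k, h1, h2, rfl⟩
    have : k ≠ m := fun h => hx (by rw [h])
    exact ⟨k, by omega, by omega, rfl⟩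
  · rintro ⟨k, h1, h2, rfl⟩
    refine ⟨fun h => ?_, k, by omega, by omega, rfl⟩
    have := vertex_injective h
    omega

/-- The exposed triangle is carried along in the induction because the next tetrahedron is glued
onto it. -/
lemma exists_isTriangulatedBody_stack (m : ℕ) (hm : 1 ≤ m) :
    ∃ T, IsTriangulatedBody (stack m) T ∧ stackFace m ∈ T := by
  induction m, hm using Nat.le_induction with
  | base =>
    refine ⟨_, by
      simpa [stack] using isTriangulatedBody_singleton (card_stackTetra 0)
        (affineIndependent_stackTetra 0), ?_⟩
    rw [← stackTetra_erase]
    exact Finset.mem_image_of_mem _ (mem_stackTetra.2 ⟨0, le_rfl, by omega, rfl⟩)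
  | succ m hm ih =>
    obtain ⟨T, hT, hf⟩ := ih
    obtain ⟨ℓ, a0, a1, a2, a3, hlt⟩ := exists_separating_plane m
    have hglue := hT.glue hf (v := vertex (m + 3)) (card_stackTetra m)
      (affineIndependent_stackTetra m) (ℓ := ℓ) ?_ a3 ?_
    · rw [stack, Finset.range_add_one, Finset.image_insert]
      refine ⟨_, hglue, Finset.mem_union_right _ ?_⟩
      rw [← stackTetra_erase]
      exact Finset.mem_image_of_mem _ (mem_stackFace.2 ⟨m, le_rfl, by omega, rfl⟩)
    · intro b hb
      obtain ⟨k, h1, h2, rfl⟩ := mem_stackFace.1 hb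
      obtain rfl | rfl | rfl : k = m ∨ k = m + 1 ∨ k = m + 2 := by omega
      exacts [a0, a1, a2]
    · intro s hs b hb hbf
      obtain ⟨j, hj, rfl⟩ := Finset.mem_image.1 hs
      obtain ⟨k, h1, h2, rfl⟩ := mem_stackTetra.1 hb
      rw [Finset.mem_range] at hj
      refine hlt k ?_
      by_contra hk
      exact hbf (mem_stackFace.2 ⟨k, by omega, by omega, rfl⟩)

end

/-! ### The lower bound: one beacon for each turn of the zigzag. -/

/-- The convex hull of the vertices of the levels `l` and `l + 1`. -/
noncomputable def levelHull (l : ℕ) : Set E3 :=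
  convexHull ℝ {x | ∃ i r, r < 3 ∧ (i = l ∨ i = l + 1) ∧ x = levelVertex i r}

lemma le_zero_of_mem_levelHull {l : ℕ} {x : E3} (hx : x ∈ levelHull l) (a b c d : ℝ)
    (h : ∀ i r, r < 3 → (i = l ∨ i = l + 1) →
      a * levelVertex i r 0 + b * levelVertex i r 1 + c * levelVertex i r 2 + d ≤ 0) :
    a * x 0 + b * x 1 + c * x 2 + d ≤ 0 := by
  have hconv : Convex ℝ {y | affineForm a b c d y ≤ 0} :=
    (convex_Iic (0 : ℝ)).affine_preimage (affineForm a b c d)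
  have : x ∈ {y | affineForm a b c d y ≤ 0} := by
    refine convexHull_min ?_ hconv hx
    rintro _ ⟨i, r, hr, hi, rfl⟩
    rw [mem_ofPred_eq, affineForm_apply]
    exact h i r hr hi
  rwa [mem_ofPred_eq, affineForm_apply] at this

/-- In units of `4 ^ l` and up to sign, the first coordinate of a vertex is within `1000 ± 2` on
level `l` and within `-(4000 ± 8)` on level `l + 1`. The last two bounds interpolate these linearly
in the height. -/
lemma levelHull_bounds {l : ℕ} {x : E3} (hx : x ∈ levelHull l) :
    (l : ℝ) ≤ x 2 ∧ x 2 ≤ l + 1 ∧ -1 ≤ x 1 ∧ x 1 ≤ 1 ∧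
      4 ^ l * (998 - 5006 * (x 2 - l)) ≤ (-1) ^ l * x 0 ∧
      (-1) ^ l * x 0 ≤ 4 ^ l * (1002 - 4994 * (x 2 - l)) := by
  have hpow : (4 : ℝ) ^ (l + 1) = 4 * 4 ^ l := by ring
  have hpos : (0 : ℝ) < 4 ^ l := by positivity
  have hv : ∀ {r}, r < 3 →
      4 ^ l * 998 ≤ (-1) ^ l * levelVertex l r 0 ∧ (-1) ^ l * levelVertex l r 0 ≤ 4 ^ l * 1002 ∧
      -(4 ^ l * 4008) ≤ (-1) ^ l * levelVertex (l + 1) r 0 ∧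
      (-1) ^ l * levelVertex (l + 1) r 0 ≤ -(4 ^ l * 3992) := by
    intro r hr
    have h1 := abs_le.1 (abs_levelVertex_zero_sub_le (i := l) hr)
    have h2 := abs_le.1 (abs_levelVertex_zero_sub_le (i := l + 1) hr)
    unfold amp at h1 h2
    rw [hpow] at h2
    rcases neg_one_pow_cases l with ⟨h3, h4⟩ | ⟨h3, h4⟩ <;> rw [h3] at h1 ⊢ <;> rw [h4] at h2 <;>
      refine ⟨?_, ?_, ?_, ?_⟩ <;> linarith
  refine ⟨?_, ?_, ?_, ?_, ?_, ?_⟩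
  · have := le_zero_of_mem_levelHull hx 0 0 (-1) l (by
      rintro i r hr (rfl | rfl) <;> rw [levelVertex_two] <;> push_cast <;> linarith)
    linarith
  · have := le_zero_of_mem_levelHull hx 0 0 1 (-l - 1) (by
      rintro i r hr (rfl | rfl) <;> rw [levelVertex_two] <;> push_cast <;> linarith)
    linarith
  · have := le_zero_of_mem_levelHull hx 0 (-1) 0 (-1) (fun i r hr _ => by
      have := abs_le.1 (abs_levelVertex_one_le (i := i) hr)
      linarith)
    linarith
  · have := le_zero_of_mem_levelHull hx 0 1 0 (-1) (fun i r hr _ => by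
      have := abs_le.1 (abs_levelVertex_one_le (i := i) hr)
      linarith)
    linarith
  · have := le_zero_of_mem_levelHull hx (-(-1) ^ l) 0 (-(4 ^ l * 5006)) (4 ^ l * (998 + 5006 * l)) (by
      rintro i r hr (rfl | rfl) <;> rw [levelVertex_two] <;> push_cast <;>
        have := hv hr <;> linarith)
    linarith
  · have := le_zero_of_mem_levelHull hx ((-1) ^ l) 0 (4 ^ l * 4994) (-(4 ^ l * (1002 + 4994 * l))) (by
      rintro i r hr (rfl | rfl) <;> rw [levelVertex_two] <;> push_cast <;>
        have := hv hr <;> linarith)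
    linarith

/-- The first member of the chain outside `A` cannot be in `C`, as no step leads from `A` directly
to `C`; in particular it is not the end `q`. -/
lemma exists_mem_of_isChain {R : E3 → E3 → Prop} {A C : Set E3}
    (hR : ∀ x y, R x y → x ∈ A → y ∉ C) {q : E3} (hq : q ∈ C) {l : List E3} :
    ∀ {p}, p ∈ A → List.IsChain R (p :: (l ++ [q])) → ∃ b ∈ l, b ∉ A ∧ b ∉ C := by
  induction l with
  | nil =>
    intro p hp h
    simp at h
    exact absurd hq (hR p q h hp)
  | cons a l ih =>
    intro p hp h
    rw [List.cons_append, List.isChain_cons_cons] at h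
    by_cases ha : a ∈ A
    · obtain ⟨b, hb, hb'⟩ := ih ha h.2
      exact ⟨b, List.mem_cons_of_mem _ hb, hb'⟩
    · exact ⟨a, List.mem_cons_self, ha, hR p a h.1 hp⟩

section

variable [DecidableEq E3]

lemma exists_mem_levelHull {m : ℕ} {x : E3} (hx : x ∈ carrier (stack m)) : ∃ l, x ∈ levelHull l := by
  obtain ⟨s, hs, hxs⟩ := mem_carrier.1 hx
  obtain ⟨j, -, rfl⟩ := Finset.mem_image.1 hs
  refine ⟨(j + 2) / 3, convexHull_mono ?_ hxs⟩
  intro y hy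
  obtain ⟨k, h1, h2, rfl⟩ := mem_stackTetra.1 hy
  exact ⟨(k + 2) / 3, (k + 2) % 3, Nat.mod_lt _ (by norm_num), by omega, rfl⟩

lemma vertex_mem_carrier {m n : ℕ} (hm : 1 ≤ m) (hn : n ≤ m + 2) : vertex n ∈ carrier (stack m) := by
  refine mem_carrier.2 ⟨stackTetra (min n (m - 1)), Finset.mem_image_of_mem _ ?_,
    subset_convexHull ℝ _ (mem_stackTetra.2 ⟨n, by omega, by omega, rfl⟩)⟩
  rw [Finset.mem_range]
  omega

set_option maxHeartbeats 1000000 in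
/-- All points far below level `i` are closer to the points shortly above level `i` than to those of
level `i`. -/
lemma norm_sub_lt_of_levels {m i : ℕ} (hi : 1 ≤ i) {x y b : E3} (hx : x ∈ carrier (stack m))
    (hy : y ∈ carrier (stack m)) (hb : b ∈ carrier (stack m)) (hx2 : x 2 = i + 1 / 8)
    (hy2 : y 2 = i) (hb2 : b 2 ≤ i - 7 / 8) : ‖b - x‖ ^ 2 < ‖b - y‖ ^ 2 := by
  obtain ⟨lx, hlx⟩ := exists_mem_levelHull hx
  obtain ⟨ly, hly⟩ := exists_mem_levelHull hy
  obtain ⟨lb, hlb⟩ := exists_mem_levelHull hb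
  obtain ⟨x1, x2, x3, x4, x5, x6⟩ := levelHull_bounds hlx
  obtain ⟨y1, y2, y3, y4, y5, y6⟩ := levelHull_bounds hly
  obtain ⟨b1, b2, b3, b4, b5, b6⟩ := levelHull_bounds hlb
  have ha := cast_add_one_le_pow i
  have hi1 : (1 : ℝ) ≤ i := by exact_mod_cast hi
  set a : ℝ := 4 ^ i with hadef
  obtain ⟨j, rfl⟩ : ∃ j, i = j + 1 := ⟨i - 1, by omega⟩
  have hj : (4 : ℝ) ^ j = a / 4 := by rw [hadef, pow_succ]; ring
  have elx : lx = j + 1 := by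
    have h1 : (lx : ℝ) < (j + 2 : ℕ) := by push_cast at *; linarith
    have h2 : ((j + 1 : ℕ) : ℝ) < (lx + 1 : ℕ) := by push_cast at *; linarith
    rw [Nat.cast_lt] at h1 h2
    omega
  have ely : ly = j + 1 ∨ ly = j := by
    have h1 : (ly : ℝ) ≤ (j + 1 : ℕ) := by push_cast at *; linarith
    have h2 : ((j + 1 : ℕ) : ℝ) ≤ (ly + 1 : ℕ) := by push_cast at *; linarith
    rw [Nat.cast_le] at h1 h2
    omega
  have elb : lb ≤ j := by
    have h1 : (lb : ℝ) < (j + 1 : ℕ) := by push_cast at *; linarith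
    rw [Nat.cast_lt] at h1
    omega
  have hs : ((-1 : ℝ) ^ (j + 1)) = -(-1) ^ j := by rw [pow_succ]; ring
  set s : ℝ := (-1) ^ (j + 1) with hsdef
  have hss : s = 1 ∨ s = -1 := neg_one_pow_eq_or ℝ _
  have hsj : (-1 : ℝ) ^ j = -s := by rw [hs]; ring
  -- The interpolated bounds at one eighth of the way up: `998 - 5006 / 8` and `1002 - 4994 / 8`.
  -- The point `y` at the turn itself is at about `1000 * a`.
  have hX : s * x 0 ≤ 378 * a ∧ 372 * a ≤ s * x 0 := by
    subst elx
    rw [hx2, ← hadef, ← hsdef] at x5 x6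
    constructor <;> linarith
  have hY : 998 * a ≤ s * y 0 := by
    rcases ely with rfl | rfl
    · rw [hy2, ← hadef, ← hsdef] at y5
      linarith
    · rw [hy2, hj, hsj] at y6
      push_cast at y6
      linarith
  -- Directly below level `i`, the beacon is at most one eighth above level `i - 1` and still on the
  -- opposite side; further down, all amplitudes are at most `4008 * a / 16`.
  have hB : s * b 0 ≤ 251 * a := by
    rcases elb.eq_or_lt with rfl | hlt
    · rw [hj, hsj] at b5
      push_cast at hb2
      have := mul_le_mul_of_nonneg_left hb2 (by linarith : (0 : ℝ) ≤ a)
      linarith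
    · have h1 : (4 : ℝ) ^ lb * 16 ≤ a := by
        rw [hadef, show (16 : ℝ) = 4 ^ 2 by norm_num, ← pow_add]
        exact pow_le_pow_right₀ (by norm_num) (by omega)
      have hpos : (0 : ℝ) < 4 ^ lb := by positivity
      have h5 : -(4008 * 4 ^ lb) ≤ (-1) ^ lb * b 0 := by
        have := mul_le_mul_of_nonneg_left b2 hpos.le
        linarith
      have h6 : (-1) ^ lb * b 0 ≤ 4008 * 4 ^ lb := by
        have := mul_le_mul_of_nonneg_left b1 hpos.le
        linarith
      rcases hss with h | h <;> rcases neg_one_pow_eq_or ℝ lb with h' | h' <;>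
        rw [h'] at h5 h6 <;> rw [h] <;> linarith
  -- The contribution of the first coordinate to the difference of the squared distances. It is
  -- quadratic in `a`, while the other two coordinates lose at most `8` and `a`.
  have hprod : 500000 * (a * a) ≤ (y 0 - x 0) * (y 0 + x 0 - 2 * b 0) := by
    have h1 : 620 * a ≤ s * (y 0 - x 0) := by linarith
    have h2 : 868 * a ≤ s * (y 0 + x 0 - 2 * b 0) := by linarith
    have h3 := mul_le_mul h1 h2 (by linarith) (by linarith)
    have h4 : s * s = 1 := by rcases hss with h | h <;> rw [h] <;> norm_num
    have h5 : s * (y 0 - x 0) * (s * (y 0 + x 0 - 2 * b 0)) =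
        (s * s) * ((y 0 - x 0) * (y 0 + x 0 - 2 * b 0)) := by ring
    rw [h5, h4, one_mul] at h3
    have h6 : 620 * a * (868 * a) = 538160 * (a * a) := by ring
    have h7 := mul_self_nonneg a
    linarith only [h3, h6, h7]
  have h1 : -8 ≤ (y 1 - x 1) * (y 1 + x 1 - 2 * b 1) := by
    have h2 : |(y 1 - x 1) * (y 1 + x 1 - 2 * b 1)| ≤ 2 * 4 := by
      rw [abs_mul]
      refine mul_le_mul ?_ ?_ (abs_nonneg _) (by norm_num) <;> rw [abs_le] <;> constructor <;> linarith
    linarith [(abs_le.1 h2).1]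
  have h2 : -a ≤ (y 2 - x 2) * (y 2 + x 2 - 2 * b 2) := by
    have hb0 : (0 : ℝ) ≤ b 2 := (Nat.cast_nonneg lb).trans b1
    rw [hx2, hy2]
    linarith
  have ha1 : 2 ≤ a := by linarith
  have haa : 2 * a ≤ a * a := mul_le_mul_of_nonneg_right ha1 (by linarith only [ha1])
  rw [EuclideanSpace.norm_sq_eq, EuclideanSpace.norm_sq_eq, Fin.sum_univ_three, Fin.sum_univ_three]
  simp only [PiLp.sub_apply, Real.norm_eq_abs, sq_abs]
  linarith only [hprod, h1, h2, ha1, haa]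

/-- By the intermediate value theorem a path down to `b` passes height `i + 1 / 8` and later height
`i`, and its distance to `b` would have increased in between. -/
lemma MayCover.not_mem_lower {m i : ℕ} (hi : 1 ≤ i) {p b : E3} (h : MayCover (carrier (stack m)) b p)
    (hp : (i : ℝ) + 1 / 8 ≤ p 2) : ¬ b 2 ≤ i - 7 / 8 := by
  intro hb
  obtain ⟨L, γ, hγ, hL⟩ := h
  have hc : ContinuousOn (fun t => γ t 2) (Icc 0 L) := by
    have : Continuous fun x : E3 => x 2 := by fun_prop
    exact this.comp_continuousOn hγ.continuousOn
  have hbP : b ∈ carrier (stack m) := hL ▸ hγ.mem L ⟨hγ.length_nonneg, le_rfl⟩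
  obtain ⟨t₁, ht₁, h1⟩ := intermediate_value_Icc' hγ.length_nonneg hc
    (show (i : ℝ) + 1 / 8 ∈ Icc (γ L 2) (γ 0 2) by
      rw [hL, hγ.start]; exact ⟨by linarith, hp⟩)
  dsimp only at h1
  obtain ⟨t₂, ht₂, h2⟩ := intermediate_value_Icc' ht₁.2 (hc.mono (Icc_subset_Icc_left ht₁.1))
    (show (i : ℝ) ∈ Icc (γ L 2) (γ t₁ 2) by
      rw [hL, h1]; constructor <;> linarith)
  have ht₂' : t₂ ∈ Icc 0 L := ⟨ht₁.1.trans ht₂.1, ht₂.2⟩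
  have h3 := hγ.antitoneOn_dist ht₁ ht₂' ht₂.1
  exact not_lt.2 h3 (norm_sub_lt_of_levels hi (hγ.mem _ ht₁) (hγ.mem _ ht₂') hbP h1 h2 hb)

lemma le_card_of_canRoute_stack {m : ℕ} (hm : 1 ≤ m) {B : Finset E3}
    (hB : ∀ p ∈ carrier (stack m), ∀ q ∈ carrier (stack m),
      CanRoute (MayCover (carrier (stack m))) B p q) : (m + 1) / 3 ≤ B.card := by
  -- The numbering of the vertices starts with the last vertex of level 0, so vertex `3 * k + 1` is
  -- the first one of level `k + 1`, and it is present since the last vertex has index `m + 2`. A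
  -- route from it down to vertex 0 has to pass the `k` turns at the levels `1, …, k`.
  set k := (m + 1) / 3 with hk
  have hp : vertex (3 * k + 1) ∈ carrier (stack m) := vertex_mem_carrier hm (by omega)
  have hq : vertex 0 ∈ carrier (stack m) := vertex_mem_carrier hm (by omega)
  have hp2 : vertex (3 * k + 1) 2 = k + 1 := by
    rw [vertex_eq (i := k + 1) (r := 0) (by norm_num) (by omega), levelVertex_two]; push_cast; ring
  have hq2 : vertex 0 2 = 0 := by
    rw [vertex_eq (i := 0) (r := 2) (by norm_num) (by omega), levelVertex_two]; simp
  have key : ∀ i : ℕ, ∃ b, 1 ≤ i → i ≤ k → b ∈ B ∧ (i : ℝ) - 7 / 8 < b 2 ∧ b 2 < i + 1 / 8 := by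
    intro i
    by_cases hik : 1 ≤ i ∧ i ≤ k
    · obtain ⟨l, hl, hch⟩ := hB _ hp _ hq
      have h1 : (1 : ℝ) ≤ i := by exact_mod_cast hik.1
      have h2 : (i : ℝ) ≤ k := by exact_mod_cast hik.2
      obtain ⟨b, hb, hbA, hbC⟩ := exists_mem_of_isChain (A := {x | (i : ℝ) + 1 / 8 ≤ x 2})
        (C := {x | x 2 ≤ (i : ℝ) - 7 / 8}) (fun x y hxy hx => hxy.not_mem_lower hik.1 hx)
        (show vertex 0 2 ≤ (i : ℝ) - 7 / 8 by rw [hq2]; linarith)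
        (show (i : ℝ) + 1 / 8 ≤ vertex (3 * k + 1) 2 by rw [hp2]; linarith) hch
      exact ⟨b, fun _ _ => ⟨hl b hb, not_le.1 hbC, not_le.1 hbA⟩⟩
    -- A dummy value for the levels outside `1, …, k`.
    · exact ⟨0, fun h1 h2 => absurd ⟨h1, h2⟩ hik⟩
  choose b hb using key
  have hcard : (Finset.Icc 1 k).card ≤ B.card := by
    -- The slabs between the heights `i - 7 / 8` and `i + 1 / 8` are disjoint for different `i`, so
    -- the chosen beacons are distinct.
    refine Finset.card_le_card_of_injOn b (fun i hi => ?_) ?_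
    · have hi' := Finset.mem_Icc.1 hi
      exact (hb i hi'.1 hi'.2).1
    · have hlt : ∀ i j, 1 ≤ i → j ≤ k → i < j → b i ≠ b j := by
        intro i j hi hj hij h
        have h1 := (hb i hi (hij.le.trans hj)).2.2
        have h2 := (hb j (hi.trans hij.le) hj).2.1
        have h3 : ((i + 1 : ℕ) : ℝ) ≤ j := by exact_mod_cast hij
        push_cast at h3
        rw [h] at h1
        linarith
      intro i hi j hj hij
      have hi' := Finset.mem_Icc.1 hi
      have hj' := Finset.mem_Icc.1 hj
      rcases lt_trichotomy i j with h | h | h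
      · exact absurd hij (hlt i j hi'.1 hj'.2 h)
      · exact h
      · exact absurd hij.symm (hlt j i hj'.1 hi'.2 h)
  simpa using hcard

end

theorem mainTheorem1 :
    (∀ (P : Set E3) (S : Finset (Finset E3)),
      IsPolyhedron P → IsTetrahedralDecomposition P S →
        ∃ B : Finset E3, (B : Set E3) ⊆ P ∧ B.card ≤ (S.card + 1) / 3 ∧
          ∀ p ∈ P, ∀ q ∈ P, CanRoute (Covers P) B p q) ∧
    (∀ m : ℕ, 1 ≤ m →
      ∃ (P : Set E3) (S : Finset (Finset E3)),
        IsPolyhedron P ∧ IsTetrahedralDecomposition P S ∧ S.card = m ∧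
          ∀ B : Finset E3, (B : Set E3) ⊆ P →
            (∀ p ∈ P, ∀ q ∈ P, CanRoute (MayCover P) B p q) →
              (m + 1) / 3 ≤ B.card) := by
  classical
  refine ⟨fun P S hP hS => exists_beacons hP hS, fun m hm => ?_⟩
  obtain ⟨T, hT, -⟩ := exists_isTriangulatedBody_stack m hm
  exact ⟨carrier (stack m), stack m, hT.isPolyhedron, ⟨hT.family, rfl⟩, card_stack m,
    fun B _ hB => le_card_of_canRoute_stack hm hB⟩
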